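/- Fix the following notions, for finite alphabets $\Sigma$. A forest over $\Sigma$ is a finite (possibly empty) sequence of finite ordered unranked trees whose nodes are labelled by elements of $\Sigma$. A forest context is a forest over $\Sigma\cup\{x\}$ in which the parameter $x\notin\Sigma$ occurs exactly once, at a leaf. The forest algebra has as elements all forests and forest contexts over $\Sigma$; its operations are the constants $\varepsilon$ (the empty forest) and $x$, the unary operations $f\mapsto a(f)$ for $a\in\Sigma$, the horizontal concatenation $fg$ (defined if at least one of $f,g$ is a forest without $x$), and the vertical concatenation $f\langle g\rangle$ (defined if $f$ is a forest context; it replaces $x$ in $f$ by $g$). A cluster is a tree over $\Sigma$ with at least two nodes (rank $0$), or such a tree together with a distinguished leaf, its bottom boundary node (rank $1$). The cluster algebra has as elements all clusters; its operations are the constants $a(b)$ and $a(\underline b)$ for $a,b\in\Sigma$ (in the latter the leaf $b$ is distinguished), the horizontal merge $a(f)\odot a(g)=a(fg)$ (defined if the root labels coincide and at least one of the two clusters has rank $0$), and the vertical merge of $s$ and $t$ (defined if $s$ has rank $1$ and its bottom boundary node has the same label as the root of $t$), which replaces the bottom boundary node of $s$ by $t$. A straight-line program (SLP) over such an algebra consists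 of a finite set of variables, a start variable, and for each variable $A$ a right-hand side $f(A_1,\dots,A_k)$, where $f$ is an operation of arity $k\in\{0,1,2\}$ of the algebra and $A_1,\dots,A_k$ are variables, such that the relation "$B$ occurs in the right-hand side of $A$" is acyclic. Evaluating right-hand sides gives each variable a (possibly undefined) value; the value $\mathrm{val}(P)$ of the program $P$ is the value of its start variable. A forest straight-line program (FSLP) is an SLP over the forest algebra in which every variable has a defined value and whose value is a forest without $x$. A top dag is an SLP over the cluster algebra whose value is defined and is a tree (a cluster of rank $0$). A forest automaton over $\Sigma$ consists of a finite set $Q$ of states, a finite set of transition rules $a(R)\to q$ with $a\in\Sigma$, $q\in Q$ and $R\subseteq Q^*$ a regular language, and a regular language $L\subseteq Q^*$; the languages $R$ and $L$ are given by nondeterministic finite automata. A run on a forest labels its nodes by states so that for each node with label $a$, state $q$ and children with states $q_1,\dots,q_m$ (in order) there is a rule $a(R)\to q$ with $q_1\cdots q_m\in R$. The automaton accepts a forest if there is a run on it for which the word of states at the roots belongs to $L$. **Statement.** There is a deterministic polynomial-time algorithm that, given a finite alphabet $\Sigma$, a forest automaton $A$ over $\Sigma$ and an FSLP $F$ over $\Sigma$,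 decides whether $A$ accepts $\mathrm{val}(F)$. There is also a deterministic polynomial-time algorithm that, given $\Sigma$, a forest automaton $A$ over $\Sigma$ and a top dag $D$ over $\Sigma$, decides whether $A$ accepts the tree $\mathrm{val}(D)$. (Polynomial time means: on a multi-stack Turing machine, in a number of steps bounded by a polynomial in the length of an explicit bit-string encoding of the input, in which letters, states and variables are numbered and the numbers are written in unary.) -/

import Mathlib

namespace ForestSLP

/-! ### Straight-line programs over partial algebras -/

/-- An algebraic structure with carrier `C`, whose operations are constants indexed by `K`,
unary operations indexed by `U` and partial binary operations indexed by `B`. -/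
structure PartialAlgebra (K U B C : Type) where
  const : K → C
  un : U → C → C
  bin : B → C → C → Option C

/-- A right-hand side: one operation applied to variables from `V`. -/
inductive Rhs (K U B V : Type) where
  | const (k : K)
  | un (a : U) (A : V)
  | bin (b : B) (A₁ A₂ : V)

/-- The variables occurring in a right-hand side. -/
def Rhs.vars {K U B V : Type} : Rhs K U B V → List V
  | .const _ => []
  | .un _ A => [A]
  | .bin _ A₁ A₂ => [A₁, A₂]

/-- A straight-line program with variables `0, …, size - 1`, a start variable, and for every
variable a right-hand side, such that the edge relation "`A'` occurs in the right-hand side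
of `A`" is acyclic. -/
structure SLP (K U B : Type) where
  size : ℕ
  start : Fin size
  rhs : Fin size → Rhs K U B (Fin size)
  acyclic : ∀ A, ¬ Relation.TransGen (fun A A' => A' ∈ (rhs A).vars) A A

/-- `P.HasValue alg A v`: the value of the variable `A` of `P` in `alg` is defined and is `v`. -/
inductive SLP.HasValue {K U B C : Type} (alg : PartialAlgebra K U B C) (P : SLP K U B) :
    Fin P.size → C → Prop
  | const {A : Fin P.size} {k : K} (h : P.rhs A = .const k) :
      SLP.HasValue alg P A (alg.const k)
  | un {A A₁ : Fin P.size} {a : U} {v : C} (h : P.rhs A = .un a A₁)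
      (h₁ : SLP.HasValue alg P A₁ v) :
      SLP.HasValue alg P A (alg.un a v)
  | bin {A A₁ A₂ : Fin P.size} {b : B} {v₁ v₂ v : C} (h : P.rhs A = .bin b A₁ A₂)
      (h₁ : SLP.HasValue alg P A₁ v₁) (h₂ : SLP.HasValue alg P A₂ v₂)
      (hv : alg.bin b v₁ v₂ = some v) :
      SLP.HasValue alg P A v

theorem SLP.HasValue.unique {K U B C : Type} {alg : PartialAlgebra K U B C} {P : SLP K U B}
    {A : Fin P.size} {v w : C} (hv : P.HasValue alg A v) (hw : P.HasValue alg A w) : v = w := by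
  induction hv generalizing w with
  | const h => cases hw <;> simp_all
  | un h _ ih =>
    cases hw with
    | const h' => simp_all
    | un h' h₁' =>
      rw [h] at h'
      cases h'
      rw [ih h₁']
    | bin h' => simp_all
  | bin h _ _ hv ih₁ ih₂ =>
    cases hw with
    | const h' => simp_all
    | un h' => simp_all
    | bin h' h₁' h₂' hw' =>
      rw [h] at h'
      cases h'
      rw [ih₁ h₁', ih₂ h₂', hw'] at hv
      exact (Option.some.inj hv).symm

/-! ### Forests and forest contexts -/

/-- Finite ordered forests with node labels in `α`: the empty forest `nil`, and `cons a f g`,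
the forest `a(f) g` whose first tree has root label `a` and children forest `f`, followed by the
trees of `g`. A tree is a forest of the form `cons a f nil`. -/
inductive Forest (α : Type) where
  | nil
  | cons (a : α) (children siblings : Forest α)

/-- Concatenation of forests. -/
def Forest.append {α : Type} : Forest α → Forest α → Forest α
  | .nil, h => h
  | .cons a f g, h => .cons a f (g.append h)

/-- Forest contexts: forests with labels in `α ∪ {x}` in which the parameter `x` occurs exactly
once, at a leaf. `hole g` is `x g`, `right a f c` is `a(f) c`, and `down a c g` is `a(c) g`. -/
inductive Ctx (α : Type) where
  | hole (g : Forest α)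
  | right (a : α) (f : Forest α) (c : Ctx α)
  | down (a : α) (c : Ctx α) (g : Forest α)

namespace Ctx

variable {α : Type}

/-- `f c`, for a forest `f` and a context `c`. -/
def appendLeft : Forest α → Ctx α → Ctx α
  | .nil, c => c
  | .cons a f g, c => .right a f (appendLeft g c)

/-- `c h`, for a context `c` and a forest `h`. -/
def appendRight : Ctx α → Forest α → Ctx α
  | .hole g, h => .hole (g.append h)
  | .right a f c, h => .right a f (c.appendRight h)
  | .down a c g, h => .down a c (g.append h)

/-- `c⟨h⟩` for a forest `h`. -/
def plug : Ctx α → Forest α → Forest α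
  | .hole g, h => h.append g
  | .right a f c, h => .cons a f (c.plug h)
  | .down a c g, h => .cons a (c.plug h) g

/-- `c⟨d⟩` for a context `d`. -/
def comp : Ctx α → Ctx α → Ctx α
  | .hole g, d => d.appendRight g
  | .right a f c, d => .right a f (c.comp d)
  | .down a c g, d => .down a (c.comp d) g

end Ctx

/-- Names of the two binary operations: horizontal and vertical. -/
inductive BinOp where
  | hor
  | ver

/-! ### The forest algebra and forest straight-line programs -/

/-- Names of the constants of the forest algebra: the empty forest and the parameter `x`. -/
inductive FAConst where
  | eps
  | param

/-- The forest algebra over `α`. Its carrier consists of the forests (`Sum.inl`) and the forest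
contexts (`Sum.inr`); every label `a` gives the unary operation `f ↦ a(f)`. -/
def forestAlgebra (α : Type) : PartialAlgebra FAConst α BinOp (Forest α ⊕ Ctx α) where
  const
    | .eps => .inl .nil
    | .param => .inr (.hole .nil)
  un a
    | .inl f => .inl (.cons a f .nil)
    | .inr c => .inr (.down a c .nil)
  bin
    | .hor, .inl f, .inl g => some (.inl (f.append g))
    | .hor, .inl f, .inr c => some (.inr (Ctx.appendLeft f c))
    | .hor, .inr c, .inl f => some (.inr (c.appendRight f))
    | .hor, .inr _, .inr _ => none
    | .ver, .inl _, _ => none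
    | .ver, .inr c, .inl f => some (.inl (c.plug f))
    | .ver, .inr c, .inr d => some (.inr (c.comp d))

/-- A forest straight-line program over the labels `0, …, σ - 1`: a straight-line program over the
forest algebra in which all variables have a defined value and whose start variable produces a
forest without parameter. -/
structure FSLP (σ : ℕ) extends SLP FAConst (Fin σ) BinOp where
  valid : ∀ A, ∃ v, toSLP.HasValue (forestAlgebra (Fin σ)) A v
  ground : ∃ f, toSLP.HasValue (forestAlgebra (Fin σ)) start (.inl f)

/-- The forest produced by an FSLP. -/
noncomputable def FSLP.val {σ : ℕ} (F : FSLP σ) : Forest (Fin σ) :=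
  F.ground.choose

/-! ### The cluster algebra and top dags -/

/-- Clusters over `α`. A cluster of rank 0 is a tree `a(f)` with at least two nodes. A cluster of
rank 1 is a tree with at least two nodes and a distinguished leaf, the bottom boundary node;
`rank1 a c b` is the tree `a(c⟨b⟩)`, where `b` is the label of the distinguished leaf and the
context `c` is what is left of the children forest when this leaf is replaced by `x`. -/
inductive Cluster (α : Type) where
  | rank0 (a : α) (f : Forest α) (hf : f ≠ .nil)
  | rank1 (a : α) (c : Ctx α) (b : α)

theorem Forest.append_ne_nil {α : Type} {f : Forest α} (hf : f ≠ .nil) (g : Forest α) :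
    f.append g ≠ .nil := by
  cases f with
  | nil => exact absurd rfl hf
  | cons a f g => simp [Forest.append]

theorem Ctx.plug_ne_nil {α : Type} (c : Ctx α) {f : Forest α} (hf : f ≠ .nil) :
    c.plug f ≠ .nil := by
  cases c with
  | hole g => exact Forest.append_ne_nil hf g
  | right a f c => simp [Ctx.plug]
  | down a c g => simp [Ctx.plug]

/-- Names of the constants of the cluster algebra: the atomic clusters `a(b)`, and `a(b)` with
bottom boundary node `b`. -/
inductive CAConst (α : Type) where
  | atom (a b : α)
  | atomBot (a b : α)

/-- Horizontal merge of clusters. -/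
def Cluster.hmerge {α : Type} [DecidableEq α] : Cluster α → Cluster α → Option (Cluster α)
  | .rank0 a f hf, .rank0 a' g _ =>
    if a = a' then some (.rank0 a (f.append g) (Forest.append_ne_nil hf g)) else none
  | .rank0 a f _, .rank1 a' c b => if a = a' then some (.rank1 a (Ctx.appendLeft f c) b) else none
  | .rank1 a c b, .rank0 a' g _ => if a = a' then some (.rank1 a (c.appendRight g) b) else none
  | .rank1 _ _ _, .rank1 _ _ _ => none

/-- Vertical merge of clusters. -/
def Cluster.vmerge {α : Type} [DecidableEq α] : Cluster α → Cluster α → Option (Cluster α)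
  | .rank0 _ _ _, _ => none
  | .rank1 a c b, .rank0 a' f _ =>
    if b = a' then
      some (.rank0 a (c.plug (.cons a' f .nil)) (c.plug_ne_nil (by simp)))
    else none
  | .rank1 a c b, .rank1 a' d b' =>
    if b = a' then some (.rank1 a (c.comp (.down a' d .nil)) b') else none

/-- The cluster algebra over `α`; it has no unary operations. -/
def clusterAlgebra (α : Type) [DecidableEq α] :
    PartialAlgebra (CAConst α) Empty BinOp (Cluster α) where
  const
    | .atom a b => .rank0 a (.cons b .nil .nil) (by simp)
    | .atomBot a b => .rank1 a (.hole .nil) b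
  un a := a.elim
  bin
    | .hor => Cluster.hmerge
    | .ver => Cluster.vmerge

/-- A top dag over the labels `0, …, σ - 1`: a straight-line program over the cluster algebra whose
value is defined and is a tree (a cluster of rank 0). -/
structure TopDag (σ : ℕ) extends SLP (CAConst (Fin σ)) Empty BinOp where
  ground : ∃ a f hf, toSLP.HasValue (clusterAlgebra (Fin σ)) start (.rank0 a f hf)

/-- The tree produced by a top dag, as a forest consisting of one tree. -/
noncomputable def TopDag.val {σ : ℕ} (D : TopDag σ) : Forest (Fin σ) :=
  .cons D.ground.choose D.ground.choose_spec.choose .nil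

/-! ### Forest automata -/

/-- A finite description of a nondeterministic finite automaton with states `0, …, size - 1`
that reads words over the alphabet `0, …, k - 1`. -/
structure WordAutomaton (k : ℕ) where
  size : ℕ
  start : List (Fin size)
  accept : List (Fin size)
  trans : List (Fin size × Fin k × Fin size)

/-- The automaton described by a `WordAutomaton`. -/
def WordAutomaton.toNFA {k : ℕ} (N : WordAutomaton k) : NFA (Fin k) (Fin N.size) where
  step p s := {p' | (p, s, p') ∈ N.trans}
  start := {p | p ∈ N.start}
  accept := {p | p ∈ N.accept}

/-- A transition rule `a(R) → q`, where the horizontal language `R` is a regular language of words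
over the set of states, given by a nondeterministic finite automaton. -/
structure Rule (σ k : ℕ) where
  label : Fin σ
  horizontal : WordAutomaton k
  target : Fin k

/-- A (nondeterministic) forest automaton over the labels `0, …, σ - 1` with states
`0, …, states - 1`: finitely many transition rules `a(R) → q` and a regular language of accepting
words over the set of states, given by a nondeterministic finite automaton. -/
structure ForestAutomaton (σ : ℕ) where
  states : ℕ
  rules : List (Rule σ states)
  final : WordAutomaton states

/-- `M.Run f w`: there is a run of `M` on the forest `f` (a labelling of the nodes by states that is
consistent at every node with some transition rule) for which `w` is the word of states at the roots
of `f`. -/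
inductive ForestAutomaton.Run {σ : ℕ} (M : ForestAutomaton σ) :
    Forest (Fin σ) → List (Fin M.states) → Prop
  | nil : ForestAutomaton.Run M .nil []
  | cons {f g : Forest (Fin σ)} {u w : List (Fin M.states)} {r : Rule σ M.states}
      (hr : r ∈ M.rules) (hf : ForestAutomaton.Run M f u) (hu : u ∈ r.horizontal.toNFA.accepts)
      (hg : ForestAutomaton.Run M g w) :
      ForestAutomaton.Run M (.cons r.label f g) (r.target :: w)

/-- `M` accepts `f` if `M` has a run on `f` whose word of root states is accepting. -/
def ForestAutomaton.Accepts {σ : ℕ} (M : ForestAutomaton σ) (f : Forest (Fin σ)) : Prop :=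
  ∃ w, M.Run f w ∧ w ∈ M.final.toNFA.accepts

/-! ### Inputs and their binary encodings -/

/-- An input consisting of an alphabet size, a forest automaton and an FSLP. -/
structure FSLPInput where
  σ : ℕ
  automaton : ForestAutomaton σ
  program : FSLP σ

/-- An input consisting of an alphabet size, a forest automaton and a top dag. -/
structure TopDagInput where
  σ : ℕ
  automaton : ForestAutomaton σ
  program : TopDag σ

/-- `n` is written as `n` times `1`, followed by `0`. -/
def encNat (n : ℕ) : List Bool := List.replicate n true ++ [false]

def encFin {n : ℕ} (i : Fin n) : List Bool := encNat i

/-- Every entry of a list is preceded by `1`, and the end of the list is marked by `0`. -/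
def encList {α : Type} (e : α → List Bool) (l : List α) : List Bool :=
  l.flatMap (fun x => true :: e x) ++ [false]

def encTriple {k m : ℕ} (t : Fin m × Fin k × Fin m) : List Bool :=
  encFin t.1 ++ encFin t.2.1 ++ encFin t.2.2

def encWordAutomaton {k : ℕ} (N : WordAutomaton k) : List Bool :=
  encNat N.size ++ encList encFin N.start ++ encList encFin N.accept ++ encList encTriple N.trans

def encRule {σ k : ℕ} (r : Rule σ k) : List Bool :=
  encFin r.label ++ encFin r.target ++ encWordAutomaton r.horizontal

def encForestAutomaton {σ : ℕ} (M : ForestAutomaton σ) : List Bool :=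
  encNat M.states ++ encList encRule M.rules ++ encWordAutomaton M.final

def encBinOp : BinOp → List Bool
  | .hor => [false]
  | .ver => [true]

def encFAConst : FAConst → List Bool
  | .eps => [false]
  | .param => [true]

def encCAConst {σ : ℕ} : CAConst (Fin σ) → List Bool
  | .atom a b => false :: (encFin a ++ encFin b)
  | .atomBot a b => true :: (encFin a ++ encFin b)

def encRhs {K U : Type} (eK : K → List Bool) (eU : U → List Bool) {n : ℕ} :
    Rhs K U BinOp (Fin n) → List Bool
  | .const k => encNat 0 ++ eK k
  | .un a A => encNat 1 ++ eU a ++ encFin A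
  | .bin b A₁ A₂ => encNat 2 ++ encBinOp b ++ encFin A₁ ++ encFin A₂

def encSLP {K U : Type} (eK : K → List Bool) (eU : U → List Bool) (P : SLP K U BinOp) :
    List Bool :=
  encNat P.size ++ encFin P.start ++ encList (encRhs eK eU) (List.ofFn P.rhs)

def FSLPInput.encode (x : FSLPInput) : List Bool :=
  encNat x.σ ++ encForestAutomaton x.automaton ++ encSLP encFAConst encFin x.program.toSLP

def TopDagInput.encode (x : TopDagInput) : List Bool :=
  encNat x.σ ++ encForestAutomaton x.automaton ++
    encSLP encCAConst (fun e : Empty => e.elim) x.program.toSLP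

open Classical in
/-- The answer to the question whether the automaton accepts the forest produced by the FSLP. -/
noncomputable def FSLPInput.answer (x : FSLPInput) : Bool :=
  decide (x.automaton.Accepts x.program.val)

open Classical in
/-- The answer to the question whether the automaton accepts the tree produced by the top dag. -/
noncomputable def TopDagInput.answer (x : TopDagInput) : Bool :=
  decide (x.automaton.Accepts x.program.val)

end ForestSLP

/-!
A forest automaton `M` and a program for a forest `f`, both given by one input word `w`, are turned
into a question about a fixed Datalog program over the positions of `w`: membership of a fact
`accept()` in its least model. A fixed Datalog program has polynomially many facts over `w`, so its
least model is reached after polynomially many rounds, and a stack machine can compute it.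

*The machine.* `StackProg` is a small structured language (stack operations, sequence, and the loop
"while stack `k` is nonempty"), and `StackProg.polyTime` translates terminating programs with a
polynomial step bound into machines of type `TM2`. Every register of the evaluator is a position in
`w`, kept as a copy of `w` that is split between two stacks; hence testing a bit, moving by one, and
looping over all positions are direct. The set of derived facts is a table, split between two stacks
as well: the entry with the number `index (t₁, …, tᵣ)` is the finite set of all predicates that hold
for `(t₁, …, tᵣ)`. Nested loops over the positions move to an entry (`exists_exec_access`), apply
all rules for all values of their variables (`exists_exec_forAllProg`), and repeat such rounds more
often than there are facts (`exists_exec_repeatAll`). The resulting theorem about Datalog is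
`Datalog.polyTime_derivable`.

*The Datalog program.* The value of a variable of the straight-line program may be exponentially
large, but all that matters about a forest `f` is the relation `M.Reads f N s t` between states `s`
and `t` of the horizontal word automata `N` of `M`: some run of `M` on `f` has a word of root states
that leads `N` from `s` to `t`. Likewise a context `c` matters only through the relation
`M.CtxReads c N s t N' p q`: if `N'` can go from `p` to `q` on what is substituted for the
parameter, then `N` can go from `s` to `t` on the result. These relations are computed
compositionally: `reads_append`, `reads_plug`, `ctxReads_appendLeft`, `ctxReads_appendRight` and
`ctxReads_comp` express the relations of a concatenation by those of its arguments, and these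
equivalences are rules. The remaining rules parse `w`. A cluster is handled as its root label
together with the forest or context below the root (`Cluster.content`); this turns horizontal merges
into concatenations, and in a vertical merge the whole tree or context of the second cluster
(`Cluster.full`) is substituted. `Problem` is the common abstraction of the two situations.

*Correctness.* Soundness holds because the intended meaning `Problem.Sem` of the predicates is a
model of the rules (`isModel_common`, `isModel_fslpRule`, `isModel_topDagRule`). Completeness is an
induction on the derivation of `HasValue` (`FSLPInput.complete`, `TopDagInput.complete`); as the
variables of the rules range only over `0, …, |w|`, all positions, labels, states and program
variables have to be bounded by `|w|`, which holds since numbers are encoded in unary.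
-/


open Turing StateTransition

/-! ### A structured language for stack machines -/

/-- Structured programs acting on a finite control state in `σ` and on stacks indexed by `K`.
The only control structures are sequential composition and the loop "while stack `k` is
nonempty". -/
inductive StackProg {K : Type} (Γ : K → Type) (σ : Type) where
  | push (k : K) (f : σ → Γ k)
  | pop (k : K) (f : σ → Option (Γ k) → σ)
  | peek (k : K) (f : σ → Option (Γ k) → σ)
  | load (f : σ → σ)
  | seq (p q : StackProg Γ σ)
  | loop (k : K) (p : StackProg Γ σ)

namespace StackProg

variable {K : Type} [DecidableEq K] {Γ : K → Type} {σ : Type}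

/-- `Runs p v S v' S' t`: started with control state `v` and stacks `S`, the program `p` stops
after exactly `t` steps with control state `v'` and stacks `S'`. -/
inductive Runs : StackProg Γ σ → σ → (∀ k, List (Γ k)) → σ → (∀ k, List (Γ k)) → ℕ → Prop
  | push (k f v S) : Runs (.push k f) v S v (Function.update S k (f v :: S k)) 1
  | pop (k f v S) :
      Runs (.pop k f) v S (f v (S k).head?) (Function.update S k (S k).tail) 1
  | peek (k f v S) : Runs (.peek k f) v S (f v (S k).head?) S 1
  | load (f v S) : Runs (.load f) v S (f v) S 1
  | seq {p q v S v₁ S₁ v₂ S₂ t u} (hp : Runs p v S v₁ S₁ t) (hq : Runs q v₁ S₁ v₂ S₂ u) :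
      Runs (.seq p q) v S v₂ S₂ (t + u)
  | loop_done {k p v S} (h : S k = []) : Runs (.loop k p) v S v S 1
  | loop_step {k p v S v₁ S₁ v₂ S₂ t u} (h : S k ≠ []) (hp : Runs p v S v₁ S₁ t)
      (hl : Runs (.loop k p) v₁ S₁ v₂ S₂ u) : Runs (.loop k p) v S v₂ S₂ (1 + t + u)

/-- The labels of the machine code of a program. -/
def Label : StackProg Γ σ → Type
  | .push _ _ => Unit
  | .pop _ _ => Unit
  | .peek _ _ => Unit
  | .load _ => Unit
  | .seq p q => p.Label ⊕ q.Label
  | .loop _ p => Option p.Label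

instance Label.fintype : ∀ p : StackProg Γ σ, Fintype p.Label
  | .push _ _ => inferInstanceAs (Fintype Unit)
  | .pop _ _ => inferInstanceAs (Fintype Unit)
  | .peek _ _ => inferInstanceAs (Fintype Unit)
  | .load _ => inferInstanceAs (Fintype Unit)
  | .seq p q =>
    have := Label.fintype p
    have := Label.fintype q
    inferInstanceAs (Fintype (p.Label ⊕ q.Label))
  | .loop _ p =>
    have := Label.fintype p
    inferInstanceAs (Fintype (Option p.Label))

/-- The label at which the machine code of a program starts. -/
def entry : ∀ p : StackProg Γ σ, p.Label
  | .push _ _ => ()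
  | .pop _ _ => ()
  | .peek _ _ => ()
  | .load _ => ()
  | .seq p _ => .inl p.entry
  | .loop _ _ => none

/-- The machine code of a program, where the labels of the program are embedded into `L` by `ι`
and the code jumps to `x` when the program stops. The Boolean component of the state of the machine
holds the outcome of the last loop test. -/
def code {L : Type} : ∀ p : StackProg Γ σ, (p.Label → L) → L → p.Label →
    TM2.Stmt Γ L (σ × Bool)
  | .push k f, _, x, _ => .push k (fun v => f v.1) (.goto fun _ => x)
  | .pop k f, _, x, _ => .pop k (fun v o => (f v.1 o, v.2)) (.goto fun _ => x)
  | .peek k f, _, x, _ => .peek k (fun v o => (f v.1 o, v.2)) (.goto fun _ => x)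
  | .load f, _, x, _ => .load (fun v => (f v.1, v.2)) (.goto fun _ => x)
  | .seq p q, ι, _, .inl l => p.code (fun l => ι (.inl l)) (ι (.inr q.entry)) l
  | .seq _ q, ι, x, .inr l => q.code (fun l => ι (.inr l)) x l
  | .loop k p, ι, x, none =>
    .peek k (fun v o => (v.1, o.isSome))
      (.branch (fun v => v.2) (.goto fun _ => ι (some p.entry)) (.goto fun _ => x))
  | .loop _ p, ι, _, some l => p.code (fun l => ι (some l)) (ι none) l

/-- A run of a program is simulated by its machine code, wherever the code is embedded in a machine,
in exactly the same number of steps. -/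
theorem Runs.steps {L : Type} {M : L → TM2.Stmt Γ L (σ × Bool)} {p : StackProg Γ σ}
    {v v' : σ} {S S' : ∀ k, List (Γ k)} {t : ℕ} (h : Runs p v S v' S' t) :
    ∀ (ι : p.Label → L) (x : L), (∀ l, M (ι l) = p.code ι x l) → ∀ b, ∃ b',
      (flip bind (TM2.step M))^[t] (some ⟨some (ι p.entry), (v, b), S⟩) =
        some ⟨some x, (v', b'), S'⟩ := by
  induction h with
  | push k f v S =>
    intro ι x hM b
    exact ⟨b, by simp [flip, TM2.step, hM, code]⟩
  | pop k f v S =>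
    intro ι x hM b
    exact ⟨b, by simp [flip, TM2.step, hM, code]⟩
  | peek k f v S =>
    intro ι x hM b
    exact ⟨b, by simp [flip, TM2.step, hM, code]⟩
  | load f v S =>
    intro ι x hM b
    exact ⟨b, by simp [flip, TM2.step, hM, code]⟩
  | @seq p q v S v₁ S₁ v₂ S₂ t u hp hq ihp ihq =>
    intro ι x hM b
    obtain ⟨b₁, h₁⟩ := ihp (fun l => ι (.inl l)) (ι (.inr q.entry)) (fun l => hM (.inl l)) b
    obtain ⟨b₂, h₂⟩ := ihq (fun l => ι (.inr l)) x (fun l => hM (.inr l)) b₁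
    refine ⟨b₂, ?_⟩
    rw [add_comm, Function.iterate_add_apply]
    exact (congrArg _ h₁).trans h₂
  | @loop_done k p v S h =>
    intro ι x hM b
    have := hM none
    refine ⟨false, ?_⟩
    simp only [Function.iterate_one, flip, Option.bind_eq_bind, Option.bind_some, entry]
    rw [TM2.step, this]
    simp [code, h]
  | @loop_step k p v S v₁ S₁ v₂ S₂ t u h hp hl ihp ihl =>
    intro ι x hM b
    obtain ⟨b₁, h₁⟩ := ihp (fun l => ι (some l)) (ι none) (fun l => hM (some l)) true
    obtain ⟨b₂, h₂⟩ := ihl ι x hM b₁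
    refine ⟨b₂, ?_⟩
    have h₀ : (flip bind (TM2.step M))^[1] (some ⟨some (ι (entry (.loop k p))), (v, b), S⟩) =
        some ⟨some (ι (some p.entry)), (v, true), S⟩ := by
      have := hM none
      simp only [Function.iterate_one, flip, Option.bind_eq_bind, Option.bind_some, entry]
      rw [TM2.step, this]
      cases hk : S k with
      | nil => exact absurd hk h
      | cons c l => simp [code, hk]
    rw [show 1 + t + u = u + (t + 1) by ring, Function.iterate_add_apply,
      Function.iterate_add_apply, h₀]
    exact (congrArg _ h₁).trans h₂

/-- The machine executing a program; its additional label `none` resets the state and halts. -/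
def machine [Fintype K] [Fintype σ] (p : StackProg Γ σ) (k₀ k₁ : K) [Fintype (Γ k₀)] (v₀ : σ) :
    FinTM2 where
  K := K
  k₀ := k₀
  k₁ := k₁
  Γ := Γ
  Λ := Option p.Label
  main := some p.entry
  σ := σ × Bool
  initialState := (v₀, false)
  m
    | none => .load (fun _ => (v₀, false)) .halt
    | some l => p.code some none l

theorem dite_eq_update (k₀ : K) (s : List (Γ k₀)) :
    (fun k => if h : k = k₀ then Eq.mpr (congrArg (fun k => List (Γ k)) h) s else []) =
      Function.update (fun k => ([] : List (Γ k))) k₀ s := by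
  funext k
  by_cases hk : k = k₀
  · subst hk
    simp
  · simp [hk]

/-- A program that erases its input, leaves the answer as the only entry of all stacks, and runs in
polynomial time gives a polynomial-time machine. -/
theorem polyTime [Fintype K] [Fintype σ] (p : StackProg Γ σ) {k₀ k₁ : K} [Fintype (Γ k₀)]
    (e₀ : Γ k₀ ≃ Bool) (e₁ : Γ k₁ ≃ Bool) (v₀ : σ) {α : Type} (enc : α → List Bool)
    (ans : α → Bool) (c : Polynomial ℕ)
    (h : ∀ x, ∃ v t, t ≤ c.eval (enc x).length ∧
      Runs p v₀ (Function.update (fun _ => []) k₀ ((enc x).map e₀.symm)) v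
        (Function.update (fun _ => []) k₁ [e₁.symm (ans x)]) t) :
    Nonempty (TM2ComputableInPolyTime enc Computability.encodeBool ans) := by
  choose v t ht hr using h
  refine ⟨⟨⟨machine p k₀ k₁ v₀, e₀, e₁⟩, c + 1, fun x => ⟨⟨t x + 1, ?_⟩, ?_⟩⟩⟩
  · obtain ⟨b, hb⟩ := (hr x).steps (M := (machine p k₀ k₁ v₀).m) some none (fun l => rfl) false
    rw [add_comm, Function.iterate_add_apply]
    have hi : initList (machine p k₀ k₁ v₀) ((enc x).map e₀.symm) =
        (⟨some (some p.entry), (v₀, false),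
          Function.update (fun _ => []) k₀ ((enc x).map e₀.symm)⟩ :
          TM2.Cfg Γ (Option p.Label) (σ × Bool)) :=
      congrArg (TM2.Cfg.mk _ _) (dite_eq_update k₀ _)
    have hf : haltList (machine p k₀ k₁ v₀) (show List (Γ k₁) from [e₁.symm (ans x)]) =
        (⟨none, (v₀, false), Function.update (fun _ => []) k₁ [e₁.symm (ans x)]⟩ :
          TM2.Cfg Γ (Option p.Label) (σ × Bool)) :=
      congrArg (TM2.Cfg.mk _ _) (dite_eq_update k₁ _)
    change (flip bind _)^[1] ((flip bind _)^[t x] (some (initList _ ((enc x).map e₀.symm)))) =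
      some (haltList (machine p k₀ k₁ v₀) (show List (Γ k₁) from [e₁.symm (ans x)]))
    rw [hi, hf]
    exact (congrArg _ hb).trans rfl
  · simpa using ht x

end StackProg

/-! ### Registers and a table on stacks -/

namespace Datalog

open StackProg

/-- The stacks of the evaluator, for registers `R`: an input stack, an output stack, for every
register two stacks holding a word to the left and to the right of a position in it, and two
stacks holding the table to the left and to the right of a position in it. -/
inductive Stk (R : Type) where
  | inp
  | out
  | left (r : R)
  | right (r : R)
  | tabLeft
  | tabRight
  deriving DecidableEq, Fintype

/-- The entries of the table are sets of predicates; all other stacks hold bits. -/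
abbrev Sym (P R : Type) : Stk R → Type
  | .tabLeft => Finset P
  | .tabRight => Finset P
  | _ => Bool

/-- The control state of the evaluator: a flag that accumulates the outcomes of tests, and two
buffers for moving a bit or a table entry from one stack to another. -/
abbrev Ctl (P : Type) : Type := Bool × Bool × Finset P

/-- Programs of the evaluator. -/
abbrev Prog (P R : Type) : Type := StackProg (K := Stk R) (Sym P R) (Ctl P)

/-- The contents of all stacks. -/
structure Store (P R : Type) where
  inp : List Bool
  out : List Bool
  left : R → List Bool
  right : R → List Bool
  tabLeft : List (Finset P)
  tabRight : List (Finset P)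

variable {P R : Type}

/-- The contents of the stacks as a family. -/
def Store.stk (s : Store P R) : ∀ k : Stk R, List (Sym P R k)
  | .inp => s.inp
  | .out => s.out
  | .left r => s.left r
  | .right r => s.right r
  | .tabLeft => s.tabLeft
  | .tabRight => s.tabRight

section Update

variable [DecidableEq R] (s : Store P R)

theorem Store.update_inp (l : List Bool) :
    Function.update s.stk .inp l = { s with inp := l }.stk := by
  funext k; cases k <;> simp [Function.update, Store.stk]

theorem Store.update_out (l : List Bool) :
    Function.update s.stk .out l = { s with out := l }.stk := by
  funext k; cases k <;> simp [Function.update, Store.stk]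

theorem Store.update_tabLeft (l : List (Finset P)) :
    Function.update s.stk .tabLeft l = { s with tabLeft := l }.stk := by
  funext k; cases k <;> simp [Function.update, Store.stk]

theorem Store.update_tabRight (l : List (Finset P)) :
    Function.update s.stk .tabRight l = { s with tabRight := l }.stk := by
  funext k; cases k <;> simp [Function.update, Store.stk]

theorem Store.update_left (r : R) (l : List Bool) :
    Function.update s.stk (.left r) l = { s with left := Function.update s.left r l }.stk := by
  funext k
  cases k with
  | left r' =>
    by_cases h : r' = r
    · subst h; simp [Store.stk]
    · simp [Store.stk, h]
  | _ => simp [Function.update, Store.stk]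

theorem Store.update_right (r : R) (l : List Bool) :
    Function.update s.stk (.right r) l = { s with right := Function.update s.right r l }.stk := by
  funext k
  cases k with
  | right r' =>
    by_cases h : r' = r
    · subst h; simp [Store.stk]
    · simp [Store.stk, h]
  | _ => simp [Function.update, Store.stk]

end Update

/-- The logical contents of the table: a finite set of facts, each consisting of a predicate and the
index of the table entry in which it is recorded; the number of entries; the current position; and
the flag of the control state. -/
structure Data (P : Type) where
  facts : Finset (P × ℕ)
  size : ℕ
  pos : ℕ
  flag : Bool

variable [DecidableEq P] [Fintype P]

/-- The predicates recorded in the table entry `i`. -/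
def cell (F : Finset (P × ℕ)) (i : ℕ) : Finset P := {p | (p, i) ∈ F}

/-- The entries of a table of the given size. -/
def cells (F : Finset (P × ℕ)) (n : ℕ) : List (Finset P) := (List.range n).map (cell F)

/-- The stacks that represent the register values `e` (positions in the word `w`) and the table. -/
def store (w : List Bool) (e : R → ℕ) (d : Data P) : Store P R where
  inp := []
  out := []
  left r := (w.take (e r)).reverse
  right r := w.drop (e r)
  tabLeft := ((cells d.facts d.size).take d.pos).reverse
  tabRight := (cells d.facts d.size).drop d.pos

variable [DecidableEq R]

/-- `Exec w p e d e' d' c`: on the word `w`, the program `p` leads from register values `e` and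
table `d` to register values `e'` and table `d'` in at most `c` steps, whatever the buffers
contain. -/
def Exec (w : List Bool) (p : Prog P R) (e : R → ℕ) (d : Data P) (e' : R → ℕ) (d' : Data P)
    (c : ℕ) : Prop :=
  ∀ v : Ctl P, v.1 = d.flag → ∃ (v' : Ctl P) (t : ℕ), v'.1 = d'.flag ∧ t ≤ c ∧
    Runs p v (store w e d).stk v' (store w e' d').stk t

variable {w : List Bool}

theorem Exec.mono {p : Prog P R} {e e' : R → ℕ} {d d' : Data P} {c c' : ℕ}
    (h : Exec w p e d e' d' c) (hc : c ≤ c') : Exec w p e d e' d' c' := fun v hv => by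
  obtain ⟨v', t, h₁, h₂, h₃⟩ := h v hv
  exact ⟨v', t, h₁, h₂.trans hc, h₃⟩

theorem Exec.seq {p q : Prog P R} {e e₁ e₂ : R → ℕ} {d d₁ d₂ : Data P} {c c' : ℕ}
    (hp : Exec w p e d e₁ d₁ c) (hq : Exec w q e₁ d₁ e₂ d₂ c') :
    Exec w (.seq p q) e d e₂ d₂ (c + c') := fun v hv => by
  obtain ⟨v₁, t, h₁, h₂, h₃⟩ := hp v hv
  obtain ⟨v₂, u, g₁, g₂, g₃⟩ := hq v₁ h₁
  exact ⟨v₂, t + u, g₁, by omega, h₃.seq g₃⟩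

/-- A loop is executed `n` times if stack `k` is nonempty before each of the iterations described
by `E` and `D`, and empty after the last one. -/
theorem Exec.loop {p : Prog P R} {k : Stk R} {n c : ℕ} (E : ℕ → R → ℕ) (D : ℕ → Data P)
    (hne : ∀ i < n, (store w (E i) (D i)).stk k ≠ []) (hend : (store w (E n) (D n)).stk k = [])
    (h : ∀ i < n, Exec w p (E i) (D i) (E (i + 1)) (D (i + 1)) c) :
    Exec w (.loop k p) (E 0) (D 0) (E n) (D n) (n * (c + 1) + 1) := by
  induction n generalizing E D with
  | zero => exact fun v hv => ⟨v, 1, hv, by simp, .loop_done hend⟩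
  | succ n ih =>
    intro v hv
    obtain ⟨v₁, t, h₁, h₂, h₃⟩ := h 0 (by simp) v hv
    obtain ⟨v₂, u, g₁, g₂, g₃⟩ := ih (fun i => E (i + 1)) (fun i => D (i + 1))
      (fun i hi => hne (i + 1) (by omega)) hend (fun i hi => h (i + 1) (by omega)) v₁ h₁
    refine ⟨v₂, 1 + t + u, g₁, ?_, .loop_step (hne 0 (by simp)) h₃ g₃⟩
    calc 1 + t + u ≤ 1 + c + (n * (c + 1) + 1) := by omega
      _ = (n + 1) * (c + 1) + 1 := by ring

/-! #### Moving registers -/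

/-- Move the register `r` one position to the right. -/
def moveRight (r : R) : Prog P R :=
  .seq (.pop (.right r) fun v (o : Option Bool) => (v.1, o.getD false, v.2.2))
    (.push (.left r) fun v => v.2.1)

/-- Move the register `r` one position to the left. -/
def moveLeft (r : R) : Prog P R :=
  .seq (.pop (.left r) fun v (o : Option Bool) => (v.1, o.getD false, v.2.2))
    (.push (.right r) fun v => v.2.1)

theorem store_update_pos (w : List Bool) (e : R → ℕ) (d : Data P) (r : R) (i : ℕ) :
    store w (Function.update e r i) d =
      { store w e d with
        left := Function.update (store w e d).left r (w.take i).reverse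
        right := Function.update (store w e d).right r (w.drop i) } := by
  unfold store
  congr 1
  · funext r'
    by_cases h : r' = r
    · subst h; simp
    · simp [h]
  · funext r'
    by_cases h : r' = r
    · subst h; simp
    · simp [h]

theorem exists_cons_drop {w : List Bool} {i : ℕ} (hi : i < w.length) :
    ∃ b, w.drop i = b :: w.drop (i + 1) ∧ (w.take (i + 1)).reverse = b :: (w.take i).reverse :=
  ⟨w[i], List.drop_eq_getElem_cons hi, by rw [List.take_add_one]; simp [hi]⟩

theorem exec_moveRight (r : R) (e : R → ℕ) (d : Data P) {i : ℕ} (hi : i < w.length) :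
    Exec w (moveRight r) (Function.update e r i) d (Function.update e r (i + 1)) d 2 := by
  intro v hv
  obtain ⟨b, hb, hb'⟩ := exists_cons_drop hi
  refine ⟨(v.1, b, v.2.2), 2, hv, le_rfl, ?_⟩
  rw [store_update_pos, store_update_pos]
  have h := (Runs.pop (Γ := Sym P R) (.right r)
      (fun v (o : Option Bool) => (v.1, o.getD false, v.2.2)) v
      { store w e d with
        left := Function.update (store w e d).left r (w.take i).reverse
        right := Function.update (store w e d).right r (w.drop i) }.stk).seq
          (.push (.left r) (fun v : Ctl P => v.2.1) _ _)
  rw [Store.update_right, Store.update_left] at h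
  simpa [moveRight, Store.stk, hb, hb'] using h

theorem exec_moveLeft (r : R) (e : R → ℕ) (d : Data P) {i : ℕ} (hi : i < w.length) :
    Exec w (moveLeft r) (Function.update e r (i + 1)) d (Function.update e r i) d 2 := by
  intro v hv
  obtain ⟨b, hb, hb'⟩ := exists_cons_drop hi
  refine ⟨(v.1, b, v.2.2), 2, hv, le_rfl, ?_⟩
  rw [store_update_pos, store_update_pos]
  have h := (Runs.pop (Γ := Sym P R) (.left r)
      (fun v (o : Option Bool) => (v.1, o.getD false, v.2.2)) v
      { store w e d with
        left := Function.update (store w e d).left r (w.take (i + 1)).reverse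
        right := Function.update (store w e d).right r (w.drop (i + 1)) }.stk).seq
          (.push (.right r) (fun v : Ctl P => v.2.1) _ _)
  rw [Store.update_left, Store.update_right] at h
  simpa [moveLeft, Store.stk, hb, hb'] using h

/-- Run `p` with the register `r` at every position from the current one to the end of the word,
and set `r` to `0` afterwards. -/
def forLoop (r : R) (p : Prog P R) : Prog P R :=
  .seq p (.seq (.loop (.right r) (.seq (moveRight r) p)) (.loop (.left r) (moveLeft r)))

theorem exec_resetRegister (r : R) (e : R → ℕ) (d : Data P) {i : ℕ} (hi : i ≤ w.length) :
    Exec w (.loop (.left r) (moveLeft r)) (Function.update e r i) d (Function.update e r 0) d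
      (i * 3 + 1) := by
  have := Exec.loop (w := w) (p := moveLeft r) (k := .left r) (n := i) (c := 2)
    (fun j => Function.update e r (i - j)) (fun _ => d)
    (fun j hj => by
      simp [Store.stk, store]; constructor <;> first | omega | (rintro rfl; simp at hi; omega))
    (by simp [Store.stk, store])
    (fun j hj => by
      have := exec_moveLeft r e d (w := w) (i := i - (j + 1)) (by omega)
      rwa [show i - (j + 1) + 1 = i - j by omega] at this)
  simpa using this

theorem exec_forLoop {r : R} {p : Prog P R} {e : R → ℕ} {c : ℕ} (D : ℕ → Data P) (he : e r = 0)
    (h : ∀ i ≤ w.length,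
      Exec w p (Function.update e r i) (D i) (Function.update e r i) (D (i + 1)) c) :
    Exec w (forLoop r p) e (D 0) e (D (w.length + 1)) ((w.length + 1) * (c + 6)) := by
  have h₁ := h 0 (by simp)
  have h₂ := Exec.loop (w := w) (p := .seq (moveRight r) p) (k := .right r) (n := w.length)
    (c := 2 + c) (fun j => Function.update e r j) (fun i => D (i + 1))
    (fun j hj => by simp [Store.stk, store]; omega)
    (by simp [Store.stk, store])
    (fun j hj => (exec_moveRight r e _ hj).seq (h _ hj))
  have h₃ := exec_resetRegister r e (D (w.length + 1)) (le_refl w.length)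
  have := h₁.seq (h₂.seq h₃)
  rw [show Function.update e r 0 = e by rw [← he, Function.update_eq_self]] at this
  refine this.mono ?_
  nlinarith

/-- Run `p` as many times as the value of the register `r` says, using `s` as an auxiliary register
in order to restore `r` afterwards. -/
def repeatValue (r s : R) (p : Prog P R) : Prog P R :=
  .seq (.loop (.left r) (.seq (moveLeft r) (.seq (moveRight s) p)))
    (.loop (.left s) (.seq (moveLeft s) (moveRight r)))

theorem exec_repeatValue {r s : R} {p : Prog P R} {e : R → ℕ} {c : ℕ} (D : ℕ → Data P)
    (hrs : r ≠ s) (hs : e s = 0) (hr : e r ≤ w.length)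
    (h : ∀ i < e r, ∀ a b, Exec w p (Function.update (Function.update e r a) s b) (D i)
      (Function.update (Function.update e r a) s b) (D (i + 1)) c) :
    Exec w (repeatValue r s p) e (D 0) e (D (e r)) ((w.length + 1) * (c + 10)) := by
  have h₁ := Exec.loop (w := w) (p := .seq (moveLeft r) (.seq (moveRight s) p)) (k := .left r)
    (n := e r) (c := 2 + (2 + c))
    (fun j => Function.update (Function.update e r (e r - j)) s j) D
    (fun j hj => by
      simp [Store.stk, store, hrs]; constructor <;> first | omega | (rintro rfl; simp at hr; omega))
    (by simp [Store.stk, store, hrs])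
    (fun j hj => by
      refine Exec.seq (e₁ := Function.update (Function.update e r (e r - (j + 1))) s j)
        (d₁ := D j) ?_ (Exec.seq ?_ (h j hj _ _))
      · have := exec_moveLeft r (Function.update e s j) (D j) (w := w) (i := e r - (j + 1))
          (by omega)
        rwa [show e r - (j + 1) + 1 = e r - j by omega, Function.update_comm hrs.symm,
          Function.update_comm hrs.symm] at this
      · exact exec_moveRight s _ _ (by omega))
  have h₂ := Exec.loop (w := w) (p := .seq (moveLeft s) (moveRight r)) (k := .left s)
    (n := e r) (c := 2 + 2)
    (fun j => Function.update (Function.update e r j) s (e r - j)) (fun _ => D (e r))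
    (fun j hj => by
      simp [Store.stk, store]; constructor <;> first | omega | (rintro rfl; simp at hr; omega))
    (by simp [Store.stk, store])
    (fun j hj => by
      refine Exec.seq (e₁ := Function.update (Function.update e r j) s (e r - (j + 1)))
        (d₁ := D (e r)) ?_ ?_
      · have := exec_moveLeft s (Function.update e r j) (D (e r)) (w := w) (i := e r - (j + 1))
          (by omega)
        rwa [show e r - (j + 1) + 1 = e r - j by omega] at this
      · have := exec_moveRight r (Function.update e s (e r - (j + 1))) (D (e r)) (w := w) (i := j)
          (by omega)
        rwa [Function.update_comm hrs.symm, Function.update_comm hrs.symm] at this)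
  have he : Function.update e s 0 = e := by rw [← hs, Function.update_eq_self]
  have h₃ : Function.update (Function.update e r 0) s (e r) =
      Function.update (Function.update e r 0) s (e r - 0) := rfl
  simp only [Nat.sub_zero, Nat.sub_self, Function.update_eq_self, he] at h₁ h₂
  refine (h₁.seq h₂).mono ?_
  nlinarith

/-! #### Operations on the table -/

/-- Move one position to the right in the table. -/
def tableRight : Prog P R :=
  .seq (.pop .tabRight fun v (o : Option (Finset P)) => (v.1, v.2.1, o.getD ∅))
    (.push .tabLeft fun v => v.2.2)

/-- Move to the first entry of the table. -/
def tableRewind : Prog P R :=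
  .loop .tabLeft (.seq (.pop .tabLeft fun v (o : Option (Finset P)) => (v.1, v.2.1, o.getD ∅))
    (.push .tabRight fun v => v.2.2))

@[simp] theorem length_cells (F : Finset (P × ℕ)) (n : ℕ) : (cells F n).length = n := by
  simp [cells]

theorem drop_cells (F : Finset (P × ℕ)) {n i : ℕ} (h : i < n) :
    (cells F n).drop i = cell F i :: (cells F n).drop (i + 1) := by
  rw [List.drop_eq_getElem_cons (by simpa using h)]
  simp only [cells, List.getElem_map, List.getElem_range]

theorem reverse_take_cells (F : Finset (P × ℕ)) {n i : ℕ} (h : i < n) :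
    ((cells F n).take (i + 1)).reverse = cell F i :: ((cells F n).take i).reverse := by
  simp [List.take_add_one, cells, h]

theorem exec_tableRight (e : R → ℕ) (d : Data P) (hd : d.pos < d.size) :
    Exec w tableRight e d e { d with pos := d.pos + 1 } 2 := by
  intro v hv
  refine ⟨(v.1, v.2.1, cell d.facts d.pos), 2, hv, le_rfl, ?_⟩
  have h := (Runs.pop (Γ := Sym P R) .tabRight
      (fun v (o : Option (Finset P)) => (v.1, v.2.1, o.getD ∅)) v
      (store w e d).stk).seq (.push .tabLeft (fun v : Ctl P => v.2.2) _ _)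
  rw [Store.update_tabRight, Store.update_tabLeft] at h
  simpa [tableRight, Store.stk, store, drop_cells _ hd, reverse_take_cells _ hd] using h

theorem exec_tableRewind (e : R → ℕ) (d : Data P) (hd : d.pos ≤ d.size) :
    Exec w tableRewind e d e { d with pos := 0 } (d.pos * 3 + 1) := by
  have := Exec.loop (w := w)
    (p := .seq (.pop .tabLeft fun v (o : Option (Finset P)) => (v.1, v.2.1, o.getD ∅))
      (.push .tabRight fun v => v.2.2)) (k := .tabLeft) (n := d.pos) (c := 2)
    (fun j => e) (fun j => { d with pos := d.pos - j })
    (fun j hj => by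
      have h₁ : (cells d.facts d.size).length ≠ 0 := by simp; omega
      simp [Store.stk, store]; constructor <;> [omega; (intro h; simp [h] at h₁)])
    (by simp [Store.stk, store])
    (fun j hj v hv => by
      obtain ⟨i, hi⟩ : ∃ i, i = d.pos - (j + 1) := ⟨_, rfl⟩
      have h₁ : i < d.size := by omega
      have h₂ : d.pos - j = i + 1 := by omega
      have h := (Runs.pop (Γ := Sym P R) .tabLeft
        (fun v (o : Option (Finset P)) => (v.1, v.2.1, o.getD ∅)) v
        (store w e { d with pos := i + 1 }).stk).seq
          (.push .tabRight (fun v : Ctl P => v.2.2) _ _)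
      rw [Store.update_tabLeft, Store.update_tabRight] at h
      refine ⟨(v.1, v.2.1, cell d.facts i), 2, hv, le_rfl, ?_⟩
      rw [← hi, h₂]
      simpa [Store.stk, store, drop_cells _ h₁, reverse_take_cells _ h₁] using h)
  simpa [tableRewind] using this

/-- Conjoin the flag with the test whether the current table entry contains `p`. -/
def tableTest (p : P) : Prog P R :=
  .peek .tabRight fun v (o : Option (Finset P)) => (v.1 && decide (p ∈ o.getD ∅), v.2)

theorem exec_tableTest (p : P) (e : R → ℕ) (d : Data P) (hd : d.pos < d.size) :
    Exec w (tableTest p) e d e { d with flag := d.flag && decide ((p, d.pos) ∈ d.facts) } 1 := by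
  intro v hv
  refine ⟨_, 1, ?_, le_rfl, .peek ..⟩
  simp [hv, Store.stk, store, drop_cells _ hd, cell]

/-- If the flag is set, then insert `p` into the current table entry. -/
def tableInsert (p : P) : Prog P R :=
  .seq (.pop .tabRight fun v (o : Option (Finset P)) => (v.1, v.2.1, o.getD ∅))
    (.push .tabRight fun v => if v.1 then insert p v.2.2 else v.2.2)

theorem cells_insert (F : Finset (P × ℕ)) (p : P) {n i : ℕ} (b : Bool) :
    cells (if b then insert (p, i) F else F) n =
      (cells F n).set i (if b then insert p (cell F i) else cell F i) := by
  cases b with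
  | false =>
    apply List.ext_getElem (by simp)
    intro j _ _
    simp only [cells, List.getElem_map, List.getElem_range, List.getElem_set]
    split_ifs with h <;> simp_all
  | true =>
    apply List.ext_getElem (by simp)
    intro j _ _
    simp only [cells, List.getElem_map, List.getElem_range, List.getElem_set]
    by_cases h : i = j
    · subst h
      ext q
      simp [cell]
    · ext q
      simp [cell, h, Ne.symm h]

theorem exec_tableInsert (p : P) (e : R → ℕ) (d : Data P) (hd : d.pos < d.size) :
    Exec w (tableInsert p) e d e
      { d with facts := if d.flag then insert (p, d.pos) d.facts else d.facts } 2 := by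
  intro v hv
  refine ⟨(v.1, v.2.1, cell d.facts d.pos), 2, hv, le_rfl, ?_⟩
  have h := (Runs.pop (Γ := Sym P R) .tabRight
      (fun v (o : Option (Finset P)) => (v.1, v.2.1, o.getD ∅)) v
      (store w e d).stk).seq
      (.push .tabRight (fun v : Ctl P => if v.1 then insert p v.2.2 else v.2.2) _ _)
  rw [Store.update_tabRight, Store.update_tabRight] at h
  have h₅ (c : Finset P) : ((cells d.facts d.size).set d.pos c).drop d.pos =
      c :: (cells d.facts d.size).drop (d.pos + 1) := by
    rw [List.drop_set]
    simp [drop_cells _ hd]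
  simp only [store, cells_insert, h₅, List.take_set_of_le le_rfl]
  simpa [tableInsert, Store.stk, store, drop_cells _ hd, hv] using h

/-! ### Datalog programs over the positions of a word -/

/-- Terms denoting natural numbers: zero, a variable, and the successor of a variable. -/
inductive Term (X : Type) where
  | zero
  | var (x : X)
  | succ (x : X)

/-- The value of a term. -/
def Term.eval {X : Type} (e : X → ℕ) : Term X → ℕ
  | .zero => 0
  | .var x => e x
  | .succ x => e x + 1

/-- Literals in the bodies of rules: atoms, and the test whether the word has the letter `b` at the
position `x`. -/
inductive Lit (P X : Type) where
  | atom (p : P) (args : List (Term X))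
  | bit (x : X) (b : Bool)

/-- A Datalog rule (a definite Horn clause) with head `head(args)`. -/
structure Rule (P X : Type) where
  head : P
  args : List (Term X)
  body : List (Lit P X)

variable {P X ι : Type}

/-- Truth of a literal in an interpretation `S` of the predicates. -/
def Lit.Holds (w : List Bool) (S : P → List ℕ → Prop) (e : X → ℕ) : Lit P X → Prop
  | .atom p args => S p (args.map (Term.eval e))
  | .bit x b => w[e x]? = some b

/-- Truth of all literals of a list. -/
def HoldsAll (w : List Bool) (S : P → List ℕ → Prop) (e : X → ℕ) : List (Lit P X) → Prop
  | [] => True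
  | l :: ls => l.Holds w S e ∧ HoldsAll w S e ls

/-- An interpretation is a model of the rules if it is closed under all rules, where the variables
range over the numbers `0, …, |w|`. -/
def IsModel (rules : ι → Rule P X) (w : List Bool) (S : P → List ℕ → Prop) : Prop :=
  ∀ i e, (∀ x, e x ≤ w.length) → HoldsAll w S e (rules i).body →
    S (rules i).head ((rules i).args.map (Term.eval e))

/-- The least model of the rules. -/
def Derivable (rules : ι → Rule P X) (w : List Bool) (p : P) (l : List ℕ) : Prop :=
  ∀ S, IsModel rules w S → S p l

theorem HoldsAll.mono {w : List Bool} {S S' : P → List ℕ → Prop} (h : ∀ p l, S p l → S' p l)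
    {e : X → ℕ} {ls : List (Lit P X)} (hl : HoldsAll w S e ls) : HoldsAll w S' e ls := by
  induction ls with
  | nil => trivial
  | cons l ls ih =>
    refine ⟨?_, ih hl.2⟩
    have := hl.1
    cases l with
    | atom p args => exact h _ _ this
    | bit x b => exact this

theorem isModel_derivable (rules : ι → Rule P X) (w : List Bool) :
    IsModel rules w (Derivable rules w) := fun i e he hb S hS =>
  hS i e he (hb.mono fun _ _ h => h S hS)

/-! ### Table indices of facts -/

/-- The table index of an argument tuple: the tuple is read as a number in bijective base `b`, so
that tuples of different lengths have different indices. -/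
def index (b : ℕ) : List ℕ → ℕ
  | [] => 0
  | t :: l => (t + 1) + b * index b l

theorem index_lt {b : ℕ} {l : List ℕ} (hl : ∀ t ∈ l, t + 1 < b) :
    index b l < b ^ l.length := by
  induction l with
  | nil => simp [index]
  | cons t l ih =>
    have h₁ := ih fun t ht => hl t (by simp [ht])
    have h₂ := hl t (by simp)
    simp only [index, List.length_cons, pow_succ]
    nlinarith

theorem index_injective {b : ℕ} {l l' : List ℕ} (hl : ∀ t ∈ l, t + 1 < b)
    (hl' : ∀ t ∈ l', t + 1 < b) (h : index b l = index b l') : l = l' := by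
  induction l generalizing l' with
  | nil =>
    cases l' with
    | nil => rfl
    | cons t l' => simp only [index] at h; omega
  | cons t l ih =>
    cases l' with
    | nil => simp only [index] at h; omega
    | cons t' l' =>
      have h₁ := hl t (by simp)
      have h₂ := hl' t' (by simp)
      simp only [index] at h
      have h₃ : t + 1 = t' + 1 := by
        have := congrArg (· % b) h
        simpa [Nat.add_mul_mod_self_left, Nat.mod_eq_of_lt h₁, Nat.mod_eq_of_lt h₂] using this
      have h₄ : index b l = index b l' := by
        rw [h₃] at h
        exact Nat.eq_of_mul_eq_mul_left (by omega) (Nat.add_left_cancel h)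
      rw [ih (fun t ht => hl t (by simp [ht])) (fun t ht => hl' t (by simp [ht])) h₄,
        Nat.succ_injective h₃]

/-! ### Access to the table -/

/-- The registers of the evaluator: one for every variable, the registers `digit i` for moving in
the table, the registers `round i` for counting rounds, and an auxiliary register. -/
inductive Reg (X : Type) (m k : ℕ) where
  | var (x : X)
  | digit (i : Fin m)
  | round (i : Fin k)
  | aux
  deriving DecidableEq, Fintype

section Evaluator

variable {m k : ℕ} [DecidableEq P] [Fintype P] [DecidableEq X] {w : List Bool}

/-- The base for the indices of facts; it exceeds `t + 1` for every value `t` of a term. -/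
def base (w : List Bool) : ℕ := w.length + 3

/-- Repeat `p` as many times as `base` says. -/
def repeatBase (r : Reg X m k) (p : Prog P (Reg X m k)) : Prog P (Reg X m k) :=
  -- the loop runs through the `|w| + 1` positions of the word
  .seq (forLoop r p) (.seq p p)

theorem exec_repeatBase {r : Reg X m k} {p : Prog P (Reg X m k)} {e : Reg X m k → ℕ} {c : ℕ}
    (D : ℕ → Data P) (he : e r = 0)
    (h : ∀ i < base w, ∀ j ≤ w.length,
      Exec w p (Function.update e r j) (D i) (Function.update e r j) (D (i + 1)) c) :
    Exec w (repeatBase r p) e (D 0) e (D (base w)) ((w.length + 3) * (c + 6)) := by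
  have h₁ := exec_forLoop D he fun i hi => h i (by unfold base; omega) i hi
  have h₂ := h (w.length + 1) (by unfold base; omega) 0 (by omega)
  have h₃ := h (w.length + 2) (by unfold base; omega) 0 (by omega)
  rw [show Function.update e r 0 = e by rw [← he, Function.update_eq_self]] at h₂ h₃
  refine (h₁.seq (h₂.seq h₃)).mono ?_
  nlinarith

/-- Repeat `p` once more than the value of the term says. -/
def repeatTerm (p : Prog P (Reg X m k)) : Term X → Prog P (Reg X m k)
  | .zero => p
  | .var x => .seq (repeatValue (.var x) .aux p) p
  | .succ x => .seq (repeatValue (.var x) .aux p) (.seq p p)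

/-- Move by `index` of the arguments, where `p` moves by one. -/
def access : List (Term X) → List (Fin m) → Prog P (Reg X m k) → Prog P (Reg X m k)
  | [], _, _ => .load id
  | t :: ts, i :: is, p => .seq (repeatTerm p t) (access ts is (repeatBase (.digit i) p))
  | _ :: _, [], _ => .load id

/-- `Moves w I p n c`: the program `p`, which uses only the registers `digit i` for `i` in `I`,
moves `n` positions to the right in the table, in at most `c` steps. -/
def Moves (w : List Bool) (I : List (Fin m)) (p : Prog P (Reg X m k)) (n c : ℕ) : Prop :=
  ∀ e (d : Data P), (∀ i ∈ I, e (.digit i) = 0) → d.pos + n ≤ d.size →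
    Exec w p e d e { d with pos := d.pos + n } c

theorem moves_tableRight : Moves w [] (tableRight : Prog P (Reg X m k)) 1 2 :=
  fun e d _ hd => exec_tableRight e d hd

theorem Moves.repeatBase {I : List (Fin m)} {p : Prog P (Reg X m k)} {n c : ℕ}
    (h : Moves w I p n c) {i : Fin m} (hi : i ∉ I) :
    Moves w (i :: I) (repeatBase (.digit i) p) (base w * n) ((w.length + 3) * (c + 6)) := by
  intro e d he hd
  have := exec_repeatBase (w := w) (r := .digit i) (p := p) (e := e) (c := c)
    (fun j => { d with pos := d.pos + j * n }) (he i (by simp)) fun j hj l hl => by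
      have := h (Function.update e (.digit i) l) { d with pos := d.pos + j * n }
        (fun i' hi' => by
          rw [Function.update_of_ne]
          · exact he i' (by simp [hi'])
          · rintro ⟨⟩
            exact hi hi')
        (by
          have : (j + 1) * n ≤ base w * n := Nat.mul_le_mul_right _ hj
          simp only
          linarith)
      simpa [add_mul, add_assoc] using this
  simpa using this

theorem exec_load_id {R : Type} [DecidableEq R] (e : R → ℕ) (d : Data P) :
    Exec w (.load id) e d e d 1 :=
  fun v hv => ⟨v, 1, hv, le_rfl, .load id v _⟩

theorem Moves.repeatTerm {I : List (Fin m)} {p : Prog P (Reg X m k)} {n c : ℕ}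
    (h : Moves w I p n c) (t : Term X) (e : Reg X m k → ℕ) (d : Data P)
    (he : ∀ i ∈ I, e (.digit i) = 0) (haux : e .aux = 0) (hle : ∀ x, e (.var x) ≤ w.length)
    (hd : d.pos + (t.eval (fun x => e (.var x)) + 1) * n ≤ d.size) :
    Exec w (Datalog.repeatTerm p t) e d e
      { d with pos := d.pos + (t.eval (fun x => e (.var x)) + 1) * n }
      ((w.length + 3) * (c + 10)) := by
  have key (x : X) (hd : d.pos + e (.var x) * n ≤ d.size) :
      Exec w (repeatValue (.var x) .aux p) e d e { d with pos := d.pos + e (.var x) * n }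
        ((w.length + 1) * (c + 10)) := by
    have := exec_repeatValue (w := w) (r := .var x) (s := .aux) (p := p) (e := e) (c := c)
      (fun j => { d with pos := d.pos + j * n }) (by simp) haux (hle x) fun j hj a b => by
        have := h (Function.update (Function.update e (.var x) a) .aux b)
          { d with pos := d.pos + j * n } (fun i hi => by simp [he i hi])
          (by
            have : (j + 1) * n ≤ e (.var x) * n := Nat.mul_le_mul_right _ hj
            simp only
            linarith)
        simpa [add_mul, add_assoc] using this
    simpa using this
  cases t with
  | zero =>
    simp only [Term.eval, zero_add, one_mul] at hd ⊢
    exact (h e d he hd).mono (by nlinarith)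
  | var x =>
    simp only [Term.eval, add_mul, one_mul, ← add_assoc] at hd ⊢
    refine ((key x (by omega)).seq (h e _ he ?_)).mono ?_
    · simpa using hd
    · nlinarith
  | succ x =>
    simp only [Term.eval, add_mul, one_mul, ← add_assoc] at hd ⊢
    refine ((key x (by omega)).seq ((h e _ he ?_).seq (h e _ he ?_))).mono ?_
    · simp only; omega
    · simpa using hd
    · nlinarith

open Polynomial in
theorem exists_exec_access (ts : List (Term X)) (is : List (Fin m)) (hlen : ts.length ≤ is.length)
    (I : List (Fin m)) (hI : (I ++ is).Nodup) (p : Prog P (Reg X m k)) (n : List Bool → ℕ)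
    (c : ℕ[X]) (hp : ∀ w, Moves w I p (n w) (c.eval w.length)) :
    ∃ c' : ℕ[X], ∀ (w : List Bool) (e : Reg X m k → ℕ) (d : Data P),
      (∀ i ∈ I ++ is, e (.digit i) = 0) → e .aux = 0 → (∀ x, e (.var x) ≤ w.length) →
      d.pos + index (base w) (ts.map (Term.eval fun x => e (.var x))) * n w ≤ d.size →
      Exec w (access ts is p) e d e
        { d with pos := d.pos + index (base w) (ts.map (Term.eval fun x => e (.var x))) * n w }
        (c'.eval w.length) := by
  induction ts generalizing is I p n c with
  | nil =>
    refine ⟨1, fun w e d _ _ _ _ => ?_⟩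
    simpa [index, access] using exec_load_id e d
  | cons t ts ih =>
    cases is with
    | nil => simp at hlen
    | cons i is =>
      have hI' := hI
      rw [List.nodup_append] at hI'
      obtain ⟨c', hc'⟩ := ih is (by simpa using hlen) (i :: I)
        (by
          refine List.Perm.nodup ?_ hI
          simp [List.perm_middle]) (repeatBase (.digit i) p)
        (fun w => base w * n w) ((Polynomial.X + 3) * (c + 6)) fun w => by
          have := (hp w).repeatBase (i := i) fun h => hI'.2.2 i h i (by simp) rfl
          simpa using this
      refine ⟨(Polynomial.X + 3) * (c + 10) + c', fun w e d h₁ h₂ h₃ h₄ => ?_⟩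
      simp only [List.map_cons, index] at h₄ ⊢
      have h₅ : ((t.eval fun x => e (.var x)) + 1 +
          base w * index (base w) (ts.map (Term.eval fun x => e (.var x)))) * n w =
          ((t.eval fun x => e (.var x)) + 1) * n w +
            index (base w) (ts.map (Term.eval fun x => e (.var x))) * (base w * n w) := by ring
      rw [h₅, ← add_assoc] at h₄ ⊢
      have g₁ := (hp w).repeatTerm t e d (fun i hi => h₁ i (by simp [hi])) h₂ h₃ (by omega)
      have g₂ := hc' w e { d with pos := d.pos + ((t.eval fun x => e (.var x)) + 1) * n w }
        (fun i' hi' => h₁ i' (by simp at hi' ⊢; tauto)) h₂ h₃ h₄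
      simpa [access] using g₁.seq g₂

end Evaluator

variable {P X ι : Type}

section Evaluator

variable {m k : ℕ} {w : List Bool}

/-! ### Evaluation of rules -/

/-- The interpretation of the predicates given by the facts recorded in the table. -/
def inTable (w : List Bool) (F : Finset (P × ℕ)) (p : P) (l : List ℕ) : Prop :=
  (p, index (base w) l) ∈ F

/-- The number of entries of the table for predicates of arity at most `m`. -/
def tableSize (m : ℕ) (w : List Bool) : ℕ := base w ^ m

/-- The values of the variables. -/
def varVal (e : Reg X m k → ℕ) (x : X) : ℕ := e (.var x)

/-- The registers used for moving in the table are zero, and the variables have admissible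
values. -/
structure Ready (w : List Bool) (e : Reg X m k → ℕ) : Prop where
  digit : ∀ i, e (.digit i) = 0
  aux : e .aux = 0
  var_le : ∀ x, varVal e x ≤ w.length

theorem Ready.index_lt {e : Reg X m k → ℕ} (he : Ready w e) {args : List (Term X)}
    (hm : args.length ≤ m) : index (base w) (args.map (Term.eval (varVal e))) < tableSize m w := by
  refine (Datalog.index_lt fun t ht => ?_).trans_le
    (Nat.pow_le_pow_right (by simp [base]) (by simpa using hm))
  obtain ⟨u, -, rfl⟩ := List.mem_map.1 ht
  cases u with
  | zero => simp [Term.eval, base]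
  | var x => have := he.var_le x; simp only [Term.eval, base]; omega
  | succ x => have := he.var_le x; simp only [Term.eval, base]; omega

variable [DecidableEq X]

/-- The instances of the rules for all values up to `n` of the variables in a list and the given
values of all other variables. -/
def instances (rs : List (Rule P X)) (n : ℕ) : List X → (X → ℕ) → List (Rule P X × (X → ℕ))
  | [], e => rs.map fun r => (r, e)
  | x :: xs, e => (List.range (n + 1)).flatMap fun i => instances rs n xs (Function.update e x i)

theorem mem_instances {rs : List (Rule P X)} {n : ℕ} {xs : List X} {e e' : X → ℕ} {r : Rule P X}
    (hr : r ∈ rs) (he : ∀ x, e' x ≤ n) (h : ∀ x, x ∉ xs → e' x = e x) :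
    (r, e') ∈ instances rs n xs e := by
  induction xs generalizing e with
  | nil =>
    have : e' = e := funext fun x => h x (by simp)
    simpa [instances, this] using hr
  | cons x xs ih =>
    refine List.mem_flatMap.2 ⟨e' x, List.mem_range.2 (Nat.lt_succ_of_le (he x)), ih fun y hy => ?_⟩
    by_cases hyx : y = x
    · subst hyx; simp
    · rw [Function.update_of_ne hyx]
      exact h y (by simp [hyx, hy])

theorem of_mem_instances {rs : List (Rule P X)} {n : ℕ} {xs : List X} {e : X → ℕ}
    {q : Rule P X × (X → ℕ)} (he : ∀ x, e x ≤ n) (hq : q ∈ instances rs n xs e) :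
    q.1 ∈ rs ∧ ∀ x, q.2 x ≤ n := by
  induction xs generalizing e with
  | nil =>
    obtain ⟨r, hr, rfl⟩ := List.mem_map.1 hq
    exact ⟨hr, he⟩
  | cons x xs ih =>
    obtain ⟨i, hi, h⟩ := List.mem_flatMap.1 hq
    refine ih (fun y => ?_) h
    by_cases hyx : y = x
    · subst hyx
      simpa using Nat.lt_succ_iff.1 (List.mem_range.1 hi)
    · rw [Function.update_of_ne hyx]
      exact he y

variable [DecidableEq P] [Fintype P]

/-- Move to the table entry with the index of the given arguments, execute `q`, and return. -/
def atEntry (args : List (Term X)) (q : Prog P (Reg X m k)) : Prog P (Reg X m k) :=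
  .seq (access args (List.finRange m) tableRight) (.seq q tableRewind)

theorem exists_exec_atEntry (args : List (Term X)) (hm : args.length ≤ m)
    (q : Prog P (Reg X m k)) :
    ∃ c : Polynomial ℕ, ∀ (w : List Bool) (e : Reg X m k → ℕ) (F F' : Finset (P × ℕ))
      (b b' : Bool), Ready w e →
      (∀ i < tableSize m w, i = index (base w) (args.map (Term.eval (varVal e))) →
        Exec w q e ⟨F, tableSize m w, i, b⟩ e ⟨F', tableSize m w, i, b'⟩ 2) →
      Exec w (atEntry args q) e ⟨F, tableSize m w, 0, b⟩ e ⟨F', tableSize m w, 0, b'⟩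
        (c.eval w.length) := by
  obtain ⟨c, hc⟩ := exists_exec_access (k := k) (P := P) args (List.finRange m)
    (by simpa using hm) [] (by simpa using List.nodup_finRange m) tableRight (fun _ => 1) 2
    (fun w => by simpa using moves_tableRight)
  refine ⟨c + (2 + ((Polynomial.X + 3) ^ m * 3 + 1)), fun w e F F' b b' he h => ?_⟩
  have hlt := he.index_lt hm
  have h₁ := hc w e ⟨F, tableSize m w, 0, b⟩ (fun i _ => he.digit i) he.aux he.var_le
    (by simpa only [zero_add, mul_one] using! hlt.le)
  have h₂ := h _ hlt rfl
  have h₃ := exec_tableRewind (w := w) e ⟨F', tableSize m w, _, b'⟩ hlt.le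
  simp only [zero_add, mul_one] at h₁
  refine (h₁.seq (h₂.seq h₃)).mono ?_
  simp only [Polynomial.eval_add, Polynomial.eval_mul, Polynomial.eval_pow, Polynomial.eval_X,
    Polynomial.eval_ofNat, Polynomial.eval_one]
  simp only [tableSize, base] at hlt
  simp only [base]
  omega

/-- Conjoin the flag with the truth value of a literal. -/
def litProg : Lit P X → Prog P (Reg X m k)
  | .atom p args => atEntry args (tableTest p)
  | .bit x b => .peek (.right (.var x)) fun v (o : Option Bool) => (v.1 && decide (o = some b), v.2)

/-- All argument tuples of the rule have at most `m` entries. -/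
def Rule.ArityLE (m : ℕ) (r : Rule P X) : Prop :=
  r.args.length ≤ m ∧ ∀ p args, Lit.atom p args ∈ r.body → args.length ≤ m

open Classical in
theorem exists_exec_litProg (l : Lit P X) (hm : ∀ p args, l = .atom p args → args.length ≤ m) :
    ∃ c : Polynomial ℕ, ∀ (w : List Bool) (e : Reg X m k → ℕ) (F : Finset (P × ℕ)) (b : Bool),
      Ready w e →
      Exec w (litProg l) e ⟨F, tableSize m w, 0, b⟩ e
        ⟨F, tableSize m w, 0, b && decide (l.Holds w (inTable w F) (varVal e))⟩
        (c.eval w.length) := by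
  cases l with
  | atom p args =>
    obtain ⟨c, hc⟩ := exists_exec_atEntry (k := k) args (hm p args rfl) (tableTest p)
    refine ⟨c, fun w e F b he => hc w e F F b _ he fun i hi hi' => ?_⟩
    have := exec_tableTest (w := w) p e ⟨F, tableSize m w, i, b⟩ hi
    subst hi'
    refine Exec.mono ?_ one_le_two
    convert this using 2
    rw [Bool.eq_iff_iff]
    simp only [Bool.and_eq_true, decide_eq_true_eq]
    rfl
  | bit x b' =>
    refine ⟨1, fun w e F b he v hv => ⟨_, 1, ?_, by simp, .peek ..⟩⟩
    have : (store w e ⟨F, tableSize m w, 0, b⟩).stk (.right (.var x)) = w.drop (varVal e x) := rfl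
    rw [Bool.eq_iff_iff]
    simp only [Bool.and_eq_true, decide_eq_true_eq, hv, this, Lit.Holds, List.head?_drop]
    exact and_congr_right fun _ => (@decide_eq_true_iff _
      (Classical.propDecidable (Lit.Holds w (inTable w F) (varVal e) (.bit x b')))).symm

/-- Conjoin the flag with the truth value of all literals. -/
def bodyProg : List (Lit P X) → Prog P (Reg X m k)
  | [] => .load id
  | l :: ls => .seq (litProg l) (bodyProg ls)

open Classical in
theorem exists_exec_bodyProg (ls : List (Lit P X))
    (hm : ∀ p args, Lit.atom p args ∈ ls → args.length ≤ m) :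
    ∃ c : Polynomial ℕ, ∀ (w : List Bool) (e : Reg X m k → ℕ) (F : Finset (P × ℕ)) (b : Bool),
      Ready w e →
      Exec w (bodyProg ls) e ⟨F, tableSize m w, 0, b⟩ e
        ⟨F, tableSize m w, 0, b && decide (HoldsAll w (inTable w F) (varVal e) ls)⟩
        (c.eval w.length) := by
  induction ls with
  | nil =>
    refine ⟨1, fun w e F b _ => ?_⟩
    have key : (b && decide (HoldsAll w (inTable w F) (varVal e) [])) = b := by
      rw [Bool.eq_iff_iff]
      simp only [Bool.and_eq_true, decide_eq_true_eq]
      simp [HoldsAll]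
    rw [key]
    simpa [bodyProg] using exec_load_id e (Data.mk F _ 0 b)
  | cons l ls ih =>
    obtain ⟨c, hc⟩ := exists_exec_litProg (k := k) l fun p args h => hm p args (by simp [h])
    obtain ⟨c', hc'⟩ := ih fun p args h => hm p args (by simp [h])
    refine ⟨c + c', fun w e F b he => ?_⟩
    have := (hc w e F b he).seq (hc' w e F _ he)
    have key : (b && decide (HoldsAll w (inTable w F) (varVal e) (l :: ls))) =
        (b && decide (l.Holds w (inTable w F) (varVal e)) &&
          decide (HoldsAll w (inTable w F) (varVal e) ls)) := by
      rw [Bool.eq_iff_iff]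
      simp only [Bool.and_eq_true, decide_eq_true_eq]
      simp [HoldsAll, and_assoc]
    rw [key]
    simpa [bodyProg] using this

open Classical in
/-- The facts obtained by applying a rule for given values of the variables. -/
noncomputable def applyRule (w : List Bool) (r : Rule P X) (e : X → ℕ) (F : Finset (P × ℕ)) :
    Finset (P × ℕ) :=
  if HoldsAll w (inTable w F) e r.body then
    insert (r.head, index (base w) (r.args.map (Term.eval e))) F
  else F

/-- Apply a rule, and set the flag afterwards. -/
def ruleProg (r : Rule P X) : Prog P (Reg X m k) :=
  .seq (bodyProg r.body) (.seq (atEntry r.args (tableInsert r.head)) (.load fun v => (true, v.2)))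

theorem exists_exec_ruleProg (r : Rule P X) (hr : r.ArityLE m) :
    ∃ c : Polynomial ℕ, ∀ (w : List Bool) (e : Reg X m k → ℕ) (F : Finset (P × ℕ)),
      Ready w e →
      Exec w (ruleProg r) e ⟨F, tableSize m w, 0, true⟩ e
        ⟨applyRule w r (varVal e) F, tableSize m w, 0, true⟩ (c.eval w.length) := by
  classical
  obtain ⟨c, hc⟩ := exists_exec_bodyProg (k := k) r.body hr.2
  obtain ⟨c', hc'⟩ := exists_exec_atEntry (k := k) r.args hr.1 (tableInsert r.head)
  refine ⟨c + (c' + 1), fun w e F he => ?_⟩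
  have h₁ := hc w e F true he
  have h₂ := hc' w e F (applyRule w r (varVal e) F)
    (decide (HoldsAll w (inTable w F) (varVal e) r.body))
    (decide (HoldsAll w (inTable w F) (varVal e) r.body)) he fun i hi hi' => by
      have := exec_tableInsert (w := w) r.head e ⟨F, tableSize m w, i,
        decide (HoldsAll w (inTable w F) (varVal e) r.body)⟩ hi
      subst hi'
      convert this using 2
      simp [applyRule]
  have h₃ (F' : Finset (P × ℕ)) (b : Bool) : Exec w (.load fun v => (true, v.2)) e
      ⟨F', tableSize m w, 0, b⟩ e ⟨F', tableSize m w, 0, true⟩ 1 :=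
    fun v hv => ⟨_, 1, rfl, le_rfl, .load ..⟩
  rw [Bool.true_and] at h₁
  have := h₁.seq (h₂.seq (h₃ _ _))
  simpa [ruleProg] using this

/-- The facts obtained by applying rules for given values of their variables one after the other. -/
noncomputable def applyRules (w : List Bool) (L : List (Rule P X × (X → ℕ)))
    (F : Finset (P × ℕ)) : Finset (P × ℕ) :=
  L.foldl (fun F q => applyRule w q.1 q.2 F) F

/-- Apply all rules of a list. -/
def rulesProg : List (Rule P X) → Prog P (Reg X m k)
  | [] => .load id
  | r :: rs => .seq (ruleProg r) (rulesProg rs)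

theorem exists_exec_rulesProg (rs : List (Rule P X)) (hr : ∀ r ∈ rs, r.ArityLE m) :
    ∃ c : Polynomial ℕ, ∀ (w : List Bool) (e : Reg X m k → ℕ) (F : Finset (P × ℕ)),
      Ready w e →
      Exec w (rulesProg rs) e ⟨F, tableSize m w, 0, true⟩ e
        ⟨applyRules w (rs.map fun r => (r, varVal e)) F, tableSize m w, 0, true⟩
        (c.eval w.length) := by
  induction rs with
  | nil =>
    exact ⟨1, fun w e F _ => by
      simpa [rulesProg, applyRules] using exec_load_id e (Data.mk F _ 0 true)⟩
  | cons r rs ih =>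
    obtain ⟨c, hc⟩ := exists_exec_ruleProg (k := k) r (hr r (by simp))
    obtain ⟨c', hc'⟩ := ih fun r h => hr r (by simp [h])
    refine ⟨c + c', fun w e F he => ?_⟩
    have := (hc w e F he).seq (hc' w e _ he)
    simpa [rulesProg, applyRules] using this

/-- Apply all rules for all values of the variables in a list. -/
def forAllProg (rs : List (Rule P X)) : List X → Prog P (Reg X m k)
  | [] => rulesProg rs
  | x :: xs => forLoop (.var x) (forAllProg rs xs)

theorem exists_exec_forAllProg (rs : List (Rule P X)) (hr : ∀ r ∈ rs, r.ArityLE m) (xs : List X)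
    (hxs : xs.Nodup) :
    ∃ c : Polynomial ℕ, ∀ (w : List Bool) (e : Reg X m k → ℕ) (F : Finset (P × ℕ)),
      Ready w e → (∀ x ∈ xs, varVal e x = 0) →
      Exec w (forAllProg rs xs) e ⟨F, tableSize m w, 0, true⟩ e
        ⟨applyRules w (instances rs w.length xs (varVal e)) F, tableSize m w, 0, true⟩
        (c.eval w.length) := by
  induction xs with
  | nil =>
    obtain ⟨c, hc⟩ := exists_exec_rulesProg (k := k) rs hr
    exact ⟨c, fun w e F he _ => hc w e F he⟩
  | cons x xs ih =>
    obtain ⟨hx, hxs⟩ := List.nodup_cons.1 hxs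
    obtain ⟨c, hc⟩ := ih hxs
    refine ⟨(Polynomial.X + 1) * (c + 6), fun w e F he h₀ => ?_⟩
    have := exec_forLoop (w := w) (r := .var x) (p := forAllProg rs xs) (e := e)
      (c := c.eval w.length)
      (fun i => ⟨applyRules w ((List.range i).flatMap fun i =>
        instances rs w.length xs (Function.update (varVal e) x i)) F, tableSize m w, 0, true⟩)
      (show e (.var x) = 0 from h₀ x (by simp)) fun i hi => by
        have hv : varVal (Function.update e (.var x) i) = Function.update (varVal e) x i := by
          funext y
          by_cases hy : y = x
          · subst hy; simp [varVal]
          · simp [varVal, hy]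
        have := hc w (Function.update e (.var x) i) (applyRules w ((List.range i).flatMap fun i =>
          instances rs w.length xs (Function.update (varVal e) x i)) F)
          ⟨fun j => by simpa using he.digit j, by simpa using he.aux, fun y => by
            rw [hv]
            by_cases hy : y = x
            · subst hy; simpa using hi
            · simpa [hy] using he.var_le y⟩
          fun y hy => by
            rw [hv, Function.update_of_ne (by rintro rfl; exact hx hy)]
            exact h₀ y (by simp [hy])
        rw [hv] at this
        simpa [List.range_succ, applyRules, List.foldl_append] using this
    simpa [forAllProg, instances, applyRules] using this

/-! ### Rounds -/

/-- Repeat `p` as many times as the power of `base` says whose exponent is the number of the given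
registers. -/
def repeatAll (p : Prog P (Reg X m k)) : List (Reg X m k) → Prog P (Reg X m k)
  | [] => p
  | r :: rs => repeatBase r (repeatAll p rs)

/-- If one execution of `p` transforms the table by `h`, as long as the registers in `Z` are zero and
the table satisfies the invariant `A`, then `repeatAll` iterates `h`. The counting registers do not
belong to `Z`, since they vary between the executions of `p`. -/
theorem exists_exec_repeatAll (p : Prog P (Reg X m k)) (Z : Set (Reg X m k))
    (h : List Bool → Data P → Data P) (A : List Bool → Data P → Prop)
    (hA : ∀ w d, A w d → A w (h w d)) (c : Polynomial ℕ)
    (hp : ∀ w e d, (∀ r ∈ Z, e r = 0) → A w d → Exec w p e d e (h w d) (c.eval w.length))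
    (rs : List (Reg X m k)) (hrs : rs.Nodup) (hZ : ∀ r ∈ rs, r ∉ Z) :
    ∃ c' : Polynomial ℕ, ∀ w e d, (∀ r ∈ Z, e r = 0) → (∀ r ∈ rs, e r = 0) → A w d →
      Exec w (repeatAll p rs) e d e ((h w)^[base w ^ rs.length] d) (c'.eval w.length) := by
  induction rs with
  | nil => exact ⟨c, fun w e d he _ hd => hp w e d he hd⟩
  | cons r rs ih =>
    obtain ⟨hr, hrs⟩ := List.nodup_cons.1 hrs
    obtain ⟨c', hc'⟩ := ih hrs fun r hr => hZ r (by simp [hr])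
    refine ⟨(Polynomial.X + 3) * (c' + 6), fun w e d he h₀ hd => ?_⟩
    have hAi (i : ℕ) : A w ((h w)^[i] d) := by
      induction i with
      | zero => exact hd
      | succ i ih =>
        rw [Function.iterate_succ_apply']
        exact hA w _ ih
    have := exec_repeatBase (w := w) (r := r) (p := repeatAll p rs) (e := e)
      (c := c'.eval w.length) (fun i => (h w)^[base w ^ rs.length * i] d) (h₀ r (by simp))
      fun i _ j _ => by
        have := hc' w (Function.update e r j) ((h w)^[base w ^ rs.length * i] d)
          (fun s hs => by
            rw [Function.update_of_ne (by rintro rfl; exact hZ s (by simp) hs)]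
            exact he s hs)
          (fun s hs => by
            rw [Function.update_of_ne (by rintro rfl; exact hr hs)]
            exact h₀ s (by simp [hs])) (hAi _)
        rwa [← Function.iterate_add_apply, add_comm, ← mul_add_one] at this
    simpa [repeatAll, pow_succ] using this

end Evaluator

/-! ### Least fixed points -/

section Fixpoint

variable {P X ι : Type} {w : List Bool}

theorem eval_add_one_lt_base {e : X → ℕ} (he : ∀ x, e x ≤ w.length) (t : Term X) :
    t.eval e + 1 < base w := by
  cases t with
  | zero => simp [Term.eval, base]
  | var x => have := he x; simp only [Term.eval, base]; omega
  | succ x => have := he x; simp only [Term.eval, base]; omega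

variable [DecidableEq P]

theorem subset_applyRule (r : Rule P X) (e : X → ℕ) (F : Finset (P × ℕ)) :
    F ⊆ applyRule w r e F := by
  unfold applyRule
  split_ifs
  · exact Finset.subset_insert _ _
  · exact subset_rfl

theorem subset_applyRules (L : List (Rule P X × (X → ℕ))) (F : Finset (P × ℕ)) :
    F ⊆ applyRules w L F := by
  induction L generalizing F with
  | nil => exact subset_rfl
  | cons q L ih => exact (subset_applyRule q.1 q.2 F).trans (ih _)

theorem applyRules_induction {L : List (Rule P X × (X → ℕ))} {C : Finset (P × ℕ) → Prop}
    (h : ∀ q ∈ L, ∀ F, C F → C (applyRule w q.1 q.2 F)) {F : Finset (P × ℕ)} (hF : C F) :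
    C (applyRules w L F) := by
  induction L generalizing F with
  | nil => exact hF
  | cons q L ih => exact ih (fun q hq => h q (by simp [hq])) (h q (by simp) F hF)

theorem applyRule_eq_of_applyRules_eq {L : List (Rule P X × (X → ℕ))} {F : Finset (P × ℕ)}
    (h : applyRules w L F = F) : ∀ q ∈ L, applyRule w q.1 q.2 F = F := by
  induction L with
  | nil => simp
  | cons q L ih =>
    have h₁ : applyRule w q.1 q.2 F = F := by
      refine subset_antisymm ?_ (subset_applyRule _ _ _)
      exact (subset_applyRules L _).trans_eq h
    have h₂ : applyRules w L F = F := by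
      have : applyRules w (q :: L) F = applyRules w L (applyRule w q.1 q.2 F) := rfl
      rw [h₁] at this
      exact this.symm.trans h
    intro q' hq'
    rcases List.mem_cons.1 hq' with rfl | hq'
    · exact h₁
    · exact ih h₂ q' hq'

/-- An increasing sequence of subsets of a finite set, generated by iterating a map, is stationary
from the cardinality of the set on. -/
theorem iterate_fixed {α : Type} [DecidableEq α] {g : Finset α → Finset α} {U F : Finset α}
    (hg : ∀ F, F ⊆ g F) (hU : ∀ F ⊆ U, g F ⊆ U) (hF : F ⊆ U) {n : ℕ} (hn : U.card ≤ n) :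
    g (g^[n] F) = g^[n] F := by
  have hsub (i : ℕ) : g^[i] F ⊆ U := by
    induction i with
    | zero => exact hF
    | succ i ih =>
      rw [Function.iterate_succ_apply']
      exact hU _ ih
  have key (i : ℕ) : g (g^[i] F) = g^[i] F ∨ i + 1 ≤ (g^[i + 1] F).card := by
    induction i with
    | zero =>
      by_cases h : g F = F
      · exact .inl h
      · right
        have : g F ≠ ∅ := fun h' => by
          have hF := hg F
          rw [h', Finset.subset_empty] at hF
          exact h (h'.trans hF.symm)
        exact Finset.card_pos.2 (Finset.nonempty_iff_ne_empty.2 this)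
    | succ i ih =>
      rw [Function.iterate_succ_apply' g (i + 1)]
      by_cases h : g (g^[i + 1] F) = g^[i + 1] F
      · exact .inl h
      · right
        rcases ih with ih | ih
        · rw [Function.iterate_succ_apply', ih] at h
          exact absurd ih h
        · have := Finset.card_lt_card ((hg (g^[i + 1] F)).ssubset_of_ne (Ne.symm h))
          omega
  rcases key n with h | h
  · exact h
  · have := Finset.card_le_card (hsub (n + 1))
    omega

variable [Fintype P] [DecidableEq X] [Fintype ι]

/-- The result of applying all rules for all values of the variables, as often as there are possible
facts, is the least model. -/
theorem iterate_applyRules_iff {rules : ι → Rule P X} {m n : ℕ} (hr : ∀ i, (rules i).ArityLE m)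
    {xs : List X} (hxs : ∀ x, x ∈ xs) (hn : Fintype.card P * tableSize m w ≤ n) (p : P) :
    (p, 0) ∈ (applyRules w (instances (Finset.univ.toList.map rules) w.length xs fun _ => 0))^[n] ∅ ↔
      Derivable rules w p [] := by
  set L := instances (Finset.univ.toList.map rules) w.length xs fun _ => 0 with hL
  have hmem : ∀ q ∈ L, (∃ i, rules i = q.1) ∧ ∀ x, q.2 x ≤ w.length := fun q hq => by
    have := of_mem_instances (fun _ => Nat.zero_le _) hq
    simpa using this
  constructor
  · intro h
    -- every fact in the table is the index of a derivable atom
    have key (j : ℕ) : ∀ q ∈ (applyRules w L)^[j] ∅, ∃ l, Derivable rules w q.1 l ∧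
        index (base w) l = q.2 ∧ ∀ t ∈ l, t + 1 < base w := by
      induction j with
      | zero => simp
      | succ j ih =>
        rw [Function.iterate_succ_apply']
        refine applyRules_induction (C := fun F => ∀ q ∈ F, ∃ l, Derivable rules w q.1 l ∧
          index (base w) l = q.2 ∧ ∀ t ∈ l, t + 1 < base w) (fun q hq F hF => ?_) ih
        obtain ⟨⟨i, hi⟩, he⟩ := hmem q hq
        unfold applyRule
        split_ifs with hb
        · have hlt (args : List (Term X)) : ∀ t ∈ args.map (Term.eval q.2), t + 1 < base w := by
            intro t ht
            obtain ⟨u, -, rfl⟩ := List.mem_map.1 ht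
            exact eval_add_one_lt_base he u
          have hbody (ls : List (Lit P X)) (h : HoldsAll w (inTable w F) q.2 ls) :
              HoldsAll w (Derivable rules w) q.2 ls := by
            induction ls with
            | nil => trivial
            | cons a ls ih =>
              refine ⟨?_, ih h.2⟩
              cases a with
              | bit x b => exact h.1
              | atom p args =>
                obtain ⟨l, h₁, h₂, h₃⟩ := hF _ h.1
                rw [index_injective h₃ (hlt args) h₂] at h₁
                exact h₁
          rw [Finset.forall_mem_insert]
          refine ⟨⟨_, ?_, rfl, hlt _⟩, hF⟩
          rw [← hi] at hb ⊢
          exact isModel_derivable rules w i q.2 he (hbody _ hb)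
        · exact hF
    obtain ⟨l, h₁, h₂, h₃⟩ := key n _ h
    have := index_injective (l' := []) h₃ (by simp) (by simpa [index] using h₂)
    rwa [this] at h₁
  · intro h
    set F := (applyRules w L)^[n] ∅ with hF
    have hfix : applyRules w L F = F := by
      refine iterate_fixed (U := Finset.univ ×ˢ Finset.range (tableSize m w))
        (subset_applyRules L) (fun F hF => ?_) (by simp) (by simpa using hn)
      refine applyRules_induction (C := fun F => F ⊆ _) (fun q hq F hF => ?_) hF
      obtain ⟨⟨i, hi⟩, he⟩ := hmem q hq
      unfold applyRule
      split_ifs with hb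
      · refine Finset.insert_subset ?_ hF
        simp only [Finset.mem_product, Finset.mem_univ, Finset.mem_range, true_and]
        refine (index_lt fun t ht => ?_).trans_le
          (Nat.pow_le_pow_right (by simp [base]) (by simpa [← hi] using (hr i).1))
        obtain ⟨u, -, rfl⟩ := List.mem_map.1 ht
        exact eval_add_one_lt_base he u
      · exact hF
    refine h (inTable w F) fun i e he hb => ?_
    have := applyRule_eq_of_applyRules_eq hfix (rules i, e)
      (mem_instances (by simp) he fun x hx => absurd (hxs x) hx)
    rw [inTable, ← this, applyRule, if_pos hb]
    exact Finset.mem_insert_self _ _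

end Fixpoint

/-! ### The evaluator -/

section Driver

variable {P X : Type} {m k : ℕ} [DecidableEq X]

/-- Push the buffered bit onto the left stacks of the given registers. -/
def pushAll : List (Reg X m k) → Prog P (Reg X m k)
  | [] => .load id
  | r :: rs => .seq (.push (.left r) fun v => v.2.1) (pushAll rs)

theorem runs_pushAll {rs : List (Reg X m k)} (hrs : rs.Nodup) (v : Ctl P)
    (s : Store P (Reg X m k)) :
    Runs (pushAll rs) v s.stk v
      { s with left := fun r => if r ∈ rs then v.2.1 :: s.left r else s.left r }.stk
      (rs.length + 1) := by
  induction rs generalizing s with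
  | nil => simpa [pushAll] using Runs.load (Γ := Sym P (Reg X m k)) id v s.stk
  | cons r rs ih =>
    obtain ⟨hr, hrs⟩ := List.nodup_cons.1 hrs
    have h₁ := Runs.push (Γ := Sym P (Reg X m k)) (.left r) (fun v : Ctl P => v.2.1) v s.stk
    rw [Store.update_left] at h₁
    have h₂ := h₁.seq (ih hrs _)
    have h₃ : (fun r' => if r' ∈ r :: rs then v.2.1 :: s.left r' else s.left r') =
        fun r' => if r' ∈ rs then
          v.2.1 :: Function.update s.left r (v.2.1 :: s.stk (.left r)) r'
          else Function.update s.left r (v.2.1 :: s.stk (.left r)) r' := by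
      funext r'
      by_cases h : r' = r
      · subst h; simp [hr, Store.stk]
      · simp [h]
    rw [h₃, List.length_cons, add_comm (rs.length + 1)]
    exact h₂

/-- Empty the given stacks. -/
def clearAll : List (Stk (Reg X m k)) → Prog P (Reg X m k)
  | [] => .load id
  | s :: ss => .seq (.loop s (.pop s fun v _ => v)) (clearAll ss)

theorem runs_clear (s : Stk (Reg X m k)) (v : Ctl P) (S : ∀ s, List (Sym P (Reg X m k) s)) :
    Runs (.loop s (.pop s fun v _ => v)) v S v (Function.update S s []) ((S s).length * 2 + 1) := by
  obtain ⟨l, hl⟩ : ∃ l, l = S s := ⟨_, rfl⟩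
  rw [← hl]
  induction l generalizing S with
  | nil =>
    rw [show Function.update S s [] = S by rw [hl, Function.update_eq_self]]
    exact Runs.loop_done hl.symm
  | cons a l ih =>
    have h₁ := Runs.pop s (fun (v : Ctl P) _ => v) v S
    rw [← hl] at h₁
    have h₂ := Runs.loop_step (by simp [← hl]) h₁ (ih (Function.update S s l) (by simp))
    simp only [Function.update_idem] at h₂
    convert! h₂ using 1
    simp; ring

theorem runs_clearAll (ss : List (Stk (Reg X m k))) (v : Ctl P)
    (S : ∀ s, List (Sym P (Reg X m k) s)) {c : ℕ} (hc : ∀ s ∈ ss, (S s).length ≤ c) :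
    ∃ t ≤ ss.length * (c * 2 + 1) + 1,
      Runs (clearAll ss) v S v (fun s => if s ∈ ss then [] else S s) t := by
  induction ss generalizing S with
  | nil => exact ⟨1, by simp, by simpa [clearAll] using Runs.load id v S⟩
  | cons s ss ih =>
    have h₁ := runs_clear s v S
    obtain ⟨t, ht, h₂⟩ := ih (Function.update S s []) fun s' hs' => by
      by_cases h : s' = s
      · subst h; simp
      · simpa [h] using hc s' (by simp [hs'])
    have h₃ : (fun s' => if s' ∈ s :: ss then [] else S s') =
        fun s' => if s' ∈ ss then [] else Function.update S s [] s' := by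
      funext s'
      by_cases h : s' = s
      · subst h; simp
      · simp [h]
    rw [h₃]
    refine ⟨_, ?_, h₁.seq h₂⟩
    have := hc s (by simp)
    simp only [List.length_cons]
    nlinarith

/-- Move the input onto the left stacks of the given registers. -/
def loadInput (rs : List (Reg X m k)) : Prog P (Reg X m k) :=
  .loop .inp (.seq (.pop .inp fun v (o : Option Bool) => (v.1, o.getD false, v.2.2)) (pushAll rs))

theorem runs_loadInput {rs : List (Reg X m k)} (hrs : rs.Nodup) (hmem : ∀ r, r ∈ rs) (v : Ctl P)
    (u l : List Bool) :
    ∃ v' : Ctl P, v'.1 = v.1 ∧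
      Runs (loadInput rs) v (Store.mk u [] (fun _ => l) (fun _ => []) [] []).stk v'
        (Store.mk [] [] (fun _ => u.reverse ++ l) (fun _ => []) [] []).stk
        (u.length * (rs.length + 3) + 1) := by
  induction u generalizing v l with
  | nil => exact ⟨v, rfl, by simpa [loadInput] using Runs.loop_done rfl⟩
  | cons b u ih =>
    obtain ⟨v', hv', h⟩ := ih (v.1, b, v.2.2) (b :: l)
    refine ⟨v', hv', ?_⟩
    have h₁ := Runs.pop (Γ := Sym P (Reg X m k)) .inp
      (fun (v : Ctl P) (o : Option Bool) => (v.1, o.getD false, v.2.2)) v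
      (Store.mk (b :: u) [] (fun _ => l) (fun _ => []) [] []).stk
    rw [Store.update_inp] at h₁
    have h₂ := runs_pushAll (P := P) hrs (v.1, b, v.2.2)
      (Store.mk u [] (fun _ => l) (fun _ => []) [] [])
    have h₃ := Runs.loop_step (k := .inp) (List.cons_ne_nil b u) (h₁.seq h₂)
      (by simpa [hmem, loadInput] using h)
    convert! h₃ using 1
    · simp
    · simp; ring

variable [DecidableEq P] [Fintype P] {w : List Bool}

/-- Move the given registers to the beginning of the word. -/
def resetAll : List (Reg X m k) → Prog P (Reg X m k)
  | [] => .load id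
  | r :: rs => .seq (.loop (.left r) (moveLeft r)) (resetAll rs)

theorem exec_resetAll (rs : List (Reg X m k)) (e : Reg X m k → ℕ) (d : Data P)
    (he : ∀ r, e r ≤ w.length) :
    Exec w (resetAll rs) e d (fun r => if r ∈ rs then 0 else e r) d
      (rs.length * (w.length * 3 + 1) + 1) := by
  induction rs generalizing e with
  | nil => simpa [resetAll] using exec_load_id e d
  | cons r rs ih =>
    have h₁ := exec_resetRegister (w := w) r e d (he r)
    rw [Function.update_eq_self] at h₁
    have h₂ := ih (Function.update e r 0) fun r' => by
      by_cases h : r' = r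
      · subst h; simp
      · simpa [h] using he r'
    have h₃ : (fun r' => if r' ∈ r :: rs then 0 else e r') =
        fun r' => if r' ∈ rs then 0 else Function.update e r 0 r' := by
      funext r'
      by_cases h : r' = r
      · subst h; simp
      · simp [h]
    rw [h₃]
    refine (h₁.seq h₂).mono ?_
    have := he r
    simp only [List.length_cons]
    nlinarith

theorem exec_newEntry (e : Reg X m k → ℕ) (n : ℕ) (b : Bool) :
    Exec w (.push .tabRight fun _ => ∅) e (Data.mk (∅ : Finset (P × ℕ)) n 0 b) e ⟨∅, n + 1, 0, b⟩
      1 := by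
  intro v hv
  have h := Runs.push (Γ := Sym P (Reg X m k)) .tabRight (fun _ : Ctl P => ∅) v
    (store w e (Data.mk (∅ : Finset (P × ℕ)) n 0 b)).stk
  rw [Store.update_tabRight] at h
  refine ⟨v, 1, hv, le_rfl, ?_⟩
  have hc (i : ℕ) : cells (∅ : Finset (P × ℕ)) i = List.replicate i ∅ := by
    rw [List.eq_replicate_iff]
    simp [cells, cell]
  simpa [Store.stk, store, hc, List.replicate_succ] using h

end Driver

section Evaluator

variable {P X ι : Type} [DecidableEq P] [Fintype P] [DecidableEq X] [Fintype X] [Fintype ι]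

/-- The program that computes the least model of the rules and outputs whether it contains the fact
`goal()`. -/
noncomputable def evaluator (rules : ι → Rule P X) (goal : P) (m k : ℕ) :
    Prog P (Reg X m k) :=
  .seq (loadInput Finset.univ.toList) <|
  .seq (.seq (resetAll Finset.univ.toList) <|
    .seq (repeatAll (.push .tabRight fun _ => ∅) ((List.finRange m).map .digit)) <|
    .seq (repeatAll (forAllProg (Finset.univ.toList.map rules) Finset.univ.toList)
      ((List.finRange k).map .round)) <|
    litProg (.atom goal [])) <|
  .seq (.push .out fun v => v.1) <|
  clearAll (Finset.univ.erase .out).toList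

open Classical in
/-- Whether a fact without arguments belongs to the least model of a fixed Datalog program can be
decided in polynomial time. -/
theorem polyTime_derivable (rules : ι → Rule P X) (goal : P) (m : ℕ)
    (hr : ∀ i, (rules i).ArityLE m) {α : Type} (enc : α → List Bool) (ans : α → Bool)
    (h : ∀ x, ans x = true ↔ Derivable rules (enc x) goal []) :
    Nonempty (Turing.TM2ComputableInPolyTime enc Computability.encodeBool ans) := by
  -- there are `card P * base ^ m ≤ base ^ k` possible facts, so `base ^ k` rounds suffice
  obtain ⟨k, hk⟩ : ∃ k, k = m + Fintype.card P := ⟨_, rfl⟩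
  -- `c₁` bounds the creation of the empty table, `c₃` the rounds, and `c₄` the test of the goal
  obtain ⟨c₁, hc₁⟩ := exists_exec_repeatAll (P := P) (X := X) (m := m) (k := k)
    (.push .tabRight fun _ => ∅) ∅ (fun _ d => { d with size := d.size + 1 })
    (fun _ d => d.facts = ∅ ∧ d.pos = 0) (fun _ _ h => h) 1
    (fun w e d _ hd => by
      obtain ⟨F, n, i, b⟩ := d
      obtain ⟨rfl, rfl⟩ := hd
      simpa using exec_newEntry (w := w) e n b)
    ((List.finRange m).map .digit)
    ((List.nodup_finRange m).map fun _ _ h => by simpa using h) (by simp)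
  obtain ⟨c₂, hc₂⟩ := exists_exec_forAllProg (m := m) (k := k) (Finset.univ.toList.map rules)
    (by simpa using hr) Finset.univ.toList (Finset.nodup_toList _)
  obtain ⟨c₃, hc₃⟩ := exists_exec_repeatAll (P := P) (X := X) (m := m) (k := k)
    (forAllProg (Finset.univ.toList.map rules) Finset.univ.toList)
    {r | ∀ i, r ≠ .round i}
    (fun w d => { d with facts := applyRules w (instances (Finset.univ.toList.map rules) w.length
      Finset.univ.toList fun _ => 0) d.facts })
    (fun w d => d.size = tableSize m w ∧ d.pos = 0 ∧ d.flag = true) (fun _ _ h => h) c₂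
    (fun w e d he hd => by
      obtain ⟨F, n, i, b⟩ := d
      obtain ⟨h₁, h₂, h₃⟩ := hd
      simp only at h₁ h₂ h₃
      subst h₁ h₂ h₃
      have hv : varVal e = fun _ => 0 := funext fun x => he _ (by simp)
      have := hc₂ w e F ⟨fun i => he _ (by simp), he _ (by simp), by simp [hv]⟩ (by simp [hv])
      simpa [hv] using this)
    ((List.finRange k).map .round)
    ((List.nodup_finRange k).map fun _ _ h => by simpa using h) (by simp)
  obtain ⟨c₄, hc₄⟩ := exists_exec_litProg (P := P) (X := X) (m := m) (k := k) (.atom goal [])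
    (by rintro p args ⟨⟩; simp)
  let R : List (Reg X m k) := Finset.univ.toList
  let K : List (Stk (Reg X m k)) := (Finset.univ.erase .out).toList
  let n : Polynomial ℕ := Polynomial.X
  refine StackProg.polyTime (evaluator rules goal m k) (k₀ := .inp) (k₁ := .out)
    (Equiv.refl Bool) (Equiv.refl Bool) (true, false, ∅) enc ans
    ((n * (R.length + 3) + 1) + ((R.length * (n * 3 + 1) + 1) + (c₁ + (c₃ + (c₄ + (1 +
      (K.length * ((n + (n + 3) ^ m) * 2 + 1) + 1))))))) fun x => ?_
  obtain ⟨w, hw⟩ : ∃ w, w = enc x := ⟨_, rfl⟩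
  let g : Finset (P × ℕ) → Finset (P × ℕ) := applyRules w
    (instances (Finset.univ.toList.map rules) w.length Finset.univ.toList fun _ => 0)
  let F := g^[base w ^ k] ∅
  -- loading the input
  obtain ⟨v₀, hv₀, r₀⟩ := runs_loadInput (P := P) (rs := R) (Finset.nodup_toList _)
    (fun r => by simp [R]) (true, false, ∅) w []
  have hs : (Store.mk (P := P) [] [] (fun _ : Reg X m k => w.reverse ++ []) (fun _ => []) [] []) =
      store w (fun _ => w.length) ⟨∅, 0, 0, true⟩ := by
    simp [store, cells]
  rw [hs] at r₀
  -- computing the facts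
  have e₁ := exec_resetAll (w := w) R (fun _ => w.length) (Data.mk (∅ : Finset (P × ℕ)) 0 0 true)
    (fun _ => le_rfl)
  have hR : (fun r => if r ∈ R then 0 else w.length) = fun _ : Reg X m k => 0 := by simp [R]
  rw [hR] at e₁
  have e₂ := hc₁ w (fun _ => 0) ⟨∅, 0, 0, true⟩ (by simp) (by simp) (by simp)
  have hsize (j i : ℕ) : (fun d : Data P => { d with size := d.size + 1 })^[j] ⟨∅, i, 0, true⟩ =
      ⟨∅, i + j, 0, true⟩ := by
    induction j generalizing i with
    | zero => rfl
    | succ j ih =>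
      rw [Function.iterate_succ_apply, ih]
      simp [add_comm, add_left_comm]
  have e₃ := hc₃ w (fun _ => 0) ⟨∅, tableSize m w, 0, true⟩ (by simp) (by simp) (by simp)
  have hfacts (j : ℕ) (G : Finset (P × ℕ)) : (fun d : Data P => { d with facts := g d.facts })^[j]
      ⟨G, tableSize m w, 0, true⟩ = ⟨g^[j] G, tableSize m w, 0, true⟩ := by
    induction j generalizing G with
    | zero => rfl
    | succ j ih => rw [Function.iterate_succ_apply, ih, Function.iterate_succ_apply]
  have e₄ := hc₄ w (fun _ => 0) F true ⟨by simp, rfl, by simp [varVal]⟩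
  have hsize' := hsize (base w ^ m) 0
  have hfacts' := hfacts (base w ^ k) ∅
  simp only [List.length_map, List.length_finRange] at e₂ e₃
  rw [hsize', zero_add] at e₂
  erw [hfacts'] at e₃
  obtain ⟨v₁, t₁, hv₁, ht₁, r₁⟩ := e₁.seq (e₂.seq (e₃.seq e₄)) v₀ hv₀
  have hans : v₁.1 = ans x := by
    rw [hv₁, Bool.eq_iff_iff, h x, ← hw]
    simp only [Bool.true_and, decide_eq_true_eq]
    exact iterate_applyRules_iff (w := w) (n := base w ^ k) hr (fun x => by simp)
      (by
        rw [hk, pow_add, mul_comm, tableSize]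
        refine Nat.mul_le_mul_left _ (Nat.lt_pow_self ?_).le
        simp [base]) goal
  -- output and cleaning up
  have r₂ := Runs.push (Γ := Sym P (Reg X m k)) .out (fun v : Ctl P => v.1) v₁
    (store w (fun _ => 0) ⟨F, tableSize m w, 0, true && decide
      (Lit.Holds w (inTable w F) (varVal fun _ : Reg X m k => 0) (.atom goal []))⟩).stk
  rw [Store.update_out] at r₂
  let s₁ : Store P (Reg X m k) :=
    { store w (fun _ => 0) ⟨F, tableSize m w, 0, true && decide
      (Lit.Holds w (inTable w F) (varVal fun _ : Reg X m k => 0) (.atom goal []))⟩ with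
      out := [v₁.1] }
  obtain ⟨t₂, ht₂, r₃⟩ := runs_clearAll K v₁ s₁.stk (c := w.length + tableSize m w)
    (fun s hs => by
      cases s with
      | inp => simp [s₁, Store.stk, store]
      | out => simp [K] at hs
      | left r => simp [s₁, Store.stk, store]
      | right r => simp [s₁, Store.stk, store]
      | tabLeft => simp [s₁, Store.stk, store]
      | tabRight => simp [s₁, Store.stk, store])
  have hin : (Function.update (fun _ => []) Stk.inp ((enc x).map (Equiv.refl Bool).symm) :
      ∀ s, List (Sym P (Reg X m k) s)) =
      (Store.mk (P := P) (R := Reg X m k) w [] (fun _ => []) (fun _ => []) [] []).stk := by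
    have hmap : (enc x).map (Equiv.refl Bool).symm = w := by rw [hw]; exact List.map_id _
    funext s
    cases s <;> first | exact hmap | rfl
  refine ⟨v₁, w.length * (R.length + 3) + 1 + (t₁ + (1 + t₂)), ?_, ?_⟩
  · rw [← hw]
    simp only [Polynomial.eval_add, Polynomial.eval_mul, Polynomial.eval_pow, Polynomial.eval_X,
      Polynomial.eval_ofNat, Polynomial.eval_one, Polynomial.eval_natCast, Nat.cast_id, n]
    simp only [tableSize, base] at ht₂
    omega
  · have := r₀.seq (r₁.seq (r₂.seq r₃))
    rw [hin]
    convert! this using 1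
    funext s
    by_cases hs : s = .out
    · subst hs
      rw [Function.update_self, if_neg (by simp [K]), ← hans]
      rfl
    · rw [Function.update_of_ne hs, if_pos (by simp [K, hs])]

end Evaluator

end Datalog

namespace ForestSLP

/-! ### Reading a forest with a word automaton -/

section Reads

namespace WordAutomaton

variable {k : ℕ} (N : WordAutomaton k)

/-- The number `s` is an initial state. -/
def IsStart (s : ℕ) : Prop := ∃ x ∈ N.start, (x : ℕ) = s

/-- The number `s` is an accepting state. -/
def IsAccept (s : ℕ) : Prop := ∃ x ∈ N.accept, (x : ℕ) = s

/-- The numbers `s`, `q`, `t` form a transition. -/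
def IsStep (s q t : ℕ) : Prop := ∃ x ∈ N.trans, (x.1 : ℕ) = s ∧ (x.2.1 : ℕ) = q ∧ (x.2.2 : ℕ) = t

end WordAutomaton

namespace ForestAutomaton

variable {σ : ℕ} (M : ForestAutomaton σ)

/-- `N` has a transition from `s` to `t` that reads the state of a root with label `a`, the word of
states of whose children is read by the horizontal automaton along a path whose ends satisfy `φ`. -/
def TreeStep (a : Fin σ) (φ : WordAutomaton M.states → ℕ → ℕ → Prop) (N : WordAutomaton M.states)
    (s t : ℕ) : Prop :=
  ∃ r ∈ M.rules, r.label = a ∧ N.IsStep s r.target t ∧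
    ∃ x y, r.horizontal.IsStart x ∧ r.horizontal.IsAccept y ∧ φ r.horizontal x y

/-- `N` can go from `s` to `s'` while it reads the word of root states of some run of `M` on a
forest. -/
def Reads : Forest (Fin σ) → WordAutomaton M.states → ℕ → ℕ → Prop
  | .nil, _, s, s' => s = s'
  | .cons a f g, N, s, s' => ∃ t, M.TreeStep a (fun N' => Reads f N') N s t ∧ Reads g N t s'

/-- For every forest `f` such that `N'` can go from `p` to `p'` while it reads `f`, the automaton
`N` can go from `s` to `s'` while it reads `c⟨f⟩`, where the siblings of the parameter are read
by `N'`. -/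
def CtxReads : Ctx (Fin σ) → WordAutomaton M.states → ℕ → ℕ → WordAutomaton M.states → ℕ → ℕ → Prop
  | .hole g, N, s, s', N', p, p' => N' = N ∧ p = s ∧ M.Reads g N p' s'
  | .right a f c, N, s, s', N', p, p' =>
    ∃ t, M.TreeStep a (fun N₁ => M.Reads f N₁) N s t ∧ CtxReads c N t s' N' p p'
  | .down a c g, N, s, s', N', p, p' =>
    ∃ t, M.TreeStep a (fun N₁ x y => CtxReads c N₁ x y N' p p') N s t ∧ M.Reads g N t s'

variable {M}

theorem TreeStep.mono {a : Fin σ} {φ ψ : WordAutomaton M.states → ℕ → ℕ → Prop}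
    {N : WordAutomaton M.states} {s t : ℕ} (h : ∀ N x y, φ N x y → ψ N x y)
    (hs : M.TreeStep a φ N s t) : M.TreeStep a ψ N s t := by
  obtain ⟨r, hr, ha, hst, x, y, hx, hy, hφ⟩ := hs
  exact ⟨r, hr, ha, hst, x, y, hx, hy, h _ _ _ hφ⟩

theorem treeStep_exists {ι : Sort*} {a : Fin σ} {φ : ι → WordAutomaton M.states → ℕ → ℕ → Prop}
    {N : WordAutomaton M.states} {s t : ℕ} :
    M.TreeStep a (fun N x y => ∃ i, φ i N x y) N s t ↔ ∃ i, M.TreeStep a (φ i) N s t := by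
  constructor
  · rintro ⟨r, hr, ha, hst, x, y, hx, hy, i, hφ⟩
    exact ⟨i, r, hr, ha, hst, x, y, hx, hy, hφ⟩
  · rintro ⟨i, h⟩
    exact h.mono fun _ _ _ h => ⟨i, h⟩

theorem treeStep_and {a : Fin σ} {φ : WordAutomaton M.states → ℕ → ℕ → Prop} {p : Prop}
    {N : WordAutomaton M.states} {s t : ℕ} :
    M.TreeStep a (fun N x y => φ N x y ∧ p) N s t ↔ M.TreeStep a φ N s t ∧ p := by
  constructor
  · rintro ⟨r, hr, ha, hst, x, y, hx, hy, hφ, h⟩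
    exact ⟨⟨r, hr, ha, hst, x, y, hx, hy, hφ⟩, h⟩
  · rintro ⟨h, hp⟩
    exact h.mono fun _ _ _ h => ⟨h, hp⟩

theorem reads_append {f g : Forest (Fin σ)} {N : WordAutomaton M.states} {s s' : ℕ} :
    M.Reads (f.append g) N s s' ↔ ∃ t, M.Reads f N s t ∧ M.Reads g N t s' := by
  induction f generalizing s with
  | nil => simp [Forest.append, Reads]
  | cons a f g' _ ih =>
    simp only [Forest.append, Reads, ih]
    grind

theorem reads_tree {a : Fin σ} {f : Forest (Fin σ)} {N : WordAutomaton M.states} {s t : ℕ} :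
    M.Reads (.cons a f .nil) N s t ↔ M.TreeStep a (fun N' => M.Reads f N') N s t := by
  simp [Reads]

theorem ctxReads_tree {a : Fin σ} {c : Ctx (Fin σ)} {N N' : WordAutomaton M.states}
    {s t p q : ℕ} : M.CtxReads (.down a c .nil) N s t N' p q ↔
      M.TreeStep a (fun N₁ x y => M.CtxReads c N₁ x y N' p q) N s t := by
  simp [Reads, CtxReads]

theorem ctxReads_appendLeft {f : Forest (Fin σ)} {c : Ctx (Fin σ)} {N N' : WordAutomaton M.states}
    {s s' p p' : ℕ} : M.CtxReads (Ctx.appendLeft f c) N s s' N' p p' ↔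
      ∃ t, M.Reads f N s t ∧ M.CtxReads c N t s' N' p p' := by
  induction f generalizing s with
  | nil => simp [Ctx.appendLeft, Reads]
  | cons a f g' _ ih =>
    simp only [Ctx.appendLeft, Reads, CtxReads, ih]
    grind

theorem ctxReads_appendRight {c : Ctx (Fin σ)} {g : Forest (Fin σ)}
    {N N' : WordAutomaton M.states} {s s' p p' : ℕ} :
    M.CtxReads (c.appendRight g) N s s' N' p p' ↔
      ∃ t, M.CtxReads c N s t N' p p' ∧ M.Reads g N t s' := by
  induction c generalizing s with
  | hole g' =>
    simp only [Ctx.appendRight, CtxReads, reads_append]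
    grind
  | right a f c ih =>
    simp only [Ctx.appendRight, CtxReads, ih]
    grind
  | down a c g' _ =>
    simp only [Ctx.appendRight, CtxReads, reads_append]
    grind

theorem reads_plug {c : Ctx (Fin σ)} {f : Forest (Fin σ)} {N : WordAutomaton M.states}
    {s s' : ℕ} : M.Reads (c.plug f) N s s' ↔
      ∃ N' p p', M.CtxReads c N s s' N' p p' ∧ M.Reads f N' p p' := by
  induction c generalizing N s s' with
  | hole g =>
    simp only [Ctx.plug, CtxReads, reads_append]
    grind
  | right a f' c ih =>
    simp only [Ctx.plug, CtxReads, Reads, ih]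
    grind
  | down a c g ih =>
    have e : M.Reads (c.plug f) =
        fun N x y => ∃ N' p p', M.CtxReads c N x y N' p p' ∧ M.Reads f N' p p' := by
      funext N x y
      exact propext ih
    simp only [Ctx.plug, CtxReads, Reads, e, treeStep_exists, treeStep_and]
    grind

theorem ctxReads_comp {c d : Ctx (Fin σ)} {N O : WordAutomaton M.states} {s s' q q' : ℕ} :
    M.CtxReads (c.comp d) N s s' O q q' ↔
      ∃ N' p p', M.CtxReads c N s s' N' p p' ∧ M.CtxReads d N' p p' O q q' := by
  induction c generalizing N s s' with
  | hole g =>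
    simp only [Ctx.comp, CtxReads, ctxReads_appendRight]
    grind
  | right a f' c ih =>
    simp only [Ctx.comp, CtxReads, ih]
    grind
  | down a c g ih =>
    simp only [Ctx.comp, CtxReads, ih, treeStep_exists, treeStep_and]
    grind

/-- With `exists_run_of_reads`, this shows that `Reads` has the meaning stated in its docstring. -/
theorem reads_of_run {f : Forest (Fin σ)} {u : List (Fin M.states)} (h : M.Run f u)
    {N : WordAutomaton M.states} {s s' : Fin N.size} (hu : s' ∈ N.toNFA.evalFrom {s} u) :
    M.Reads f N s s' := by
  induction h generalizing N s s' with
  | nil =>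
    rw [NFA.evalFrom_nil, Set.mem_singleton_iff] at hu
    rw [hu]
    rfl
  | cons hr _ hacc _ ihf ihg =>
    rw [NFA.evalFrom_cons, NFA.stepSet_singleton, NFA.mem_evalFrom_iff_exists] at hu
    obtain ⟨t, ht, hu⟩ := hu
    obtain ⟨y, hy, hacc⟩ := hacc
    rw [NFA.eval, NFA.mem_evalFrom_iff_exists] at hacc
    obtain ⟨x, hx, hacc⟩ := hacc
    exact ⟨t, ⟨_, hr, rfl, ⟨_, ht, rfl, rfl, rfl⟩, x, y, ⟨x, hx, rfl⟩, ⟨y, hy, rfl⟩, ihf hacc⟩,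
      ihg hu⟩

theorem exists_run_of_reads {f : Forest (Fin σ)} {N : WordAutomaton M.states} {s : Fin N.size}
    {s' : ℕ} (h : M.Reads f N s s') :
    ∃ u, M.Run f u ∧ ∃ t ∈ N.toNFA.evalFrom {s} u, (t : ℕ) = s' := by
  induction f generalizing N s s' with
  | nil => exact ⟨[], .nil, s, rfl, h⟩
  | cons a f g ihf ihg =>
    obtain ⟨t, ⟨r, hr, rfl, ⟨⟨s₁, q, t⟩, ht, hs, hq, rfl⟩, x, y, ⟨x, hx, rfl⟩, ⟨y, hy, rfl⟩, hf⟩,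
      hg⟩ := h
    obtain ⟨u, hu, y', hy', e⟩ := ihf hf
    obtain ⟨v, hv, t', ht', rfl⟩ := ihg hg
    obtain rfl : y' = y := Fin.ext e
    obtain rfl : s₁ = s := Fin.ext hs
    obtain rfl : q = r.target := Fin.ext hq
    refine ⟨_, .cons hr hu ⟨y', hy, NFA.mem_evalFrom_iff_exists.2 ⟨x, hx, hy'⟩⟩ hv, t', ?_, rfl⟩
    rw [NFA.evalFrom_cons, NFA.stepSet_singleton, NFA.mem_evalFrom_iff_exists]
    exact ⟨t, ht, ht'⟩

theorem accepts_iff_reads {f : Forest (Fin σ)} : M.Accepts f ↔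
    ∃ x y, M.final.IsStart x ∧ M.final.IsAccept y ∧ M.Reads f M.final x y := by
  constructor
  · rintro ⟨u, hu, y, hy, hacc⟩
    rw [NFA.eval, NFA.mem_evalFrom_iff_exists] at hacc
    obtain ⟨x, hx, hacc⟩ := hacc
    exact ⟨x, y, ⟨x, hx, rfl⟩, ⟨y, hy, rfl⟩, reads_of_run hu hacc⟩
  · rintro ⟨x, y, ⟨x, hx, rfl⟩, ⟨y, hy, rfl⟩, h⟩
    obtain ⟨u, hu, y', hy', e⟩ := exists_run_of_reads h
    obtain rfl : y' = y := Fin.ext e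
    exact ⟨u, hu, y', hy, NFA.mem_evalFrom_iff_exists.2 ⟨x, hx, hy'⟩⟩

theorem TreeStep.lt {a : Fin σ} {φ : WordAutomaton M.states → ℕ → ℕ → Prop}
    {N : WordAutomaton M.states} {s t : ℕ} (h : M.TreeStep a φ N s t) :
    s < N.size ∧ t < N.size := by
  obtain ⟨_, _, _, ⟨x, _, rfl, _, rfl⟩, _⟩ := h
  exact ⟨x.1.2, x.2.2.2⟩

theorem Reads.eq_or_lt {f : Forest (Fin σ)} {N : WordAutomaton M.states} {s s' : ℕ}
    (h : M.Reads f N s s') : s = s' ∨ s < N.size ∧ s' < N.size := by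
  induction f generalizing s with
  | nil => exact .inl h
  | cons a f g _ ih =>
    obtain ⟨t, ht, hg⟩ := h
    have := ht.lt
    have := ih hg
    grind

/-- The automaton at the parameter is the given one or the horizontal automaton of a rule,
and its states at the parameter are among its own states or the given ones. -/
theorem CtxReads.invariant (p₀ : WordAutomaton M.states → Prop) {n : ℕ}
    (hn : ∀ N, p₀ N → N.size ≤ n) (hp : ∀ r ∈ M.rules, p₀ r.horizontal) {c : Ctx (Fin σ)}
    {N N' : WordAutomaton M.states} {s s' p p' : ℕ} (h : M.CtxReads c N s s' N' p p')
    (hN : p₀ N) (hs : s ≤ n) (hs' : s' ≤ n) : p₀ N' ∧ p ≤ n ∧ p' ≤ n := by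
  induction c generalizing N s s' with
  | hole g =>
    obtain ⟨rfl, rfl, h⟩ := h
    have := hn _ hN
    have := h.eq_or_lt
    exact ⟨hN, hs, by omega⟩
  | right a f c ih =>
    obtain ⟨t, ht, h⟩ := h
    have := hn _ hN
    have := ht.lt
    exact ih h hN (by omega) hs'
  | down a c g ih =>
    obtain ⟨t, ⟨r, hr, _, _, x, y, ⟨x, _, rfl⟩, ⟨y, _, rfl⟩, h⟩, _⟩ := h
    have := hn _ (hp r hr)
    exact ih h (hp r hr) (by omega) (by omega)

end ForestAutomaton

end Reads

open Datalog (Term Lit HoldsAll IsModel Derivable isModel_derivable)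

/-! ### A Datalog program for acceptance -/

section Program

/-- Kinds of substrings of the encodings of inputs. -/
inductive Code where
  | nat | triple | rule | automaton | rhs
  deriving DecidableEq

instance : Fintype Code where
  elems := {.nat, .triple, .rule, .automaton, .rhs}
  complete x := by cases x <;> simp

/-- Predicates. The arguments are positions of the input word, states, labels and variables of the
straight-line program. A word automaton is represented by a position at which its encoding starts.
* `num i v j`: the number `v` is encoded between the positions `i` and `j`.
* `one i j`, `two i j`: the same for the numbers 1 and 2.
* `codeEnd x i j`: a code of kind `x` at `i` ends at `j`.
* `entry x i j`: an entry of the list of codes of kind `x` at `i` starts at `j`.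
* `listEnd x i j`: the list of codes of kind `x` at `i` ends at `j`.
* `isStart N s`, `isAccept N s`, `isStep N s q t`: the states and transitions of `N`.
* `rule a q N`: the forest automaton has the rule `a(N) → q`.
* `treeStep N a s t N' x y`: `N` has a transition from `s` to `t` that reads the target of a rule
  with label `a` and horizontal automaton `N'`, which has the initial state `x` and the accepting
  state `y`.
* `final N`: `N` is the automaton for the words of root states.
* `slp i`: the encoding of the straight-line program starts at `i`.
* `startVar A`: the start variable is `A`.
* `rhsList A i`: the list of the right-hand sides of the variables from `A` on starts at `i`.
* `rhs A i`: the right-hand side of `A` starts at `i`.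
* `hor A B C`, `ver A B C`: the right-hand side of `A` is a concatenation of `B` and `C`.
* `un A a B`: the right-hand side of `A` is `a(B)`.
* `atom A a b`, `atomBot A a b`: the right-hand side of `A` is an atomic cluster.
* `label A a`: the value of `A` is a cluster whose root has the label `a`.
* `forest A N s t`: the value of `A` has a forest as content, and `N` can go from `s` to `t` while it
  reads this forest.
* `ctx A N s t N' p q`: the same for contexts, where `N'` goes from `p` to `q` at the parameter.
* `fullForest`, `fullCtx`: the same for the full value instead of the content.
* `accept`: the automaton accepts. -/
inductive Pred where
  | num | one | two
  | codeEnd (x : Code) | entry (x : Code) | listEnd (x : Code)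
  | isStart | isAccept | isStep | rule | treeStep | final
  | slp | startVar | rhsList | rhs | hor | ver | un | atom | atomBot | label
  | forest | ctx | fullForest | fullCtx | accept
  deriving DecidableEq, Fintype

/-- The variables of the Datalog rules. -/
abbrev Var := Fin 12

/-- Functions of `n` variables that produce a Datalog rule. -/
def RuleScheme : ℕ → Type
  | 0 => Datalog.Rule Pred Var
  | n + 1 => Var → RuleScheme n

/-- The rule that a scheme produces for the variables `i, i + 1, …`. -/
def RuleScheme.inst (i : Var) : {n : ℕ} → RuleScheme n → Datalog.Rule Pred Var
  | 0, r => r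
  | _ + 1, r => inst (i + 1) (r i)

/-- The rule with `n` variables that is given by a scheme. -/
def mkRule (n : ℕ) (r : RuleScheme n) : Datalog.Rule Pred Var := r.inst 0

instance : Coe Var (Term Var) := ⟨.var⟩

/-- Names of the rules that do not depend on the kind of straight-line programs. -/
inductive CommonRule where
  | numZero | numSucc | one | two
  | entryHead (x : Code) | entryTail (x : Code) | listEndNil (x : Code) | listEndCons (x : Code)
  | natEnd | tripleEnd | ruleEnd | automatonEnd | binEnd
  | isStart | isAccept | isStep | rule | treeStep | final
  | slp | startVar | rhsListZero | rhsListSucc | rhs | hor | ver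
  | horForestForest | horForestCtx | horCtxForest | verForest | verCtx | accept
  deriving Fintype

/-- The rules that do not depend on the kind of straight-line programs. -/
def commonRule : CommonRule → Datalog.Rule Pred Var
  | .numZero => mkRule 1 fun i => ⟨.num, [i, .zero, .succ i], [.bit i false]⟩
  | .numSucc => mkRule 3 fun i v j =>
    ⟨.num, [i, .succ v, j], [.bit i true, .atom .num [.succ i, v, j]]⟩
  | .one => mkRule 2 fun i j => ⟨.one, [i, j], [.bit i true, .atom .num [.succ i, .zero, j]]⟩
  | .two => mkRule 2 fun i j => ⟨.two, [i, j], [.bit i true, .atom .one [.succ i, j]]⟩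
  | .entryHead x => mkRule 1 fun i => ⟨.entry x, [i, .succ i], [.bit i true]⟩
  | .entryTail x => mkRule 3 fun i j k => ⟨.entry x, [i, k],
      [.bit i true, .atom (.codeEnd x) [.succ i, j], .atom (.entry x) [j, k]]⟩
  | .listEndNil x => mkRule 1 fun i => ⟨.listEnd x, [i, .succ i], [.bit i false]⟩
  | .listEndCons x => mkRule 3 fun i j k => ⟨.listEnd x, [i, k],
      [.bit i true, .atom (.codeEnd x) [.succ i, j], .atom (.listEnd x) [j, k]]⟩
  | .natEnd => mkRule 3 fun i v j => ⟨.codeEnd .nat, [i, j], [.atom .num [i, v, j]]⟩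
  | .tripleEnd => mkRule 7 fun i s j q k t l => ⟨.codeEnd .triple, [i, l],
      [.atom .num [i, s, j], .atom .num [j, q, k], .atom .num [k, t, l]]⟩
  | .ruleEnd => mkRule 6 fun i a j q k l => ⟨.codeEnd .rule, [i, l],
      [.atom .num [i, a, j], .atom .num [j, q, k], .atom (.codeEnd .automaton) [k, l]]⟩
  | .automatonEnd => mkRule 6 fun i n j k l m => ⟨.codeEnd .automaton, [i, m],
      [.atom .num [i, n, j], .atom (.listEnd .nat) [j, k], .atom (.listEnd .nat) [k, l],
        .atom (.listEnd .triple) [l, m]]⟩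
  | .binEnd => mkRule 6 fun i j B k C l => ⟨.codeEnd .rhs, [i, l],
      [.atom .two [i, j], .atom .num [.succ j, B, k], .atom .num [k, C, l]]⟩
  | .isStart => mkRule 6 fun N s n i j k => ⟨.isStart, [N, s],
      [.atom .num [N, n, i], .atom (.entry .nat) [i, j], .atom .num [j, s, k]]⟩
  | .isAccept => mkRule 7 fun N s n i j k l => ⟨.isAccept, [N, s],
      [.atom .num [N, n, i], .atom (.listEnd .nat) [i, j], .atom (.entry .nat) [j, k],
        .atom .num [k, s, l]]⟩
  | .isStep => mkRule 12 fun N s q t n i j k l l₁ l₂ l₃ => ⟨.isStep, [N, s, q, t],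
      [.atom .num [N, n, i], .atom (.listEnd .nat) [i, j], .atom (.listEnd .nat) [j, k],
        .atom (.entry .triple) [k, l], .atom .num [l, s, l₁], .atom .num [l₁, q, l₂],
        .atom .num [l₂, t, l₃]]⟩
  | .rule => mkRule 9 fun a q N n i m j k l => ⟨.rule, [a, q, N],
      [.atom .num [.zero, n, i], .atom .num [i, m, j], .atom (.entry .rule) [j, k],
        .atom .num [k, a, l], .atom .num [l, q, N]]⟩
  | .treeStep => mkRule 8 fun N a s t N' x y q => ⟨.treeStep, [N, a, s, t, N', x, y],
      [.atom .rule [a, q, N'], .atom .isStart [N', x], .atom .isAccept [N', y],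
        .atom .isStep [N, s, q, t]]⟩
  | .final => mkRule 5 fun N n i m j => ⟨.final, [N],
      [.atom .num [.zero, n, i], .atom .num [i, m, j], .atom (.listEnd .rule) [j, N]]⟩
  | .slp => mkRule 2 fun N i => ⟨.slp, [i], [.atom .final [N], .atom (.codeEnd .automaton) [N, i]]⟩
  | .startVar => mkRule 5 fun A i n j k => ⟨.startVar, [A],
      [.atom .slp [i], .atom .num [i, n, j], .atom .num [j, A, k]]⟩
  | .rhsListZero => mkRule 5 fun A i n j k => ⟨.rhsList, [.zero, k],
      [.atom .slp [i], .atom .num [i, n, j], .atom .num [j, A, k]]⟩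
  | .rhsListSucc => mkRule 3 fun A i j => ⟨.rhsList, [.succ A, j],
      [.atom .rhsList [A, i], .bit i true, .atom (.codeEnd .rhs) [.succ i, j]]⟩
  | .rhs => mkRule 2 fun A i => ⟨.rhs, [A, .succ i], [.atom .rhsList [A, i], .bit i true]⟩
  | .hor => mkRule 7 fun A B C i j k l => ⟨.hor, [A, B, C],
      [.atom .rhs [A, i], .atom .two [i, j], .bit j false, .atom .num [.succ j, B, k],
        .atom .num [k, C, l]]⟩
  | .ver => mkRule 7 fun A B C i j k l => ⟨.ver, [A, B, C],
      [.atom .rhs [A, i], .atom .two [i, j], .bit j true, .atom .num [.succ j, B, k],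
        .atom .num [k, C, l]]⟩
  | .horForestForest => mkRule 7 fun A B C N s t u => ⟨.forest, [A, N, s, t],
      [.atom .hor [A, B, C], .atom .forest [B, N, s, u], .atom .forest [C, N, u, t]]⟩
  | .horForestCtx => mkRule 10 fun A B C N s t u N' p q => ⟨.ctx, [A, N, s, t, N', p, q],
      [.atom .hor [A, B, C], .atom .forest [B, N, s, u], .atom .ctx [C, N, u, t, N', p, q]]⟩
  | .horCtxForest => mkRule 10 fun A B C N s t u N' p q => ⟨.ctx, [A, N, s, t, N', p, q],
      [.atom .hor [A, B, C], .atom .ctx [B, N, s, u, N', p, q], .atom .forest [C, N, u, t]]⟩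
  | .verForest => mkRule 9 fun A B C N s t N' p q => ⟨.forest, [A, N, s, t],
      [.atom .ver [A, B, C], .atom .ctx [B, N, s, t, N', p, q], .atom .fullForest [C, N', p, q]]⟩
  | .verCtx => mkRule 12 fun A B C N s t N' p q O x y => ⟨.ctx, [A, N, s, t, O, x, y],
      [.atom .ver [A, B, C], .atom .ctx [B, N, s, t, N', p, q],
        .atom .fullCtx [C, N', p, q, O, x, y]]⟩
  | .accept => mkRule 4 fun A N x y => ⟨.accept, [],
      [.atom .startVar [A], .atom .final [N], .atom .isStart [N, x], .atom .isAccept [N, y],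
        .atom .fullForest [A, N, x, y]]⟩

/-- Names of the rules for forest straight-line programs. -/
inductive FSLPRule where
  | constEnd | unEnd | eps | param | un | unForest | unCtx | fullForest | fullCtx
  deriving DecidableEq

instance : Fintype FSLPRule where
  elems := {.constEnd, .unEnd, .eps, .param, .un, .unForest, .unCtx, .fullForest, .fullCtx}
  complete x := by cases x <;> simp

/-- The rules for forest straight-line programs. -/
def fslpRule : FSLPRule → Datalog.Rule Pred Var
  | .constEnd => mkRule 2 fun i j => ⟨.codeEnd .rhs, [i, .succ j], [.atom .num [i, .zero, j]]⟩
  | .unEnd => mkRule 6 fun i j a k B l => ⟨.codeEnd .rhs, [i, l],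
      [.atom .one [i, j], .atom .num [j, a, k], .atom .num [k, B, l]]⟩
  | .eps => mkRule 5 fun A N s i j => ⟨.forest, [A, N, s, s],
      [.atom .rhs [A, i], .atom .num [i, .zero, j], .bit j false]⟩
  | .param => mkRule 6 fun A N s t i j => ⟨.ctx, [A, N, s, t, N, s, t],
      [.atom .rhs [A, i], .atom .num [i, .zero, j], .bit j true]⟩
  | .un => mkRule 7 fun A a B i j k l => ⟨.un, [A, a, B],
      [.atom .rhs [A, i], .atom .one [i, j], .atom .num [j, a, k], .atom .num [k, B, l]]⟩
  | .unForest => mkRule 9 fun A a B N s t N' x y => ⟨.forest, [A, N, s, t],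
      [.atom .un [A, a, B], .atom .treeStep [N, a, s, t, N', x, y], .atom .forest [B, N', x, y]]⟩
  | .unCtx => mkRule 12 fun A a B N s t N' x y O p q => ⟨.ctx, [A, N, s, t, O, p, q],
      [.atom .un [A, a, B], .atom .treeStep [N, a, s, t, N', x, y],
        .atom .ctx [B, N', x, y, O, p, q]]⟩
  | .fullForest => mkRule 4 fun A N s t => ⟨.fullForest, [A, N, s, t],
      [.atom .forest [A, N, s, t]]⟩
  | .fullCtx => mkRule 7 fun A N s t N' p q => ⟨.fullCtx, [A, N, s, t, N', p, q],
      [.atom .ctx [A, N, s, t, N', p, q]]⟩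

/-- Names of the rules for top dags. -/
inductive TopDagRule where
  | constEnd | atom | atomBot | labelAtom | labelAtomBot | labelHor | labelVer
  | atomForest | atomCtx | fullForest | fullCtx
  deriving DecidableEq

instance : Fintype TopDagRule where
  elems := {.constEnd, .atom, .atomBot, .labelAtom, .labelAtomBot, .labelHor, .labelVer,
    .atomForest, .atomCtx, .fullForest, .fullCtx}
  complete x := by cases x <;> simp

/-- The rules for top dags. -/
def topDagRule : TopDagRule → Datalog.Rule Pred Var
  | .constEnd => mkRule 6 fun i j a k b l => ⟨.codeEnd .rhs, [i, l],
      [.atom .num [i, .zero, j], .atom .num [.succ j, a, k], .atom .num [k, b, l]]⟩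
  | .atom => mkRule 7 fun A a b i j k l => ⟨.atom, [A, a, b],
      [.atom .rhs [A, i], .atom .num [i, .zero, j], .bit j false, .atom .num [.succ j, a, k],
        .atom .num [k, b, l]]⟩
  | .atomBot => mkRule 7 fun A a b i j k l => ⟨.atomBot, [A, a, b],
      [.atom .rhs [A, i], .atom .num [i, .zero, j], .bit j true, .atom .num [.succ j, a, k],
        .atom .num [k, b, l]]⟩
  | .labelAtom => mkRule 3 fun A a b => ⟨.label, [A, a], [.atom .atom [A, a, b]]⟩
  | .labelAtomBot => mkRule 3 fun A a b => ⟨.label, [A, a], [.atom .atomBot [A, a, b]]⟩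
  | .labelHor => mkRule 4 fun A a B C => ⟨.label, [A, a],
      [.atom .hor [A, B, C], .atom .label [B, a]]⟩
  | .labelVer => mkRule 4 fun A a B C => ⟨.label, [A, a],
      [.atom .ver [A, B, C], .atom .label [B, a]]⟩
  | .atomForest => mkRule 8 fun A a b N s t N' x => ⟨.forest, [A, N, s, t],
      [.atom .atom [A, a, b], .atom .treeStep [N, b, s, t, N', x, x]]⟩
  | .atomCtx => mkRule 6 fun A a b N s t => ⟨.ctx, [A, N, s, t, N, s, t],
      [.atom .atomBot [A, a, b]]⟩
  | .fullForest => mkRule 8 fun A a N s t N' x y => ⟨.fullForest, [A, N, s, t],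
      [.atom .label [A, a], .atom .treeStep [N, a, s, t, N', x, y],
        .atom .forest [A, N', x, y]]⟩
  | .fullCtx => mkRule 11 fun A a N s t N' x y O p q => ⟨.fullCtx, [A, N, s, t, O, p, q],
      [.atom .label [A, a], .atom .treeStep [N, a, s, t, N', x, y],
        .atom .ctx [A, N', x, y, O, p, q]]⟩

/-- The common rules together with further rules. -/
def allRules {κ : Type} (ext : κ → Datalog.Rule Pred Var) :
    CommonRule ⊕ κ → Datalog.Rule Pred Var :=
  Sum.elim commonRule ext

end Program

/-- The environment that assigns the numbers of a list to the variables `0, 1, …`. -/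
def env (l : List ℕ) (x : Var) : ℕ := l.getD x 0

theorem env_le {l : List ℕ} {n : ℕ} (hl : ∀ y ∈ l, y ≤ n) (x : Var) : env l x ≤ n := by
  rw [env]
  by_cases hx : (x : ℕ) < l.length
  · simpa [hx] using hl _ (List.getElem_mem hx)
  · simp [List.getElem?_eq_none (not_lt.1 hx)]

section Derive

variable {κ : Type} {ext : κ → Datalog.Rule Pred Var} {w : List Bool}

theorem derive_common (i : CommonRule) (l : List ℕ) (hl : ∀ y ∈ l, y ≤ w.length)
    (h : HoldsAll w (Derivable (allRules ext) w) (env l) (commonRule i).body) :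
    Derivable (allRules ext) w (commonRule i).head ((commonRule i).args.map (Term.eval (env l))) :=
  isModel_derivable (allRules ext) w (.inl i) _ (env_le hl) h

theorem derive_fslp (i : FSLPRule) (l : List ℕ) (hl : ∀ y ∈ l, y ≤ w.length)
    (h : HoldsAll w (Derivable (allRules fslpRule) w) (env l) (fslpRule i).body) :
    Derivable (allRules fslpRule) w (fslpRule i).head ((fslpRule i).args.map (Term.eval (env l))) :=
  isModel_derivable (allRules fslpRule) w (.inr i) _ (env_le hl) h

theorem derive_topDag (i : TopDagRule) (l : List ℕ) (hl : ∀ y ∈ l, y ≤ w.length)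
    (h : HoldsAll w (Derivable (allRules topDagRule) w) (env l) (topDagRule i).body) :
    Derivable (allRules topDagRule) w (topDagRule i).head
      ((topDagRule i).args.map (Term.eval (env l))) :=
  isModel_derivable (allRules topDagRule) w (.inr i) _ (env_le hl) h

end Derive

theorem _root_.Datalog.Rule.ArityLE.of_all {P X : Type} {m : ℕ} {r : Datalog.Rule P X}
    (h₁ : r.args.length ≤ m)
    (h₂ : r.body.all (fun | .atom _ args => decide (args.length ≤ m) | .bit _ _ => true) = true) :
    r.ArityLE m :=
  ⟨h₁, fun p args h => by simpa using List.all_eq_true.1 h₂ _ h⟩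

theorem arityLE_commonRule (i : CommonRule) : (commonRule i).ArityLE 7 := by
  cases i <;> exact .of_all (Nat.le_of_ble_eq_true rfl) rfl

theorem arityLE_fslpRule (i : FSLPRule) : (fslpRule i).ArityLE 7 := by
  cases i <;> exact .of_all (Nat.le_of_ble_eq_true rfl) rfl

theorem arityLE_topDagRule (i : TopDagRule) : (topDagRule i).ArityLE 7 := by
  cases i <;> exact .of_all (Nat.le_of_ble_eq_true rfl) rfl

/-! ### Soundness of the common rules -/

section Soundness

/-- A forest automaton together with a straight-line program over an algebra whose elements have
a content and a full value, which are forests or contexts. Horizontal operations concatenate the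
contents, and the content of a vertical concatenation arises by substituting the full value of the
second argument into the content of the first one.

For the forest algebra both are the element itself. For a cluster, the full value is the cluster as
a tree or context, and the content is what is below its root. -/
structure Problem (K U D : Type) where
  σ : ℕ
  automaton : ForestAutomaton σ
  program : SLP K U BinOp
  encK : K → List Bool
  encU : U → List Bool
  alg : PartialAlgebra K U BinOp D
  content : D → Forest (Fin σ) ⊕ Ctx (Fin σ)
  full : D → Forest (Fin σ) ⊕ Ctx (Fin σ)
  hor {u v d : D} : alg.bin .hor u v = some d →
    (forestAlgebra (Fin σ)).bin .hor (content u) (content v) = some (content d)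
  ver {u v d : D} : alg.bin .ver u v = some d →
    (forestAlgebra (Fin σ)).bin .ver (content u) (full v) = some (content d)

namespace Problem

variable {K U D : Type} (Q : Problem K U D)

/-- The encoding of the automaton and the program. -/
def word : List Bool :=
  encNat Q.σ ++ encForestAutomaton Q.automaton ++ encSLP Q.encK Q.encU Q.program

/-- The codes of a given kind. -/
def IsCode : Code → List Bool → Prop
  | .nat, e => ∃ v, e = encNat v
  | .triple, e => ∃ u v w, e = encNat u ++ encNat v ++ encNat w
  | .automaton, e => ∃ (k : ℕ) (N : WordAutomaton k), e = encWordAutomaton N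
  | .rule, e => ∃ (σ k : ℕ) (r : Rule σ k), e = encRule r
  | .rhs, e => ∃ (n : ℕ) (r : Rhs K U BinOp (Fin n)), e = encRhs Q.encK Q.encU r

/-- At the position `i` of the input, an encoding of `N` starts. -/
def AutomatonAt (i : ℕ) (N : WordAutomaton Q.automaton.states) : Prop :=
  ∃ rest, Q.word.drop i = encWordAutomaton N ++ rest

/-- The meaning of a fact about the forests among the contents or full values. -/
def ForestFact (f : D → Forest (Fin Q.σ) ⊕ Ctx (Fin Q.σ)) (A i s t : ℕ) : Prop :=
  ∀ (x : Fin Q.program.size) (N : WordAutomaton Q.automaton.states) (d : D), (x : ℕ) = A →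
    Q.AutomatonAt i N → Q.program.HasValue Q.alg x d →
    ∃ g, f d = .inl g ∧ Q.automaton.Reads g N s t

/-- The meaning of a fact about the contexts among the contents or full values. -/
def CtxFact (f : D → Forest (Fin Q.σ) ⊕ Ctx (Fin Q.σ)) (A i s t j p q : ℕ) : Prop :=
  ∀ (x : Fin Q.program.size) (N : WordAutomaton Q.automaton.states) (d : D), (x : ℕ) = A →
    Q.AutomatonAt i N → Q.program.HasValue Q.alg x d →
    ∃ c N', f d = .inr c ∧ Q.AutomatonAt j N' ∧ Q.automaton.CtxReads c N s t N' p q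

/-- The meaning of the predicates; `E` is the meaning of the predicates that are specific to
the kind of straight-line programs.

Most predicates are asserted only relative to a given decoding of the word at a position, so that
nothing has to be said about positions at which no code of the expected kind starts. -/
def Sem (E : Pred → List ℕ → Prop) : Pred → List ℕ → Prop
  | .num, [i, v, j] => Q.word.drop i = encNat v ++ Q.word.drop j
  | .one, [i, j] => Q.word.drop i = encNat 1 ++ Q.word.drop j
  | .two, [i, j] => Q.word.drop i = encNat 2 ++ Q.word.drop j
  | .codeEnd x, [i, j] => ∀ e rest, Q.IsCode x e → Q.word.drop i = e ++ rest → Q.word.drop j = rest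
  | .entry x, [i, j] => ∀ l rest, (∀ e ∈ l, Q.IsCode x e) →
    Q.word.drop i = encList id l ++ rest → ∃ e ∈ l, ∃ rest', Q.word.drop j = e ++ rest'
  | .listEnd x, [i, j] => ∀ l rest, (∀ e ∈ l, Q.IsCode x e) →
    Q.word.drop i = encList id l ++ rest → Q.word.drop j = rest
  | .isStart, [i, s] => ∀ N, Q.AutomatonAt i N → N.IsStart s
  | .isAccept, [i, s] => ∀ N, Q.AutomatonAt i N → N.IsAccept s
  | .isStep, [i, s, q, t] => ∀ N, Q.AutomatonAt i N → N.IsStep s q t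
  | .rule, [a, q, i] => ∃ r ∈ Q.automaton.rules, (r.label : ℕ) = a ∧ (r.target : ℕ) = q ∧
    Q.AutomatonAt i r.horizontal
  | .treeStep, [i, a, s, t, j, x, y] => ∀ N, Q.AutomatonAt i N → ∃ r ∈ Q.automaton.rules,
    (r.label : ℕ) = a ∧ N.IsStep s r.target t ∧ Q.AutomatonAt j r.horizontal ∧
      r.horizontal.IsStart x ∧ r.horizontal.IsAccept y
  | .final, [i] => Q.word.drop i =
      encWordAutomaton Q.automaton.final ++ encSLP Q.encK Q.encU Q.program
  | .slp, [i] => Q.word.drop i = encSLP Q.encK Q.encU Q.program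
  | .startVar, [A] => A = Q.program.start
  | .rhsList, [A, i] => ∃ rest, Q.word.drop i =
      encList (encRhs Q.encK Q.encU) ((List.ofFn Q.program.rhs).drop A) ++ rest
  | .rhs, [A, i] => ∀ x : Fin Q.program.size, (x : ℕ) = A → ∃ rest,
      Q.word.drop i = encRhs Q.encK Q.encU (Q.program.rhs x) ++ rest
  | .hor, [A, B, C] => ∀ x : Fin Q.program.size, (x : ℕ) = A →
    ∃ y z : Fin Q.program.size, (y : ℕ) = B ∧ (z : ℕ) = C ∧ Q.program.rhs x = .bin .hor y z
  | .ver, [A, B, C] => ∀ x : Fin Q.program.size, (x : ℕ) = A →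
    ∃ y z : Fin Q.program.size, (y : ℕ) = B ∧ (z : ℕ) = C ∧ Q.program.rhs x = .bin .ver y z
  | .forest, [A, i, s, t] => Q.ForestFact Q.content A i s t
  | .fullForest, [A, i, s, t] => Q.ForestFact Q.full A i s t
  | .ctx, [A, i, s, t, j, p, q] => Q.CtxFact Q.content A i s t j p q
  | .fullCtx, [A, i, s, t, j, p, q] => Q.CtxFact Q.full A i s t j p q
  | .accept, [] => ∀ d f, Q.program.HasValue Q.alg Q.program.start d → Q.full d = .inl f →
    Q.automaton.Accepts f
  | p, l => E p l

end Problem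

theorem SLP.HasValue.const_inv {K U B C : Type} {alg : PartialAlgebra K U B C} {P : SLP K U B}
    {A : Fin P.size} {d : C} (h : P.HasValue alg A d) {k : K} (hr : P.rhs A = .const k) :
    d = alg.const k := by
  cases h <;> simp_all

theorem SLP.HasValue.un_inv {K U B C : Type} {alg : PartialAlgebra K U B C} {P : SLP K U B}
    {A : Fin P.size} {d : C} (h : P.HasValue alg A d) {a : U} {A' : Fin P.size}
    (hr : P.rhs A = .un a A') : ∃ v, P.HasValue alg A' v ∧ d = alg.un a v := by
  cases h with
  | const h => simp [h] at hr
  | un h h₁ =>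
    rw [h] at hr
    cases hr
    exact ⟨_, h₁, rfl⟩
  | bin h => simp [h] at hr

theorem SLP.HasValue.bin_inv {K U B C : Type} {alg : PartialAlgebra K U B C} {P : SLP K U B}
    {A : Fin P.size} {d : C} (h : P.HasValue alg A d) {b : B} {A₁ A₂ : Fin P.size}
    (hr : P.rhs A = .bin b A₁ A₂) :
    ∃ u v, P.HasValue alg A₁ u ∧ P.HasValue alg A₂ v ∧ alg.bin b u v = some d := by
  cases h with
  | const h => simp [h] at hr
  | un h => simp [h] at hr
  | bin h h₁ h₂ hv =>
    rw [h] at hr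
    cases hr
    exact ⟨_, _, h₁, h₂, hv⟩

/-- The unary code is a prefix code. -/
theorem encNat_append_inj {u v : ℕ} {x y : List Bool} (h : encNat u ++ x = encNat v ++ y) :
    u = v ∧ x = y := by
  induction u generalizing v with
  | zero =>
    cases v with
    | zero => simpa [encNat] using h
    | succ v => simp [encNat, List.replicate_succ] at h
  | succ u ih =>
    cases v with
    | zero => simp [encNat, List.replicate_succ] at h
    | succ v =>
      have := ih (v := v) (by simpa [encNat, List.replicate_succ] using h)
      simpa using this

theorem drop_of_getElem? {w : List Bool} {i : ℕ} {b : Bool} (h : w[i]? = some b) :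
    w.drop i = b :: w.drop (i + 1) := by
  obtain ⟨hi, rfl⟩ := List.getElem?_eq_some_iff.1 h
  exact List.drop_eq_getElem_cons hi

theorem getElem?_of_drop {w l : List Bool} {i : ℕ} {b : Bool} (h : w.drop i = b :: l) :
    w[i]? = some b ∧ w.drop (i + 1) = l := by
  constructor
  · simpa using congrArg List.head? h
  · simpa using congrArg List.tail h

theorem encNat_succ (v : ℕ) : encNat (v + 1) = true :: encNat v := by
  simp [encNat, List.replicate_succ]

theorem encList_nil {α : Type} (e : α → List Bool) : encList e [] = [false] := rfl

theorem encList_cons {α : Type} (e : α → List Bool) (x : α) (l : List α) :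
    encList e (x :: l) = true :: (e x ++ encList e l) := by
  simp [encList]

theorem encList_map {α β : Type} (e : β → List Bool) (g : α → β) (l : List α) :
    encList e (l.map g) = encList (fun x => e (g x)) l := by
  simp [encList, List.flatMap_map]

theorem encList_eq_id {α : Type} (e : α → List Bool) (l : List α) :
    encList e l = encList id (l.map e) :=
  (encList_map id e l).symm

theorem encWordAutomaton_eq {k : ℕ} (N : WordAutomaton k) : encWordAutomaton N =
    encNat N.size ++ (encList id (N.start.map encFin) ++ (encList id (N.accept.map encFin) ++
      encList id (N.trans.map encTriple))) := by
  rw [encWordAutomaton, encList_eq_id encFin, encList_eq_id encFin, encList_eq_id encTriple]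
  simp only [List.append_assoc]

namespace Problem

variable {K U D : Type} {Q : Problem K U D}

theorem isCode_of_mem_map_encFin {n : ℕ} {l : List (Fin n)} :
    ∀ e ∈ l.map encFin, Q.IsCode .nat e :=
  List.forall_mem_map.2 fun x _ => ⟨x, rfl⟩

theorem isCode_of_mem_map_encTriple {m k : ℕ} {l : List (Fin m × Fin k × Fin m)} :
    ∀ e ∈ l.map encTriple, Q.IsCode .triple e :=
  List.forall_mem_map.2 fun x _ => ⟨x.1, x.2.1, x.2.2, rfl⟩

theorem isCode_of_mem_map_encRule {σ k : ℕ} {l : List (Rule σ k)} :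
    ∀ e ∈ l.map encRule, Q.IsCode .rule e :=
  List.forall_mem_map.2 fun x _ => ⟨σ, k, x, rfl⟩

theorem AutomatonAt.drop_eq {i n j : ℕ} {N : WordAutomaton Q.automaton.states}
    (h : Q.AutomatonAt i N) (hn : Q.word.drop i = encNat n ++ Q.word.drop j) :
    ∃ rest, Q.word.drop j = encList id (N.start.map encFin) ++ (encList id (N.accept.map encFin) ++
      (encList id (N.trans.map encTriple) ++ rest)) := by
  obtain ⟨rest, h⟩ := h
  rw [hn, encWordAutomaton_eq] at h
  simp only [List.append_assoc] at h
  exact ⟨rest, (encNat_append_inj h).2⟩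

theorem word_eq : Q.word = encNat Q.σ ++ (encNat Q.automaton.states ++
    (encList id (Q.automaton.rules.map encRule) ++ (encWordAutomaton Q.automaton.final ++
      encSLP Q.encK Q.encU Q.program))) := by
  rw [word, encForestAutomaton, encList_eq_id encRule]
  simp only [List.append_assoc]

theorem drop_rules {m n i j : ℕ} (h₁ : Q.word.drop 0 = encNat m ++ Q.word.drop i)
    (h₂ : Q.word.drop i = encNat n ++ Q.word.drop j) :
    Q.word.drop j = encList id (Q.automaton.rules.map encRule) ++
      (encWordAutomaton Q.automaton.final ++ encSLP Q.encK Q.encU Q.program) := by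
  rw [List.drop_zero, h₂] at h₁
  have h := word_eq (Q := Q)
  rw [h₁] at h
  exact (encNat_append_inj (encNat_append_inj h).2).2

theorem drop_startVar {n i j : ℕ} (h₁ : Q.word.drop i = encSLP Q.encK Q.encU Q.program)
    (h₂ : Q.word.drop i = encNat n ++ Q.word.drop j) :
    Q.word.drop j = encNat Q.program.start ++
      encList (encRhs Q.encK Q.encU) (List.ofFn Q.program.rhs) := by
  rw [h₂, encSLP, List.append_assoc] at h₁
  exact (encNat_append_inj h₁).2

theorem bin_of_encRhs {n i j : ℕ} {r : Rhs K U BinOp (Fin n)} {rest : List Bool}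
    (h : Q.word.drop i = encRhs Q.encK Q.encU r ++ rest)
    (hi : Q.word.drop i = encNat 2 ++ Q.word.drop j) : ∃ b x y, r = .bin b x y ∧
      Q.word.drop j = encBinOp b ++ (encNat x ++ (encNat y ++ rest)) := by
  rw [hi] at h
  cases r with
  | const k =>
    rw [encRhs, List.append_assoc] at h
    simpa using (encNat_append_inj h).1
  | un a x =>
    rw [encRhs, List.append_assoc, List.append_assoc] at h
    simpa using (encNat_append_inj h).1
  | bin b x y =>
    rw [encRhs, List.append_assoc, List.append_assoc, List.append_assoc] at h
    exact ⟨b, x, y, rfl, (encNat_append_inj h).2⟩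

theorem const_of_encRhs {n i j : ℕ} {r : Rhs K U BinOp (Fin n)} {rest : List Bool}
    (h : Q.word.drop i = encRhs Q.encK Q.encU r ++ rest)
    (hi : Q.word.drop i = encNat 0 ++ Q.word.drop j) :
    ∃ k, r = .const k ∧ Q.word.drop j = Q.encK k ++ rest := by
  rw [hi] at h
  cases r with
  | const k =>
    rw [encRhs, List.append_assoc] at h
    exact ⟨k, rfl, (encNat_append_inj h).2⟩
  | un a x =>
    rw [encRhs, List.append_assoc, List.append_assoc] at h
    simpa using (encNat_append_inj h).1
  | bin b x y =>
    rw [encRhs, List.append_assoc, List.append_assoc, List.append_assoc] at h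
    simpa using (encNat_append_inj h).1

theorem un_of_encRhs {n i j : ℕ} {r : Rhs K U BinOp (Fin n)} {rest : List Bool}
    (h : Q.word.drop i = encRhs Q.encK Q.encU r ++ rest)
    (hi : Q.word.drop i = encNat 1 ++ Q.word.drop j) :
    ∃ u x, r = .un u x ∧ Q.word.drop j = Q.encU u ++ (encNat x ++ rest) := by
  rw [hi] at h
  cases r with
  | const k =>
    rw [encRhs, List.append_assoc] at h
    simpa using (encNat_append_inj h).1
  | un a x =>
    rw [encRhs, List.append_assoc, List.append_assoc] at h
    exact ⟨a, x, rfl, (encNat_append_inj h).2⟩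
  | bin b x y =>
    rw [encRhs, List.append_assoc, List.append_assoc, List.append_assoc] at h
    simpa using (encNat_append_inj h).1

/-- Soundness of the common rules. -/
theorem isModel_common (E : Pred → List ℕ → Prop) : IsModel commonRule Q.word (Q.Sem E) := by
  intro i e he hb
  cases i <;> dsimp only [commonRule, mkRule, RuleScheme.inst, HoldsAll, Lit.Holds, List.map,
    Term.eval, Sem] at hb ⊢
  case numZero =>
    obtain ⟨h₁, -⟩ := hb
    exact drop_of_getElem? h₁
  case numSucc =>
    obtain ⟨h₁, h₂, -⟩ := hb
    rw [drop_of_getElem? h₁, encNat_succ]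
    exact congrArg (true :: ·) h₂
  case one =>
    obtain ⟨h₁, h₂, -⟩ := hb
    rw [drop_of_getElem? h₁, encNat_succ]
    exact congrArg (true :: ·) h₂
  case two =>
    obtain ⟨h₁, h₂, -⟩ := hb
    rw [drop_of_getElem? h₁, encNat_succ]
    exact congrArg (true :: ·) h₂
  case entryHead x =>
    obtain ⟨h₁, -⟩ := hb
    intro l rest hl h
    rw [drop_of_getElem? h₁] at h
    cases l with
    | nil => simp [encList_nil] at h
    | cons c l =>
      rw [encList_cons] at h
      exact ⟨c, by simp, encList id l ++ rest, by simpa using h⟩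
  case entryTail x =>
    obtain ⟨h₁, h₂, h₃, -⟩ := hb
    intro l rest hl h
    rw [drop_of_getElem? h₁] at h
    cases l with
    | nil => simp [encList_nil] at h
    | cons c l =>
      rw [encList_cons] at h
      have h' := h₂ c (encList id l ++ rest) (hl c (by simp)) (by simpa using h)
      obtain ⟨d, hd, r, hr⟩ := h₃ l rest (fun e he => hl e (by simp [he])) h'
      exact ⟨d, by simp [hd], r, hr⟩
  case listEndNil x =>
    obtain ⟨h₁, -⟩ := hb
    intro l rest hl h
    rw [drop_of_getElem? h₁] at h
    cases l with
    | nil => simpa [encList_nil] using h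
    | cons c l => simp [encList_cons] at h
  case listEndCons x =>
    obtain ⟨h₁, h₂, h₃, -⟩ := hb
    intro l rest hl h
    rw [drop_of_getElem? h₁] at h
    cases l with
    | nil => simp [encList_nil] at h
    | cons c l =>
      rw [encList_cons] at h
      have h' := h₂ c (encList id l ++ rest) (hl c (by simp)) (by simpa using h)
      exact h₃ l rest (fun e he => hl e (by simp [he])) h'
  case natEnd =>
    obtain ⟨h₁, -⟩ := hb
    rintro _ rest ⟨v, rfl⟩ h
    rw [h₁] at h
    exact (encNat_append_inj h).2
  case tripleEnd =>
    obtain ⟨h₁, h₂, h₃, -⟩ := hb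
    rintro _ rest ⟨u, v, w, rfl⟩ h
    rw [h₁, h₂, h₃] at h
    simp only [List.append_assoc] at h
    exact (encNat_append_inj (encNat_append_inj (encNat_append_inj h).2).2).2
  case ruleEnd =>
    obtain ⟨h₁, h₂, h₃, -⟩ := hb
    rintro _ rest ⟨σ, k, r, rfl⟩ h
    rw [h₁, h₂, encRule, encFin, encFin] at h
    simp only [List.append_assoc] at h
    exact h₃ _ _ ⟨_, _, rfl⟩ (encNat_append_inj (encNat_append_inj h).2).2
  case automatonEnd =>
    obtain ⟨h₁, h₂, h₃, h₄, -⟩ := hb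
    rintro _ rest ⟨k, N, rfl⟩ h
    rw [h₁, encWordAutomaton_eq] at h
    simp only [List.append_assoc] at h
    exact h₄ _ _ isCode_of_mem_map_encTriple (h₃ _ _ isCode_of_mem_map_encFin
      (h₂ _ _ isCode_of_mem_map_encFin (encNat_append_inj h).2))
  case binEnd =>
    obtain ⟨h₁, h₂, h₃, -⟩ := hb
    rintro _ rest ⟨n, r, rfl⟩ h
    obtain ⟨b, x, y, -, h⟩ := bin_of_encRhs h h₁
    obtain ⟨b', hb'⟩ : ∃ b', encBinOp b = [b'] := by cases b <;> exact ⟨_, rfl⟩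
    rw [hb'] at h
    have h := (getElem?_of_drop h).2
    rw [h₂, h₃] at h
    exact (encNat_append_inj (encNat_append_inj h).2).2
  case isStart =>
    obtain ⟨h₁, h₂, h₃, -⟩ := hb
    intro N hN
    obtain ⟨rest, h⟩ := hN.drop_eq h₁
    obtain ⟨_, hx, r, hr⟩ := h₂ _ _ isCode_of_mem_map_encFin h
    obtain ⟨x, hx', rfl⟩ := List.mem_map.1 hx
    rw [h₃] at hr
    exact ⟨x, hx', (encNat_append_inj hr).1.symm⟩
  case isAccept =>
    obtain ⟨h₁, h₂, h₃, h₄, -⟩ := hb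
    intro N hN
    obtain ⟨rest, h⟩ := hN.drop_eq h₁
    obtain ⟨_, hx, r, hr⟩ := h₃ _ _ isCode_of_mem_map_encFin (h₂ _ _ isCode_of_mem_map_encFin h)
    obtain ⟨x, hx', rfl⟩ := List.mem_map.1 hx
    rw [h₄] at hr
    exact ⟨x, hx', (encNat_append_inj hr).1.symm⟩
  case isStep =>
    obtain ⟨h₁, h₂, h₃, h₄, h₅, h₆, h₇, -⟩ := hb
    intro N hN
    obtain ⟨rest, h⟩ := hN.drop_eq h₁
    obtain ⟨_, hx, r, hr⟩ := h₄ _ _ isCode_of_mem_map_encTriple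
      (h₃ _ _ isCode_of_mem_map_encFin (h₂ _ _ isCode_of_mem_map_encFin h))
    obtain ⟨x, hx', rfl⟩ := List.mem_map.1 hx
    rw [h₅, h₆, h₇, encTriple] at hr
    simp only [List.append_assoc] at hr
    obtain ⟨e₁, hr⟩ := encNat_append_inj hr
    obtain ⟨e₂, hr⟩ := encNat_append_inj hr
    exact ⟨x, hx', e₁.symm, e₂.symm, (encNat_append_inj hr).1.symm⟩
  case rule =>
    obtain ⟨h₁, h₂, h₃, h₄, h₅, -⟩ := hb
    obtain ⟨_, hx, r, hr⟩ := h₃ _ _ isCode_of_mem_map_encRule (drop_rules h₁ h₂)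
    obtain ⟨x, hx', rfl⟩ := List.mem_map.1 hx
    rw [h₄, h₅, encRule] at hr
    simp only [List.append_assoc] at hr
    obtain ⟨e₁, hr⟩ := encNat_append_inj hr
    obtain ⟨e₂, hr⟩ := encNat_append_inj hr
    exact ⟨x, hx', e₁.symm, e₂.symm, _, hr⟩
  case treeStep =>
    obtain ⟨⟨r, hr, hl, ht, ha⟩, h₂, h₃, h₄, -⟩ := hb
    intro N hN
    exact ⟨r, hr, hl, ht ▸ h₄ N hN, ha, h₂ _ ha, h₃ _ ha⟩
  case final =>
    obtain ⟨h₁, h₂, h₃, -⟩ := hb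
    exact h₃ _ _ isCode_of_mem_map_encRule (drop_rules h₁ h₂)
  case slp =>
    obtain ⟨h₁, h₂, -⟩ := hb
    exact h₂ _ _ ⟨_, _, rfl⟩ h₁
  case startVar =>
    obtain ⟨h₁, h₂, h₃, -⟩ := hb
    have h := drop_startVar h₁ h₂
    rw [h₃] at h
    exact (encNat_append_inj h).1
  case rhsListZero =>
    obtain ⟨h₁, h₂, h₃, -⟩ := hb
    have h := drop_startVar h₁ h₂
    rw [h₃] at h
    exact ⟨[], by simpa using (encNat_append_inj h).2⟩
  case rhsListSucc =>
    obtain ⟨⟨rest, h₁⟩, h₂, h₃, -⟩ := hb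
    rw [drop_of_getElem? h₂] at h₁
    rw [← List.tail_drop]
    cases hl : (List.ofFn Q.program.rhs).drop (e 0) with
    | nil => simp [hl, encList_nil] at h₁
    | cons r l =>
      simp only [hl, encList_cons, List.cons_append, List.append_assoc, List.cons.injEq,
        true_and] at h₁
      exact ⟨rest, h₃ _ _ ⟨_, r, rfl⟩ h₁⟩
  case rhs =>
    obtain ⟨⟨rest, h₁⟩, h₂, -⟩ := hb
    intro x hx
    have hl := List.drop_eq_getElem_cons (l := List.ofFn Q.program.rhs) (i := x) (by simp)
    rw [drop_of_getElem? h₂, ← hx, hl] at h₁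
    simp only [encList_cons, List.cons_append, List.append_assoc, List.cons.injEq,
      true_and, List.getElem_ofFn] at h₁
    exact ⟨_, h₁⟩
  case hor =>
    obtain ⟨h₁, h₂, h₃, h₄, h₅, -⟩ := hb
    intro x hx
    obtain ⟨rest, h⟩ := h₁ x hx
    obtain ⟨b, y, z, hr, h⟩ := bin_of_encRhs h h₂
    rw [drop_of_getElem? h₃, h₄, h₅] at h
    cases b with
    | hor =>
      obtain ⟨e₁, h⟩ := encNat_append_inj (List.cons.inj h).2
      exact ⟨y, z, e₁.symm, (encNat_append_inj h).1.symm, hr⟩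
    | ver => simp [encBinOp] at h
  case ver =>
    obtain ⟨h₁, h₂, h₃, h₄, h₅, -⟩ := hb
    intro x hx
    obtain ⟨rest, h⟩ := h₁ x hx
    obtain ⟨b, y, z, hr, h⟩ := bin_of_encRhs h h₂
    rw [drop_of_getElem? h₃, h₄, h₅] at h
    cases b with
    | hor => simp [encBinOp] at h
    | ver =>
      obtain ⟨e₁, h⟩ := encNat_append_inj (List.cons.inj h).2
      exact ⟨y, z, e₁.symm, (encNat_append_inj h).1.symm, hr⟩
  case horForestForest =>
    obtain ⟨h₁, h₂, h₃, -⟩ := hb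
    intro x N d hx hN hd
    obtain ⟨y, z, hy, hz, hr⟩ := h₁ x hx
    obtain ⟨u, v, hu, hv, huv⟩ := hd.bin_inv hr
    obtain ⟨f, hf, hfN⟩ := h₂ y N u hy hN hu
    obtain ⟨g, hg, hgN⟩ := h₃ z N v hz hN hv
    have := Q.hor huv
    rw [hf, hg] at this
    exact ⟨_, (Option.some.inj this).symm, ForestAutomaton.reads_append.2 ⟨_, hfN, hgN⟩⟩
  case horForestCtx =>
    obtain ⟨h₁, h₂, h₃, -⟩ := hb
    intro x N d hx hN hd
    obtain ⟨y, z, hy, hz, hr⟩ := h₁ x hx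
    obtain ⟨u, v, hu, hv, huv⟩ := hd.bin_inv hr
    obtain ⟨f, hf, hfN⟩ := h₂ y N u hy hN hu
    obtain ⟨c, N', hc, hN', hcN⟩ := h₃ z N v hz hN hv
    have := Q.hor huv
    rw [hf, hc] at this
    exact ⟨_, N', (Option.some.inj this).symm, hN',
      ForestAutomaton.ctxReads_appendLeft.2 ⟨_, hfN, hcN⟩⟩
  case horCtxForest =>
    obtain ⟨h₁, h₂, h₃, -⟩ := hb
    intro x N d hx hN hd
    obtain ⟨y, z, hy, hz, hr⟩ := h₁ x hx
    obtain ⟨u, v, hu, hv, huv⟩ := hd.bin_inv hr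
    obtain ⟨c, N', hc, hN', hcN⟩ := h₂ y N u hy hN hu
    obtain ⟨f, hf, hfN⟩ := h₃ z N v hz hN hv
    have := Q.hor huv
    rw [hf, hc] at this
    exact ⟨_, N', (Option.some.inj this).symm, hN',
      ForestAutomaton.ctxReads_appendRight.2 ⟨_, hcN, hfN⟩⟩
  case verForest =>
    obtain ⟨h₁, h₂, h₃, -⟩ := hb
    intro x N d hx hN hd
    obtain ⟨y, z, hy, hz, hr⟩ := h₁ x hx
    obtain ⟨u, v, hu, hv, huv⟩ := hd.bin_inv hr
    obtain ⟨c, N', hc, hN', hcN⟩ := h₂ y N u hy hN hu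
    obtain ⟨f, hf, hfN⟩ := h₃ z N' v hz hN' hv
    have := Q.ver huv
    rw [hf, hc] at this
    exact ⟨_, (Option.some.inj this).symm, ForestAutomaton.reads_plug.2 ⟨N', _, _, hcN, hfN⟩⟩
  case verCtx =>
    obtain ⟨h₁, h₂, h₃, -⟩ := hb
    intro x N d hx hN hd
    obtain ⟨y, z, hy, hz, hr⟩ := h₁ x hx
    obtain ⟨u, v, hu, hv, huv⟩ := hd.bin_inv hr
    obtain ⟨c, N', hc, hN', hcN⟩ := h₂ y N u hy hN hu
    obtain ⟨c', O, hc', hO, hcO⟩ := h₃ z N' v hz hN' hv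
    have := Q.ver huv
    rw [hc', hc] at this
    exact ⟨_, O, (Option.some.inj this).symm, hO,
      ForestAutomaton.ctxReads_comp.2 ⟨N', _, _, hcN, hcO⟩⟩
  case accept =>
    obtain ⟨h₁, h₂, h₃, h₄, h₅, -⟩ := hb
    intro d f hd hf
    have hN : Q.AutomatonAt _ Q.automaton.final := ⟨_, h₂⟩
    obtain ⟨g, hg, hgN⟩ := h₅ _ _ d h₁.symm hN hd
    rw [hf] at hg
    cases hg
    exact ForestAutomaton.accepts_iff_reads.2 ⟨_, _, h₃ _ hN, h₄ _ hN, hgN⟩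

theorem isModel_allRules {κ : Type} {ext : κ → Datalog.Rule Pred Var} {E : Pred → List ℕ → Prop}
    (h : IsModel ext Q.word (Q.Sem E)) : IsModel (allRules ext) Q.word (Q.Sem E) := by
  rintro (i | i)
  · exact isModel_common E i
  · exact h i

end Problem

end Soundness

/-! ### Completeness of the common rules -/

section Completeness

section Parsing

variable {κ : Type} {ext : κ → Datalog.Rule Pred Var} {w : List Bool}

theorem lt_length_of_drop {i : ℕ} {b : Bool} {l : List Bool} (h : w.drop i = b :: l) :
    i < w.length := by
  by_contra hi
  simp [List.drop_eq_nil_of_le (not_lt.1 hi)] at h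

theorem le_length_of_drop {i v : ℕ} {rest : List Bool} (h : w.drop i = encNat v ++ rest) :
    i ≤ w.length ∧ v ≤ w.length := by
  have := congrArg List.length h
  simp [encNat] at this
  omega

theorem exists_derivable_num {v i : ℕ} {rest : List Bool} (h : w.drop i = encNat v ++ rest) :
    ∃ j, i ≤ w.length ∧ v ≤ w.length ∧ j ≤ w.length ∧
      Derivable (allRules ext) w .num [i, v, j] ∧ w.drop j = rest := by
  induction v generalizing i with
  | zero =>
    have hi := lt_length_of_drop h
    obtain ⟨hb, hr⟩ := getElem?_of_drop h
    exact ⟨i + 1, hi.le, by omega, hi,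
      derive_common .numZero [i] (by simp; omega) ⟨hb, trivial⟩, hr⟩
  | succ v ih =>
    have hv := le_length_of_drop h
    rw [encNat_succ] at h
    obtain ⟨hb, hr⟩ := getElem?_of_drop h
    obtain ⟨j, h₁, h₂, h₃, h₄, h₅⟩ := ih hr
    exact ⟨j, hv.1, hv.2, h₃,
      derive_common .numSucc [i, v, j] (by simp; omega) ⟨hb, h₄, trivial⟩, h₅⟩

/-- By means of the predicate `p`, the end of every occurrence of the string `e` is derivable from
its start. -/
def FindsEnd (ext : κ → Datalog.Rule Pred Var) (w : List Bool) (p : Pred) (e : List Bool) : Prop :=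
  ∀ i rest, w.drop i = e ++ rest →
    ∃ j, i ≤ w.length ∧ j ≤ w.length ∧ Derivable (allRules ext) w p [i, j] ∧ w.drop j = rest

theorem findsEnd_one : FindsEnd ext w .one (encNat 1) := by
  intro i rest h
  have hi := lt_length_of_drop h
  rw [encNat_succ] at h
  obtain ⟨hb, hr⟩ := getElem?_of_drop h
  obtain ⟨j, _, _, hj, h₁, h₂⟩ := exists_derivable_num (ext := ext) hr
  exact ⟨j, hi.le, hj, derive_common .one [i, j] (by simp; omega) ⟨hb, h₁, trivial⟩, h₂⟩

theorem findsEnd_two : FindsEnd ext w .two (encNat 2) := by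
  intro i rest h
  have hi := lt_length_of_drop h
  rw [encNat_succ] at h
  obtain ⟨hb, hr⟩ := getElem?_of_drop h
  obtain ⟨j, _, hj, h₁, h₂⟩ := findsEnd_one (ext := ext) _ _ hr
  exact ⟨j, hi.le, hj, derive_common .two [i, j] (by simp; omega) ⟨hb, h₁, trivial⟩, h₂⟩

theorem findsEnd_nat (v : ℕ) : FindsEnd ext w (.codeEnd .nat) (encNat v) := by
  intro i rest h
  obtain ⟨j, _, _, _, h₁, h₂⟩ := exists_derivable_num (ext := ext) h
  exact ⟨j, ‹_›, ‹_›, derive_common .natEnd [i, v, j] (by simp; omega) ⟨h₁, trivial⟩, h₂⟩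

theorem findsEnd_triple (u v x : ℕ) :
    FindsEnd ext w (.codeEnd .triple) (encNat u ++ encNat v ++ encNat x) := by
  intro i rest h
  simp only [List.append_assoc] at h
  obtain ⟨j, _, _, _, h₁, h⟩ := exists_derivable_num (ext := ext) h
  obtain ⟨k, _, _, _, h₂, h⟩ := exists_derivable_num (ext := ext) h
  obtain ⟨l, _, _, _, h₃, h⟩ := exists_derivable_num (ext := ext) h
  exact ⟨l, ‹_›, ‹_›, derive_common .tripleEnd [i, u, j, v, k, x, l] (by simp; omega)
    ⟨h₁, h₂, h₃, trivial⟩, h⟩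

theorem findsEnd_list {x : Code} {l : List (List Bool)}
    (hl : ∀ e ∈ l, FindsEnd ext w (.codeEnd x) e) :
    FindsEnd ext w (.listEnd x) (encList id l) := by
  induction l with
  | nil =>
    intro i rest h
    rw [encList_nil] at h
    have hi := lt_length_of_drop h
    obtain ⟨hb, hr⟩ := getElem?_of_drop h
    exact ⟨i + 1, hi.le, hi, derive_common (.listEndNil x) [i] (by simp; omega) ⟨hb, trivial⟩, hr⟩
  | cons e l ih =>
    intro i rest h
    rw [encList_cons, List.cons_append, List.append_assoc] at h
    have hi := lt_length_of_drop h
    obtain ⟨hb, hr⟩ := getElem?_of_drop h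
    obtain ⟨j, _, _, h₁, hr⟩ := hl e (by simp) _ _ hr
    obtain ⟨k, _, _, h₂, hr⟩ := ih (fun e he => hl e (by simp [he])) _ _ hr
    exact ⟨k, hi.le, ‹_›, derive_common (.listEndCons x) [i, j, k] (by simp; omega)
      ⟨hb, h₁, h₂, trivial⟩, hr⟩

theorem exists_derivable_entry {x : Code} {l : List (List Bool)}
    (hl : ∀ e ∈ l, FindsEnd ext w (.codeEnd x) e) {i : ℕ} {rest : List Bool}
    (h : w.drop i = encList id l ++ rest) {e : List Bool} (he : e ∈ l) :
    ∃ j ≤ w.length, Derivable (allRules ext) w (.entry x) [i, j] ∧ ∃ r, w.drop j = e ++ r := by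
  induction l generalizing i with
  | nil => simp at he
  | cons e' l ih =>
    rw [encList_cons, List.cons_append, List.append_assoc] at h
    have hi := lt_length_of_drop h
    obtain ⟨hb, hr⟩ := getElem?_of_drop h
    obtain rfl | he := List.mem_cons.1 he
    · exact ⟨i + 1, hi, derive_common (.entryHead x) [i] (by simp; omega) ⟨hb, trivial⟩, _, hr⟩
    · obtain ⟨j, _, _, h₁, hr⟩ := hl e' (by simp) _ _ hr
      obtain ⟨k, _, h₂, hk⟩ := ih (fun e he => hl e (by simp [he])) hr he
      exact ⟨k, ‹_›, derive_common (.entryTail x) [i, j, k] (by simp; omega)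
        ⟨hb, h₁, h₂, trivial⟩, hk⟩

theorem findsEnd_map_encFin {n : ℕ} {l : List (Fin n)} :
    ∀ e ∈ l.map encFin, FindsEnd ext w (.codeEnd .nat) e :=
  List.forall_mem_map.2 fun _ _ => findsEnd_nat _

theorem findsEnd_map_encTriple {m k : ℕ} {l : List (Fin m × Fin k × Fin m)} :
    ∀ e ∈ l.map encTriple, FindsEnd ext w (.codeEnd .triple) e :=
  List.forall_mem_map.2 fun _ _ => findsEnd_triple _ _ _

theorem findsEnd_automaton {k : ℕ} (N : WordAutomaton k) :
    FindsEnd ext w (.codeEnd .automaton) (encWordAutomaton N) := by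
  intro i rest h
  rw [encWordAutomaton_eq] at h
  simp only [List.append_assoc] at h
  obtain ⟨j, _, _, _, h₁, h⟩ := exists_derivable_num (ext := ext) h
  obtain ⟨k, _, _, h₂, h⟩ := findsEnd_list findsEnd_map_encFin _ _ h
  obtain ⟨l, _, _, h₃, h⟩ := findsEnd_list findsEnd_map_encFin _ _ h
  obtain ⟨m, _, _, h₄, h⟩ := findsEnd_list findsEnd_map_encTriple _ _ h
  exact ⟨m, ‹_›, ‹_›, derive_common .automatonEnd [i, N.size, j, k, l, m] (by simp; omega)
    ⟨h₁, h₂, h₃, h₄, trivial⟩, h⟩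

theorem findsEnd_map_encRule {σ k : ℕ} {l : List (Rule σ k)} :
    ∀ e ∈ l.map encRule, FindsEnd ext w (.codeEnd .rule) e := by
  refine List.forall_mem_map.2 fun r _ i rest h => ?_
  rw [encRule] at h
  simp only [List.append_assoc] at h
  obtain ⟨j, _, _, _, h₁, h⟩ := exists_derivable_num (ext := ext) h
  obtain ⟨k, _, _, _, h₂, h⟩ := exists_derivable_num (ext := ext) h
  obtain ⟨l, _, _, h₃, h⟩ := findsEnd_automaton (ext := ext) _ _ _ h
  exact ⟨l, ‹_›, ‹_›, derive_common .ruleEnd [i, r.label, j, r.target, k, l] (by simp; omega)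
    ⟨h₁, h₂, h₃, trivial⟩, h⟩

end Parsing

namespace Problem

variable {K U D : Type} {Q : Problem K U D} {κ : Type} {ext : κ → Datalog.Rule Pred Var}

theorem AutomatonAt.le {i : ℕ} {N : WordAutomaton Q.automaton.states} (h : Q.AutomatonAt i N) :
    i ≤ Q.word.length ∧ N.size ≤ Q.word.length := by
  obtain ⟨rest, h⟩ := h
  rw [encWordAutomaton_eq, List.append_assoc] at h
  exact le_length_of_drop h

variable (ext) in
theorem AutomatonAt.exists_derivable_size {i : ℕ} {N : WordAutomaton Q.automaton.states}
    (h : Q.AutomatonAt i N) : ∃ j ≤ Q.word.length,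
      Derivable (allRules ext) Q.word .num [i, N.size, j] ∧
      ∃ rest, Q.word.drop j = encList id (N.start.map encFin) ++
        (encList id (N.accept.map encFin) ++ (encList id (N.trans.map encTriple) ++ rest)) := by
  obtain ⟨rest, h⟩ := h
  rw [encWordAutomaton_eq] at h
  simp only [List.append_assoc] at h
  obtain ⟨j, _, _, _, h₁, h⟩ := exists_derivable_num (ext := ext) h
  exact ⟨j, ‹_›, h₁, _, h⟩

theorem derivable_isStart {i s : ℕ} {N : WordAutomaton Q.automaton.states}
    (h : Q.AutomatonAt i N) (hs : N.IsStart s) :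
    Derivable (allRules ext) Q.word .isStart [i, s] := by
  obtain ⟨x, hx, rfl⟩ := hs
  obtain ⟨j, _, h₁, rest, hj⟩ := h.exists_derivable_size ext
  obtain ⟨k, _, h₂, r, hk⟩ := exists_derivable_entry (ext := ext) findsEnd_map_encFin hj
    (List.mem_map_of_mem hx)
  obtain ⟨l, _, _, _, h₃, -⟩ := exists_derivable_num (ext := ext) hk
  have := h.le
  exact derive_common .isStart [i, x, N.size, j, k, l] (by simp; omega) ⟨h₁, h₂, h₃, trivial⟩

theorem derivable_isAccept {i s : ℕ} {N : WordAutomaton Q.automaton.states}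
    (h : Q.AutomatonAt i N) (hs : N.IsAccept s) :
    Derivable (allRules ext) Q.word .isAccept [i, s] := by
  obtain ⟨x, hx, rfl⟩ := hs
  obtain ⟨j, _, h₁, rest, hj⟩ := h.exists_derivable_size ext
  obtain ⟨k, _, _, h₂, hk⟩ := findsEnd_list findsEnd_map_encFin _ _ hj
  obtain ⟨l, _, h₃, r, hl⟩ := exists_derivable_entry (ext := ext) findsEnd_map_encFin hk
    (List.mem_map_of_mem hx)
  obtain ⟨m, _, _, _, h₄, -⟩ := exists_derivable_num (ext := ext) hl
  have := h.le
  exact derive_common .isAccept [i, x, N.size, j, k, l, m] (by simp; omega)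
    ⟨h₁, h₂, h₃, h₄, trivial⟩

theorem derivable_isStep {i s q t : ℕ} {N : WordAutomaton Q.automaton.states}
    (h : Q.AutomatonAt i N) (hs : N.IsStep s q t) :
    Derivable (allRules ext) Q.word .isStep [i, s, q, t] := by
  obtain ⟨x, hx, rfl, rfl, rfl⟩ := hs
  obtain ⟨j, _, h₁, rest, hj⟩ := h.exists_derivable_size ext
  obtain ⟨k, _, _, h₂, hk⟩ := findsEnd_list findsEnd_map_encFin _ _ hj
  obtain ⟨l, _, _, h₃, hl⟩ := findsEnd_list findsEnd_map_encFin _ _ hk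
  obtain ⟨m, _, h₄, r, hm⟩ := exists_derivable_entry (ext := ext) findsEnd_map_encTriple hl
    (List.mem_map_of_mem hx)
  rw [encTriple] at hm
  simp only [List.append_assoc] at hm
  obtain ⟨m₁, _, _, _, h₅, hm⟩ := exists_derivable_num (ext := ext) hm
  obtain ⟨m₂, _, _, _, h₆, hm⟩ := exists_derivable_num (ext := ext) hm
  obtain ⟨m₃, _, _, _, h₇, hm⟩ := exists_derivable_num (ext := ext) hm
  have := h.le
  exact derive_common .isStep [i, x.1, x.2.1, x.2.2, N.size, j, k, l, m, m₁, m₂, m₃]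
    (by simp; omega) ⟨h₁, h₂, h₃, h₄, h₅, h₆, h₇, trivial⟩

variable (Q ext) in
theorem exists_derivable_rules : ∃ i j, i ≤ Q.word.length ∧ j ≤ Q.word.length ∧
    Q.σ ≤ Q.word.length ∧ Q.automaton.states ≤ Q.word.length ∧
    Derivable (allRules ext) Q.word .num [0, Q.σ, i] ∧
    Derivable (allRules ext) Q.word .num [i, Q.automaton.states, j] ∧
    Q.word.drop j = encList id (Q.automaton.rules.map encRule) ++
      (encWordAutomaton Q.automaton.final ++ encSLP Q.encK Q.encU Q.program) := by
  have h : Q.word.drop 0 = _ := word_eq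
  obtain ⟨i, _, _, _, h₁, h⟩ := exists_derivable_num (ext := ext) h
  obtain ⟨j, _, _, _, h₂, h⟩ := exists_derivable_num (ext := ext) h
  exact ⟨i, j, ‹_›, ‹_›, ‹_›, ‹_›, h₁, h₂, h⟩

variable (ext) in
theorem exists_derivable_rule {r : Rule Q.σ Q.automaton.states} (hr : r ∈ Q.automaton.rules) :
    ∃ i, Q.AutomatonAt i r.horizontal ∧ (r.label : ℕ) ≤ Q.word.length ∧
      (r.target : ℕ) ≤ Q.word.length ∧
      Derivable (allRules ext) Q.word .rule [r.label, r.target, i] := by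
  obtain ⟨i, j, _, _, _, _, h₁, h₂, h⟩ := Q.exists_derivable_rules ext
  obtain ⟨k, _, h₃, rest, hk⟩ := exists_derivable_entry (ext := ext) findsEnd_map_encRule h
    (List.mem_map_of_mem hr)
  rw [encRule] at hk
  simp only [List.append_assoc] at hk
  obtain ⟨l, _, _, _, h₄, h⟩ := exists_derivable_num (ext := ext) hk
  obtain ⟨N, _, _, _, h₅, h⟩ := exists_derivable_num (ext := ext) h
  exact ⟨N, ⟨_, h⟩, ‹_›, ‹_›, derive_common .rule
    [r.label, r.target, N, Q.σ, i, Q.automaton.states, j, k, l] (by simp; omega)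
    ⟨h₁, h₂, h₃, h₄, h₅, trivial⟩⟩

variable (ext) in
theorem exists_derivable_treeStep {i : ℕ} {N : WordAutomaton Q.automaton.states}
    (h : Q.AutomatonAt i N) {a : Fin Q.σ} {φ : WordAutomaton Q.automaton.states → ℕ → ℕ → Prop}
    {s t : ℕ} (hst : Q.automaton.TreeStep a φ N s t) :
    ∃ j N' x y, Q.AutomatonAt j N' ∧ (a : ℕ) ≤ Q.word.length ∧ s ≤ Q.word.length ∧
      t ≤ Q.word.length ∧ x ≤ Q.word.length ∧ y ≤ Q.word.length ∧
      Derivable (allRules ext) Q.word .treeStep [i, a, s, t, j, x, y] ∧ φ N' x y := by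
  have hlt := hst.lt
  obtain ⟨r, hr, rfl, hs, x, y, hx, hy, hφ⟩ := hst
  obtain ⟨j, hj, _, _, h₁⟩ := exists_derivable_rule ext hr
  have := h.le
  have := hj.le
  have : x ≤ Q.word.length := by obtain ⟨x, -, rfl⟩ := hx; omega
  have : y ≤ Q.word.length := by obtain ⟨y, -, rfl⟩ := hy; omega
  exact ⟨j, _, x, y, hj, ‹_›, by omega, by omega, ‹_›, ‹_›, derive_common .treeStep
    [i, r.label, s, t, j, x, y, r.target] (by simp; omega)
    ⟨h₁, derivable_isStart hj hx, derivable_isAccept hj hy, derivable_isStep h hs, trivial⟩, hφ⟩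

variable (Q ext) in
theorem exists_derivable_final : ∃ i ≤ Q.word.length,
    Derivable (allRules ext) Q.word .final [i] ∧ Q.word.drop i =
      encWordAutomaton Q.automaton.final ++ encSLP Q.encK Q.encU Q.program := by
  obtain ⟨i, j, _, _, _, _, h₁, h₂, h⟩ := Q.exists_derivable_rules ext
  obtain ⟨k, _, _, h₃, h⟩ := findsEnd_list (ext := ext) findsEnd_map_encRule _ _ h
  exact ⟨k, ‹_›, derive_common .final [k, Q.σ, i, Q.automaton.states, j] (by simp; omega)
    ⟨h₁, h₂, h₃, trivial⟩, h⟩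

variable (Q ext) in
theorem exists_derivable_slp : ∃ i j k, i ≤ Q.word.length ∧ j ≤ Q.word.length ∧
    k ≤ Q.word.length ∧ Q.program.size ≤ Q.word.length ∧
    Derivable (allRules ext) Q.word .slp [i] ∧
    Derivable (allRules ext) Q.word .num [i, Q.program.size, j] ∧
    Derivable (allRules ext) Q.word .num [j, Q.program.start, k] ∧
    Q.word.drop k = encList (encRhs Q.encK Q.encU) (List.ofFn Q.program.rhs) := by
  obtain ⟨N, _, h₁, h⟩ := Q.exists_derivable_final ext
  obtain ⟨i, _, _, h₂, h⟩ := findsEnd_automaton (ext := ext) _ _ _ h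
  rw [encSLP, List.append_assoc] at h
  obtain ⟨j, _, _, _, h₃, h⟩ := exists_derivable_num (ext := ext) h
  obtain ⟨k, _, _, _, h₄, h⟩ := exists_derivable_num (ext := ext) h
  exact ⟨i, j, k, ‹_›, ‹_›, ‹_›, ‹_›,
    derive_common .slp [N, i] (by simp; omega) ⟨h₁, h₂, trivial⟩, h₃, h₄, h⟩

theorem le_length_of_fin (x : Fin Q.program.size) : (x : ℕ) ≤ Q.word.length := by
  obtain ⟨_, _, _, _, _, _, h, -⟩ := Q.exists_derivable_slp fslpRule
  omega

theorem derivable_startVar : Derivable (allRules ext) Q.word .startVar [Q.program.start] := by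
  obtain ⟨i, j, k, _, _, _, _, h₁, h₂, h₃, -⟩ := Q.exists_derivable_slp ext
  exact derive_common .startVar [Q.program.start, i, Q.program.size, j, k] (by simp; omega)
    ⟨h₁, h₂, h₃, trivial⟩

theorem findsEnd_rhs
    (hK : ∀ k, FindsEnd ext Q.word (.codeEnd .rhs) (encNat 0 ++ Q.encK k))
    (hU : ∀ u v, FindsEnd ext Q.word (.codeEnd .rhs) (encNat 1 ++ Q.encU u ++ encNat v)) {n : ℕ}
    (r : Rhs K U BinOp (Fin n)) :
    FindsEnd ext Q.word (.codeEnd .rhs) (encRhs Q.encK Q.encU r) := by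
  cases r with
  | const k => exact hK k
  | un u x => exact hU u x
  | bin b x y =>
    intro i rest h
    obtain ⟨b', hb'⟩ : ∃ b', encBinOp b = [b'] := by cases b <;> exact ⟨_, rfl⟩
    rw [encRhs, hb'] at h
    simp only [List.append_assoc] at h
    obtain ⟨j, _, _, h₁, h⟩ := findsEnd_two (ext := ext) _ _ h
    obtain ⟨k, _, _, _, h₂, h⟩ := exists_derivable_num (ext := ext) (getElem?_of_drop h).2
    obtain ⟨l, _, _, _, h₃, h⟩ := exists_derivable_num (ext := ext) h
    exact ⟨l, ‹_›, ‹_›, derive_common .binEnd [i, j, x, k, y, l] (by simp; omega)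
      ⟨h₁, h₂, h₃, trivial⟩, h⟩

theorem exists_derivable_rhsList
    (hr : ∀ x, FindsEnd ext Q.word (.codeEnd .rhs) (encRhs Q.encK Q.encU (Q.program.rhs x)))
    {A : ℕ} (hA : A ≤ Q.program.size) : ∃ i ≤ Q.word.length,
      Derivable (allRules ext) Q.word .rhsList [A, i] ∧
      Q.word.drop i = encList (encRhs Q.encK Q.encU) ((List.ofFn Q.program.rhs).drop A) := by
  obtain ⟨i, j, k, _, _, _, _, h₁, h₂, h₃, h⟩ := Q.exists_derivable_slp ext
  induction A with
  | zero => exact ⟨k, ‹_›, derive_common .rhsListZero [Q.program.start, i, Q.program.size, j, k]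
      (by simp; omega) ⟨h₁, h₂, h₃, trivial⟩, h⟩
  | succ A ih =>
    obtain ⟨l, _, h₄, h⟩ := ih (by omega)
    have hl := List.drop_eq_getElem_cons (l := List.ofFn Q.program.rhs) (i := A) (by simpa using hA)
    rw [hl, encList_cons] at h
    obtain ⟨hb, h⟩ := getElem?_of_drop h
    rw [List.getElem_ofFn] at h
    obtain ⟨m, _, _, h₅, h⟩ := hr _ _ _ h
    exact ⟨m, ‹_›, derive_common .rhsListSucc [A, l, m] (by simp; omega) ⟨h₄, hb, h₅, trivial⟩, h⟩

theorem exists_derivable_rhs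
    (hr : ∀ x, FindsEnd ext Q.word (.codeEnd .rhs) (encRhs Q.encK Q.encU (Q.program.rhs x)))
    (x : Fin Q.program.size) : ∃ i ≤ Q.word.length,
      Derivable (allRules ext) Q.word .rhs [x, i] ∧
      ∃ rest, Q.word.drop i = encRhs Q.encK Q.encU (Q.program.rhs x) ++ rest := by
  obtain ⟨i, _, h₁, h⟩ := exists_derivable_rhsList hr x.2.le
  have hl := List.drop_eq_getElem_cons (l := List.ofFn Q.program.rhs) (i := x) (by simp)
  rw [hl, encList_cons] at h
  have hi := lt_length_of_drop h
  obtain ⟨hb, h⟩ := getElem?_of_drop h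
  rw [List.getElem_ofFn] at h
  have := le_length_of_fin x
  exact ⟨i + 1, hi, derive_common .rhs [x, i] (by simp; omega) ⟨h₁, hb, trivial⟩, _, h⟩

theorem derivable_hor
    (hr : ∀ x, FindsEnd ext Q.word (.codeEnd .rhs) (encRhs Q.encK Q.encU (Q.program.rhs x)))
    {x y z : Fin Q.program.size} (hx : Q.program.rhs x = .bin .hor y z) :
    Derivable (allRules ext) Q.word .hor [x, y, z] := by
  obtain ⟨i, _, h₁, rest, h⟩ := exists_derivable_rhs hr x
  rw [hx, encRhs, encBinOp] at h
  simp only [List.append_assoc] at h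
  obtain ⟨j, _, _, h₂, h⟩ := findsEnd_two (ext := ext) _ _ h
  obtain ⟨hb, h⟩ := getElem?_of_drop h
  obtain ⟨k, _, _, _, h₃, h⟩ := exists_derivable_num (ext := ext) h
  obtain ⟨l, _, _, _, h₄, h⟩ := exists_derivable_num (ext := ext) h
  have := le_length_of_fin x
  exact derive_common .hor [x, y, z, i, j, k, l] (by simp; omega) ⟨h₁, h₂, hb, h₃, h₄, trivial⟩

theorem derivable_ver
    (hr : ∀ x, FindsEnd ext Q.word (.codeEnd .rhs) (encRhs Q.encK Q.encU (Q.program.rhs x)))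
    {x y z : Fin Q.program.size} (hx : Q.program.rhs x = .bin .ver y z) :
    Derivable (allRules ext) Q.word .ver [x, y, z] := by
  obtain ⟨i, _, h₁, rest, h⟩ := exists_derivable_rhs hr x
  rw [hx, encRhs, encBinOp] at h
  simp only [List.append_assoc] at h
  obtain ⟨j, _, _, h₂, h⟩ := findsEnd_two (ext := ext) _ _ h
  obtain ⟨hb, h⟩ := getElem?_of_drop h
  obtain ⟨k, _, _, _, h₃, h⟩ := exists_derivable_num (ext := ext) h
  obtain ⟨l, _, _, _, h₄, h⟩ := exists_derivable_num (ext := ext) h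
  have := le_length_of_fin x
  exact derive_common .ver [x, y, z, i, j, k, l] (by simp; omega) ⟨h₁, h₂, hb, h₃, h₄, trivial⟩

/-- All true facts about the forest or context `v`, as the content or full value of the variable
`A`, are derivable; the predicates for these facts are `pf` and `pc`.

For contexts, the position `j` that represents the automaton at the parameter is not arbitrary: it
is the given position `i` or the one at which the automaton occurs in a rule. Therefore it is
quantified existentially. -/
def Complete (ext : κ → Datalog.Rule Pred Var) (pf pc : Pred) (A : ℕ) :
    Forest (Fin Q.σ) ⊕ Ctx (Fin Q.σ) → Prop
  | .inl f => ∀ i N s t, Q.AutomatonAt i N → s ≤ Q.word.length → t ≤ Q.word.length →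
    Q.automaton.Reads f N s t → Derivable (allRules ext) Q.word pf [A, i, s, t]
  | .inr c => ∀ i N s t N' x y, Q.AutomatonAt i N → s ≤ Q.word.length → t ≤ Q.word.length →
    Q.automaton.CtxReads c N s t N' x y →
    ∃ j, Q.AutomatonAt j N' ∧ Derivable (allRules ext) Q.word pc [A, i, s, t, j, x, y]

theorem ctxReads_le {i s t p q : ℕ} {N N' : WordAutomaton Q.automaton.states}
    {c : Ctx (Fin Q.σ)} (h : Q.AutomatonAt i N) (hs : s ≤ Q.word.length) (ht : t ≤ Q.word.length)
    (hc : Q.automaton.CtxReads c N s t N' p q) : p ≤ Q.word.length ∧ q ≤ Q.word.length :=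
  (hc.invariant (fun N => ∃ i, Q.AutomatonAt i N) (fun _ ⟨_, h⟩ => h.le.2)
    (fun _ hr => (exists_derivable_rule fslpRule hr).imp fun _ h => h.1) ⟨i, h⟩ hs ht).2

theorem complete_hor
    (hr : ∀ x, FindsEnd ext Q.word (.codeEnd .rhs) (encRhs Q.encK Q.encU (Q.program.rhs x)))
    {x y z : Fin Q.program.size} (hx : Q.program.rhs x = .bin .hor y z)
    {u v d : Forest (Fin Q.σ) ⊕ Ctx (Fin Q.σ)} (hu : Complete (Q := Q) ext .forest .ctx y u)
    (hv : Complete (Q := Q) ext .forest .ctx z v)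
    (hd : (forestAlgebra (Fin Q.σ)).bin .hor u v = some d) :
    Complete (Q := Q) ext .forest .ctx x d := by
  have h₁ := derivable_hor hr hx
  have := le_length_of_fin x
  have := le_length_of_fin y
  have := le_length_of_fin z
  obtain f | c := u <;> obtain g | c' := v <;> cases hd
  · intro i N s t hN hs ht h
    obtain ⟨m, hf, hg⟩ := ForestAutomaton.reads_append.1 h
    have := hf.eq_or_lt
    have := hN.le
    have hm : m ≤ Q.word.length := by omega
    exact derive_common .horForestForest [x, y, z, i, s, t, m] (by simp; omega)
      ⟨h₁, hu i N s m hN hs hm hf, hv i N m t hN hm ht hg, trivial⟩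
  · intro i N s t N' p q hN hs ht h
    have := ctxReads_le hN hs ht h
    obtain ⟨m, hf, hg⟩ := ForestAutomaton.ctxReads_appendLeft.1 h
    have := hf.eq_or_lt
    have := hN.le
    have hm : m ≤ Q.word.length := by omega
    obtain ⟨j, hj, h₂⟩ := hv i N m t N' p q hN hm ht hg
    have := hj.le
    exact ⟨j, hj, derive_common .horForestCtx [x, y, z, i, s, t, m, j, p, q] (by simp; omega)
      ⟨h₁, hu i N s m hN hs hm hf, h₂, trivial⟩⟩
  · intro i N s t N' p q hN hs ht h
    have := ctxReads_le hN hs ht h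
    obtain ⟨m, hg, hf⟩ := ForestAutomaton.ctxReads_appendRight.1 h
    have := hf.eq_or_lt
    have := hN.le
    have hm : m ≤ Q.word.length := by omega
    obtain ⟨j, hj, h₂⟩ := hu i N s m N' p q hN hs hm hg
    have := hj.le
    exact ⟨j, hj, derive_common .horCtxForest [x, y, z, i, s, t, m, j, p, q] (by simp; omega)
      ⟨h₁, h₂, hv i N m t hN hm ht hf, trivial⟩⟩

theorem complete_ver
    (hr : ∀ x, FindsEnd ext Q.word (.codeEnd .rhs) (encRhs Q.encK Q.encU (Q.program.rhs x)))
    {x y z : Fin Q.program.size} (hx : Q.program.rhs x = .bin .ver y z)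
    {u v d : Forest (Fin Q.σ) ⊕ Ctx (Fin Q.σ)} (hu : Complete (Q := Q) ext .forest .ctx y u)
    (hv : Complete (Q := Q) ext .fullForest .fullCtx z v)
    (hd : (forestAlgebra (Fin Q.σ)).bin .ver u v = some d) :
    Complete (Q := Q) ext .forest .ctx x d := by
  have h₁ := derivable_ver hr hx
  have := le_length_of_fin x
  have := le_length_of_fin y
  have := le_length_of_fin z
  obtain f | c := u <;> obtain g | c' := v <;> cases hd
  · intro i N s t hN hs ht h
    obtain ⟨N', p, q, hc, hf⟩ := ForestAutomaton.reads_plug.1 h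
    obtain ⟨hp, hq⟩ := ctxReads_le hN hs ht hc
    obtain ⟨j, hj, h₂⟩ := hu i N s t N' p q hN hs ht hc
    have := hN.le
    have := hj.le
    exact derive_common .verForest [x, y, z, i, s, t, j, p, q] (by simp; omega)
      ⟨h₁, h₂, hv j N' p q hj hp hq hf, trivial⟩
  · intro i N s t O p' q' hN hs ht h
    obtain ⟨N', p, q, hc, hf⟩ := ForestAutomaton.ctxReads_comp.1 h
    obtain ⟨hp, hq⟩ := ctxReads_le hN hs ht hc
    obtain ⟨j, hj, h₂⟩ := hu i N s t N' p q hN hs ht hc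
    obtain ⟨hp', hq'⟩ := ctxReads_le hj hp hq hf
    obtain ⟨k, hk, h₃⟩ := hv j N' p q O p' q' hj hp hq hf
    have := hN.le
    have := hj.le
    have := hk.le
    exact ⟨k, hk, derive_common .verCtx [x, y, z, i, s, t, j, p, q, k, p', q'] (by simp; omega)
      ⟨h₁, h₂, h₃, trivial⟩⟩

theorem derivable_accept {f : Forest (Fin Q.σ)}
    (h : Complete (Q := Q) ext .fullForest .fullCtx Q.program.start (.inl f))
    (hf : Q.automaton.Accepts f) : Derivable (allRules ext) Q.word .accept [] := by
  obtain ⟨x, y, hx, hy, hf⟩ := ForestAutomaton.accepts_iff_reads.1 hf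
  obtain ⟨i, _, h₁, hi⟩ := Q.exists_derivable_final ext
  have hN : Q.AutomatonAt i Q.automaton.final := ⟨_, hi⟩
  have := hN.le
  have hx' : x ≤ Q.word.length := by obtain ⟨x, -, rfl⟩ := hx; omega
  have hy' : y ≤ Q.word.length := by obtain ⟨y, -, rfl⟩ := hy; omega
  have := le_length_of_fin Q.program.start
  exact derive_common .accept [Q.program.start, i, x, y] (by simp; omega)
    ⟨derivable_startVar, h₁, derivable_isStart hN hx, derivable_isAccept hN hy,
      h i _ x y hN hx' hy' hf, trivial⟩

end Problem

end Completeness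

/-! ### Forest straight-line programs -/

section FSLP

/-- The problem given by an automaton and an FSLP; contents and full values are the values in the
forest algebra. -/
def FSLPInput.problem (x : FSLPInput) :
    Problem FAConst (Fin x.σ) (Forest (Fin x.σ) ⊕ Ctx (Fin x.σ)) where
  σ := x.σ
  automaton := x.automaton
  program := x.program.toSLP
  encK := encFAConst
  encU := encFin
  alg := forestAlgebra (Fin x.σ)
  content := id
  full := id
  hor h := h
  ver h := h

namespace FSLPInput

variable (x : FSLPInput)

/-- The meaning of the predicate for unary operations. -/
def sem : Pred → List ℕ → Prop
  | .un, [A, a, B] => ∀ y : Fin x.program.size, (y : ℕ) = A →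
    ∃ (u : Fin x.σ) (z : Fin x.program.size), (u : ℕ) = a ∧ (z : ℕ) = B ∧
      x.program.rhs y = .un u z
  | _, _ => True

theorem isModel_fslpRule : IsModel fslpRule x.problem.word (x.problem.Sem x.sem) := by
  intro i e he hb
  cases i <;> dsimp only [fslpRule, mkRule, RuleScheme.inst, HoldsAll, Lit.Holds, List.map,
    Term.eval, Problem.Sem, sem] at hb ⊢
  case constEnd =>
    obtain ⟨h₁, -⟩ := hb
    rintro _ rest ⟨n, r, rfl⟩ h
    obtain ⟨k, -, h⟩ := Problem.const_of_encRhs h h₁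
    cases k <;> exact (getElem?_of_drop h).2
  case unEnd =>
    obtain ⟨h₁, h₂, h₃, -⟩ := hb
    rintro _ rest ⟨n, r, rfl⟩ h
    obtain ⟨u, z, -, h⟩ := Problem.un_of_encRhs h h₁
    rw [h₂, h₃] at h
    exact (encNat_append_inj (encNat_append_inj h).2).2
  case eps =>
    obtain ⟨h₁, h₂, h₃, -⟩ := hb
    intro y N d hy hN hd
    obtain ⟨rest, h⟩ := h₁ y hy
    obtain ⟨k, hk, h⟩ := Problem.const_of_encRhs h h₂
    rw [hd.const_inv hk]
    cases k with
    | eps => exact ⟨.nil, rfl, rfl⟩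
    | param => cases h₃.symm.trans (getElem?_of_drop h).1
  case param =>
    obtain ⟨h₁, h₂, h₃, -⟩ := hb
    intro y N d hy hN hd
    obtain ⟨rest, h⟩ := h₁ y hy
    obtain ⟨k, hk, h⟩ := Problem.const_of_encRhs h h₂
    rw [hd.const_inv hk]
    cases k with
    | eps => cases h₃.symm.trans (getElem?_of_drop h).1
    | param => exact ⟨.hole .nil, N, rfl, hN, rfl, rfl, rfl⟩
  case un =>
    obtain ⟨h₁, h₂, h₃, h₄, -⟩ := hb
    intro y hy
    obtain ⟨rest, h⟩ := h₁ y hy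
    obtain ⟨u, z, hr, h⟩ := Problem.un_of_encRhs h h₂
    rw [h₃, h₄] at h
    obtain ⟨e₁, h⟩ := encNat_append_inj h
    exact ⟨u, z, e₁.symm, (encNat_append_inj h).1.symm, hr⟩
  case unForest =>
    obtain ⟨h₁, h₂, h₃, -⟩ := hb
    intro y N d hy hN hd
    obtain ⟨u, z, hu, hz, hr⟩ := h₁ y hy
    obtain ⟨v, hv, rfl⟩ := hd.un_inv hr
    obtain ⟨r, hrM, hru, hst, hj, hx, hy⟩ := h₂ N hN
    obtain ⟨f, rfl, hf⟩ := h₃ z _ v hz hj hv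
    exact ⟨_, rfl, ForestAutomaton.reads_tree.2
      ⟨r, hrM, Fin.ext (hru.trans hu.symm), hst, _, _, hx, hy, hf⟩⟩
  case unCtx =>
    obtain ⟨h₁, h₂, h₃, -⟩ := hb
    intro y N d hy hN hd
    obtain ⟨u, z, hu, hz, hr⟩ := h₁ y hy
    obtain ⟨v, hv, rfl⟩ := hd.un_inv hr
    obtain ⟨r, hrM, hru, hst, hj, hx, hy⟩ := h₂ N hN
    obtain ⟨c, O, rfl, hO, hc⟩ := h₃ z _ v hz hj hv
    exact ⟨_, O, rfl, hO, ForestAutomaton.ctxReads_tree.2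
      ⟨r, hrM, Fin.ext (hru.trans hu.symm), hst, _, _, hx, hy, hc⟩⟩
  case fullForest => exact hb.1
  case fullCtx => exact hb.1

theorem findsEnd_rhs {n : ℕ} (r : Rhs FAConst (Fin x.σ) BinOp (Fin n)) :
    FindsEnd fslpRule x.problem.word (.codeEnd .rhs) (encRhs encFAConst encFin r) := by
  refine Problem.findsEnd_rhs (Q := x.problem) (fun k i rest h => ?_) (fun u v i rest h => ?_) r
  · obtain ⟨b, hb⟩ : ∃ b, x.problem.encK k = [b] := by cases k <;> exact ⟨_, rfl⟩
    rw [List.append_assoc, hb] at h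
    obtain ⟨j, _, _, _, h₁, h⟩ := exists_derivable_num (ext := fslpRule) h
    have hj := lt_length_of_drop h
    exact ⟨j + 1, ‹_›, hj, derive_fslp .constEnd [i, j] (by simp; omega) ⟨h₁, trivial⟩,
      (getElem?_of_drop h).2⟩
  · simp only [List.append_assoc] at h
    obtain ⟨j, _, _, h₁, h⟩ := findsEnd_one (ext := fslpRule) _ _ h
    obtain ⟨k, _, _, _, h₂, h⟩ := exists_derivable_num (ext := fslpRule) h
    obtain ⟨l, _, _, _, h₃, h⟩ := exists_derivable_num (ext := fslpRule) h
    exact ⟨l, ‹_›, ‹_›, derive_fslp .unEnd [i, j, u, k, v, l] (by simp; omega)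
      ⟨h₁, h₂, h₃, trivial⟩, h⟩

variable {x}

theorem derivable_un {y z : Fin x.program.size} {u : Fin x.σ} (hy : x.program.rhs y = .un u z) :
    (u : ℕ) ≤ x.problem.word.length ∧
      Derivable (allRules fslpRule) x.problem.word .un [y, u, z] := by
  obtain ⟨i, _, h₁, rest, h⟩ := Problem.exists_derivable_rhs (Q := x.problem)
    (fun _ => findsEnd_rhs x _) y
  change _ = encRhs encFAConst encFin (x.program.rhs y) ++ _ at h
  rw [hy, encRhs] at h
  simp only [List.append_assoc] at h
  obtain ⟨j, _, _, h₂, h⟩ := findsEnd_one (ext := fslpRule) _ _ h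
  obtain ⟨k, _, _, _, h₃, h⟩ := exists_derivable_num (ext := fslpRule) h
  obtain ⟨l, _, _, _, h₄, h⟩ := exists_derivable_num (ext := fslpRule) h
  have := Problem.le_length_of_fin (Q := x.problem) y
  exact ⟨‹_›, derive_fslp .un [y, u, z, i, j, k, l] (by simp; omega) ⟨h₁, h₂, h₃, h₄, trivial⟩⟩

theorem complete_full {A : ℕ} {v : Forest (Fin x.σ) ⊕ Ctx (Fin x.σ)}
    (hA : A ≤ x.problem.word.length)
    (h : Problem.Complete (Q := x.problem) fslpRule .forest .ctx A v) :
    Problem.Complete (Q := x.problem) fslpRule .fullForest .fullCtx A v := by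
  cases v with
  | inl f =>
    intro i N s t hN hs ht hf
    have := hN.le
    exact derive_fslp .fullForest [A, i, s, t] (by simp; omega) ⟨h i N s t hN hs ht hf, trivial⟩
  | inr c =>
    intro i N s t N' p q hN hs ht hc
    have := Problem.ctxReads_le hN hs ht hc
    obtain ⟨j, hj, h₁⟩ := h i N s t N' p q hN hs ht hc
    have := hN.le
    have := hj.le
    exact ⟨j, hj, derive_fslp .fullCtx [A, i, s, t, j, p, q] (by simp; omega) ⟨h₁, trivial⟩⟩

theorem complete {y : Fin x.program.size} {v : Forest (Fin x.σ) ⊕ Ctx (Fin x.σ)}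
    (h : x.program.HasValue (forestAlgebra (Fin x.σ)) y v) :
    Problem.Complete (Q := x.problem) fslpRule .forest .ctx y v := by
  have hr (y) := findsEnd_rhs x (x.program.rhs y)
  have hle (y) := Problem.le_length_of_fin (Q := x.problem) y
  induction h with
  | @const y k hy =>
    have := hle y
    obtain ⟨i, _, h₁, rest, h⟩ := Problem.exists_derivable_rhs (Q := x.problem) hr y
    change _ = encRhs encFAConst encFin (x.program.rhs y) ++ _ at h
    rw [hy, encRhs, List.append_assoc] at h
    obtain ⟨j, _, _, _, h₂, h⟩ := exists_derivable_num (ext := fslpRule) h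
    cases k with
    | eps =>
      rintro N _ s _ hN hs - rfl
      have := hN.le
      exact derive_fslp .eps [y, N, s, i, j] (by simp; omega)
        ⟨h₁, h₂, (getElem?_of_drop h).1, trivial⟩
    | param =>
      rintro N _ s t _ _ _ hN hs ht ⟨rfl, rfl, rfl⟩
      have := hN.le
      exact ⟨N, hN, derive_fslp .param [y, N, _, _, i, j] (by simp; omega)
        ⟨h₁, h₂, (getElem?_of_drop h).1, trivial⟩⟩
  | @un y z u v hy _ ih =>
    have := hle y
    have := hle z
    obtain ⟨hu, h₁⟩ := derivable_un hy
    cases v with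
    | inl f =>
      intro i N s t hN hs ht hf
      obtain ⟨j, N', p, q, hj, _, _, _, hp, hq, h₂, hf⟩ :=
        Problem.exists_derivable_treeStep fslpRule hN (ForestAutomaton.reads_tree.1 hf)
      have := hN.le
      have := hj.le
      exact derive_fslp .unForest [y, u, z, i, s, t, j, p, q] (by simp; omega)
        ⟨h₁, h₂, ih j N' p q hj hp hq hf, trivial⟩
    | inr c =>
      intro i N s t O p' q' hN hs ht hc
      obtain ⟨j, N', p, q, hj, _, _, _, hp, hq, h₂, hc⟩ :=
        Problem.exists_derivable_treeStep fslpRule hN (ForestAutomaton.ctxReads_tree.1 hc)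
      have := Problem.ctxReads_le hj hp hq hc
      obtain ⟨k, hk, h₃⟩ := ih j N' p q O p' q' hj hp hq hc
      have := hN.le
      have := hj.le
      have := hk.le
      exact ⟨k, hk, derive_fslp .unCtx [y, u, z, i, s, t, j, p, q, k, p', q'] (by simp; omega)
        ⟨h₁, h₂, h₃, trivial⟩⟩
  | @bin y z z' b u v d hy _ _ hd ih₁ ih₂ =>
    cases b with
    | hor => exact Problem.complete_hor (Q := x.problem) hr hy ih₁ ih₂ hd
    | ver => exact Problem.complete_ver (Q := x.problem) hr hy ih₁ (complete_full (hle z') ih₂) hd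

theorem answer_iff_derivable (x : FSLPInput) :
    x.answer = true ↔ Derivable (allRules fslpRule) x.encode .accept [] := by
  have hv := x.program.ground.choose_spec
  simp only [answer, decide_eq_true_eq]
  constructor
  · exact Problem.derivable_accept (Q := x.problem)
      (complete_full (Problem.le_length_of_fin (Q := x.problem) _) (complete hv))
  · intro h
    exact h _ (Problem.isModel_allRules (isModel_fslpRule x)) _ _ hv rfl

end FSLPInput

end FSLP

/-! ### Top dags -/

section TopDag

namespace Cluster

variable {α : Type}

/-- The label of the root. -/
def root : Cluster α → α
  | .rank0 a _ _ => a
  | .rank1 a _ _ => a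

/-- What is below the root, where the bottom boundary node is replaced by the parameter. -/
def content : Cluster α → Forest α ⊕ Ctx α
  | .rank0 _ f _ => .inl f
  | .rank1 _ c _ => .inr c

/-- The cluster as a tree, where the bottom boundary node is replaced by the parameter. -/
def full : Cluster α → Forest α ⊕ Ctx α
  | .rank0 a f _ => .inl (.cons a f .nil)
  | .rank1 a c _ => .inr (.down a c .nil)

variable [DecidableEq α]

theorem hmerge_eq_some {u v d : Cluster α} (h : u.hmerge v = some d) :
    u.root = d.root ∧ (forestAlgebra α).bin .hor u.content v.content = some d.content := by
  cases u <;> cases v <;> simp only [hmerge, Option.ite_none_right_eq_some, Option.some.injEq,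
    reduceCtorEq] at h <;> obtain ⟨rfl, rfl⟩ := h <;> exact ⟨rfl, rfl⟩

theorem vmerge_eq_some {u v d : Cluster α} (h : u.vmerge v = some d) :
    u.root = d.root ∧ (forestAlgebra α).bin .ver u.content v.full = some d.content := by
  cases u <;> cases v <;> simp only [vmerge, Option.ite_none_right_eq_some, Option.some.injEq,
    reduceCtorEq] at h <;> obtain ⟨rfl, rfl⟩ := h <;> exact ⟨rfl, rfl⟩

end Cluster

/-- The problem given by an automaton and a top dag. -/
def TopDagInput.problem (x : TopDagInput) :
    Problem (CAConst (Fin x.σ)) Empty (Cluster (Fin x.σ)) where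
  σ := x.σ
  automaton := x.automaton
  program := x.program.toSLP
  encK := encCAConst
  encU e := e.elim
  alg := clusterAlgebra (Fin x.σ)
  content := Cluster.content
  full := Cluster.full
  hor h := (Cluster.hmerge_eq_some h).2
  ver h := (Cluster.vmerge_eq_some h).2

namespace TopDagInput

variable (x : TopDagInput)

/-- The meaning of the predicates for atomic clusters and root labels. -/
def sem : Pred → List ℕ → Prop
  | .atom, [A, a, b] => ∀ y : Fin x.program.size, (y : ℕ) = A →
    ∃ u v : Fin x.σ, (u : ℕ) = a ∧ (v : ℕ) = b ∧ x.program.rhs y = .const (.atom u v)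
  | .atomBot, [A, a, b] => ∀ y : Fin x.program.size, (y : ℕ) = A →
    ∃ u v : Fin x.σ, (u : ℕ) = a ∧ (v : ℕ) = b ∧ x.program.rhs y = .const (.atomBot u v)
  | .label, [A, a] => ∀ (y : Fin x.program.size) (d : Cluster (Fin x.σ)), (y : ℕ) = A →
    x.program.HasValue (clusterAlgebra (Fin x.σ)) y d → (d.root : ℕ) = a
  | _, _ => True

theorem isModel_topDagRule : IsModel topDagRule x.problem.word (x.problem.Sem x.sem) := by
  intro i e he hb
  cases i <;> dsimp only [topDagRule, mkRule, RuleScheme.inst, HoldsAll, Lit.Holds, List.map,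
    Term.eval, Problem.Sem, sem] at hb ⊢
  case constEnd =>
    obtain ⟨h₁, h₂, h₃, -⟩ := hb
    rintro _ rest ⟨n, r, rfl⟩ h
    obtain ⟨k, -, h⟩ := Problem.const_of_encRhs h h₁
    obtain ⟨b, u, v, hk⟩ : ∃ b u v, x.problem.encK k = b :: (encNat u ++ encNat v) := by
      cases k <;> exact ⟨_, _, _, rfl⟩
    rw [hk] at h
    have h := (getElem?_of_drop h).2
    rw [h₂, h₃, List.append_eq, List.append_assoc] at h
    exact (encNat_append_inj (encNat_append_inj h).2).2
  case atom =>
    obtain ⟨h₁, h₂, h₃, h₄, h₅, -⟩ := hb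
    intro y hy
    obtain ⟨rest, h⟩ := h₁ y hy
    obtain ⟨k, hk, h⟩ := Problem.const_of_encRhs h h₂
    cases k with
    | atom u v =>
      have h := (getElem?_of_drop h).2
      rw [h₄, h₅, List.append_eq, List.append_assoc] at h
      obtain ⟨e₁, h⟩ := encNat_append_inj h
      exact ⟨u, v, e₁.symm, (encNat_append_inj h).1.symm, hk⟩
    | atomBot u v => cases h₃.symm.trans (getElem?_of_drop h).1
  case atomBot =>
    obtain ⟨h₁, h₂, h₃, h₄, h₅, -⟩ := hb
    intro y hy
    obtain ⟨rest, h⟩ := h₁ y hy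
    obtain ⟨k, hk, h⟩ := Problem.const_of_encRhs h h₂
    cases k with
    | atom u v => cases h₃.symm.trans (getElem?_of_drop h).1
    | atomBot u v =>
      have h := (getElem?_of_drop h).2
      rw [h₄, h₅, List.append_eq, List.append_assoc] at h
      obtain ⟨e₁, h⟩ := encNat_append_inj h
      exact ⟨u, v, e₁.symm, (encNat_append_inj h).1.symm, hk⟩
  case labelAtom =>
    intro y d hy hd
    obtain ⟨u, v, hu, -, hr⟩ := hb.1 y hy
    rw [hd.const_inv hr]
    exact hu
  case labelAtomBot =>
    intro y d hy hd
    obtain ⟨u, v, hu, -, hr⟩ := hb.1 y hy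
    rw [hd.const_inv hr]
    exact hu
  case labelHor =>
    obtain ⟨h₁, h₂, -⟩ := hb
    intro y d hy hd
    obtain ⟨z, z', hz, -, hr⟩ := h₁ y hy
    obtain ⟨u, v, hu, -, hd⟩ := hd.bin_inv hr
    rw [← (Cluster.hmerge_eq_some hd).1]
    exact h₂ z u hz hu
  case labelVer =>
    obtain ⟨h₁, h₂, -⟩ := hb
    intro y d hy hd
    obtain ⟨z, z', hz, -, hr⟩ := h₁ y hy
    obtain ⟨u, v, hu, -, hd⟩ := hd.bin_inv hr
    rw [← (Cluster.vmerge_eq_some hd).1]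
    exact h₂ z u hz hu
  case atomForest =>
    obtain ⟨h₁, h₂, -⟩ := hb
    intro y N d hy hN hd
    obtain ⟨u, v, -, hv, hr⟩ := h₁ y hy
    rw [hd.const_inv hr]
    obtain ⟨r, hrM, hrv, hst, hj, hx, hy⟩ := h₂ N hN
    exact ⟨_, rfl, ForestAutomaton.reads_tree.2
      ⟨r, hrM, Fin.ext (hrv.trans hv.symm), hst, _, _, hx, hy, rfl⟩⟩
  case atomCtx =>
    intro y N d hy hN hd
    obtain ⟨u, v, -, -, hr⟩ := hb.1 y hy
    rw [hd.const_inv hr]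
    exact ⟨.hole .nil, N, rfl, hN, rfl, rfl, rfl⟩
  case fullForest =>
    obtain ⟨h₁, h₂, h₃, -⟩ := hb
    intro y N d hy hN hd
    have hl := h₁ y d hy hd
    obtain ⟨r, hrM, hr, hst, hj, hx, hy'⟩ := h₂ N hN
    obtain ⟨f, hf, hfN⟩ := h₃ y _ d hy hj hd
    cases d with
    | rank0 a g _ =>
      cases hf
      exact ⟨_, rfl, ForestAutomaton.reads_tree.2
        ⟨r, hrM, Fin.ext (hr.trans hl.symm), hst, _, _, hx, hy', hfN⟩⟩
    | rank1 a c b => cases hf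
  case fullCtx =>
    obtain ⟨h₁, h₂, h₃, -⟩ := hb
    intro y N d hy hN hd
    have hl := h₁ y d hy hd
    obtain ⟨r, hrM, hr, hst, hj, hx, hy'⟩ := h₂ N hN
    obtain ⟨c, O, hc, hO, hcN⟩ := h₃ y _ d hy hj hd
    cases d with
    | rank0 a g _ => cases hc
    | rank1 a c b =>
      cases hc
      exact ⟨_, O, rfl, hO, ForestAutomaton.ctxReads_tree.2
        ⟨r, hrM, Fin.ext (hr.trans hl.symm), hst, _, _, hx, hy', hcN⟩⟩

theorem findsEnd_rhs {n : ℕ} (r : Rhs (CAConst (Fin x.σ)) Empty BinOp (Fin n)) :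
    FindsEnd topDagRule x.problem.word (.codeEnd .rhs)
      (encRhs encCAConst (fun e : Empty => e.elim) r) := by
  refine Problem.findsEnd_rhs (Q := x.problem) (fun k i rest h => ?_) (fun u => u.elim) r
  obtain ⟨b, u, v, hk⟩ : ∃ b u v, x.problem.encK k = b :: (encNat u ++ encNat v) := by
    cases k <;> exact ⟨_, _, _, rfl⟩
  rw [hk, List.append_assoc, List.cons_append, List.append_assoc] at h
  obtain ⟨j, _, _, _, h₁, h⟩ := exists_derivable_num (ext := topDagRule) h
  obtain ⟨l, _, _, _, h₂, h⟩ := exists_derivable_num (ext := topDagRule) (getElem?_of_drop h).2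
  obtain ⟨m, _, _, _, h₃, h⟩ := exists_derivable_num (ext := topDagRule) h
  exact ⟨m, ‹_›, ‹_›, derive_topDag .constEnd [i, j, u, l, v, m] (by simp; omega)
    ⟨h₁, h₂, h₃, trivial⟩, h⟩

variable {x}

theorem derivable_atom {y : Fin x.program.size} {a b : Fin x.σ}
    (hy : x.program.rhs y = .const (.atom a b)) :
    (a : ℕ) ≤ x.problem.word.length ∧ (b : ℕ) ≤ x.problem.word.length ∧
      Derivable (allRules topDagRule) x.problem.word .atom [y, a, b] := by
  obtain ⟨i, _, h₁, rest, h⟩ := Problem.exists_derivable_rhs (Q := x.problem)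
    (fun _ => findsEnd_rhs x _) y
  change _ = encRhs encCAConst (fun e : Empty => e.elim) (x.program.rhs y) ++ _ at h
  rw [hy, encRhs, encCAConst, List.append_assoc, List.cons_append, List.append_assoc] at h
  obtain ⟨j, _, _, _, h₂, h⟩ := exists_derivable_num (ext := topDagRule) h
  obtain ⟨hb, h⟩ := getElem?_of_drop h
  obtain ⟨k, _, _, _, h₃, h⟩ := exists_derivable_num (ext := topDagRule) h
  obtain ⟨l, _, _, _, h₄, h⟩ := exists_derivable_num (ext := topDagRule) h
  have := Problem.le_length_of_fin (Q := x.problem) y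
  exact ⟨‹_›, ‹_›, derive_topDag .atom [y, a, b, i, j, k, l] (by simp; omega)
    ⟨h₁, h₂, hb, h₃, h₄, trivial⟩⟩

theorem derivable_atomBot {y : Fin x.program.size} {a b : Fin x.σ}
    (hy : x.program.rhs y = .const (.atomBot a b)) :
    (a : ℕ) ≤ x.problem.word.length ∧ (b : ℕ) ≤ x.problem.word.length ∧
      Derivable (allRules topDagRule) x.problem.word .atomBot [y, a, b] := by
  obtain ⟨i, _, h₁, rest, h⟩ := Problem.exists_derivable_rhs (Q := x.problem)
    (fun _ => findsEnd_rhs x _) y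
  change _ = encRhs encCAConst (fun e : Empty => e.elim) (x.program.rhs y) ++ _ at h
  rw [hy, encRhs, encCAConst, List.append_assoc, List.cons_append, List.append_assoc] at h
  obtain ⟨j, _, _, _, h₂, h⟩ := exists_derivable_num (ext := topDagRule) h
  obtain ⟨hb, h⟩ := getElem?_of_drop h
  obtain ⟨k, _, _, _, h₃, h⟩ := exists_derivable_num (ext := topDagRule) h
  obtain ⟨l, _, _, _, h₄, h⟩ := exists_derivable_num (ext := topDagRule) h
  have := Problem.le_length_of_fin (Q := x.problem) y
  exact ⟨‹_›, ‹_›, derive_topDag .atomBot [y, a, b, i, j, k, l] (by simp; omega)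
    ⟨h₁, h₂, hb, h₃, h₄, trivial⟩⟩

theorem complete_full {A : ℕ} {d : Cluster (Fin x.σ)} (hA : A ≤ x.problem.word.length)
    (hl : Derivable (allRules topDagRule) x.problem.word .label [A, d.root])
    (h : Problem.Complete (Q := x.problem) topDagRule .forest .ctx A d.content) :
    Problem.Complete (Q := x.problem) topDagRule .fullForest .fullCtx A d.full := by
  cases d with
  | rank0 a f hf =>
    intro i N s t hN hs ht hf
    obtain ⟨j, N', p, q, hj, _, _, _, hp, hq, h₂, hf⟩ :=
      Problem.exists_derivable_treeStep topDagRule hN (ForestAutomaton.reads_tree.1 hf)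
    have := hN.le
    have := hj.le
    exact derive_topDag .fullForest [A, a, i, s, t, j, p, q] (by simp; omega)
      ⟨hl, h₂, h j N' p q hj hp hq hf, trivial⟩
  | rank1 a c b =>
    intro i N s t O p' q' hN hs ht hc
    obtain ⟨j, N', p, q, hj, _, _, _, hp, hq, h₂, hc⟩ :=
      Problem.exists_derivable_treeStep topDagRule hN (ForestAutomaton.ctxReads_tree.1 hc)
    have := Problem.ctxReads_le hj hp hq hc
    obtain ⟨k, hk, h₃⟩ := h j N' p q O p' q' hj hp hq hc
    have := hN.le
    have := hj.le
    have := hk.le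
    exact ⟨k, hk, derive_topDag .fullCtx [A, a, i, s, t, j, p, q, k, p', q'] (by simp; omega)
      ⟨hl, h₂, h₃, trivial⟩⟩

theorem complete {y : Fin x.program.size} {d : Cluster (Fin x.σ)}
    (h : x.program.HasValue (clusterAlgebra (Fin x.σ)) y d) :
    (d.root : ℕ) ≤ x.problem.word.length ∧
    Derivable (allRules topDagRule) x.problem.word .label [y, d.root] ∧
      Problem.Complete (Q := x.problem) topDagRule .forest .ctx y d.content := by
  have hr (y) := findsEnd_rhs x (x.program.rhs y)
  have hle (y) := Problem.le_length_of_fin (Q := x.problem) y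
  induction h with
  | @const y k hy =>
    have := hle y
    cases k with
    | atom a b =>
      obtain ⟨_, _, h₁⟩ := derivable_atom hy
      refine ⟨‹_›, derive_topDag .labelAtom [y, a, b] (by simp; omega) ⟨h₁, trivial⟩, ?_⟩
      intro i N s t hN hs ht hf
      obtain ⟨j, N', p, q, hj, _, _, _, hp, hq, h₂, rfl⟩ :=
        Problem.exists_derivable_treeStep topDagRule hN (ForestAutomaton.reads_tree.1 hf)
      have := hN.le
      have := hj.le
      exact derive_topDag .atomForest [y, a, b, i, s, t, j, p] (by simp; omega)
        ⟨h₁, h₂, trivial⟩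
    | atomBot a b =>
      obtain ⟨_, _, h₁⟩ := derivable_atomBot hy
      refine ⟨‹_›, derive_topDag .labelAtomBot [y, a, b] (by simp; omega) ⟨h₁, trivial⟩, ?_⟩
      rintro N _ s t _ _ _ hN hs ht ⟨rfl, rfl, rfl⟩
      have := hN.le
      exact ⟨N, hN, derive_topDag .atomCtx [y, a, b, N, _, _] (by simp; omega) ⟨h₁, trivial⟩⟩
  | @un y z u => exact u.elim
  | @bin y z z' o u v d hy _ _ hd ih₁ ih₂ =>
    obtain ⟨_, hl₁, h₁⟩ := ih₁
    obtain ⟨_, hl₂, h₂⟩ := ih₂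
    have := hle y
    have := hle z
    have := hle z'
    cases o with
    | hor =>
      obtain ⟨e, hc⟩ := Cluster.hmerge_eq_some hd
      rw [← e]
      exact ⟨‹_›, derive_topDag .labelHor [y, u.root, z, z'] (by simp; omega)
        ⟨Problem.derivable_hor (Q := x.problem) hr hy, hl₁, trivial⟩,
        Problem.complete_hor (Q := x.problem) hr hy h₁ h₂ hc⟩
    | ver =>
      obtain ⟨e, hc⟩ := Cluster.vmerge_eq_some hd
      rw [← e]
      exact ⟨‹_›, derive_topDag .labelVer [y, u.root, z, z'] (by simp; omega)
        ⟨Problem.derivable_ver (Q := x.problem) hr hy, hl₁, trivial⟩,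
        Problem.complete_ver (Q := x.problem) hr hy h₁ (complete_full (hle z') hl₂ h₂) hc⟩

theorem answer_iff_derivable (x : TopDagInput) :
    x.answer = true ↔ Derivable (allRules topDagRule) x.encode .accept [] := by
  obtain ⟨hf, hv⟩ := x.program.ground.choose_spec.choose_spec
  simp only [answer, decide_eq_true_eq]
  constructor
  · obtain ⟨_, hl, h⟩ := complete hv
    exact Problem.derivable_accept (Q := x.problem)
      (complete_full (Problem.le_length_of_fin (Q := x.problem) _) hl h)
  · intro h
    exact h _ (Problem.isModel_allRules (isModel_topDagRule x)) _ _ hv rfl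

end TopDagInput

end TopDag

theorem arityLE_allRules {κ : Type} {ext : κ → Datalog.Rule Pred Var}
    (h : ∀ i, (ext i).ArityLE 7) (i : CommonRule ⊕ κ) : (allRules ext i).ArityLE 7 := by
  cases i with
  | inl i => exact arityLE_commonRule i
  | inr i => exact h i

end ForestSLP

theorem mainTheorem10 :
    Nonempty (Turing.TM2ComputableInPolyTime ForestSLP.FSLPInput.encode Computability.encodeBool
      ForestSLP.FSLPInput.answer) ∧
    Nonempty (Turing.TM2ComputableInPolyTime ForestSLP.TopDagInput.encode Computability.encodeBool
      ForestSLP.TopDagInput.answer) :=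
  ⟨Datalog.polyTime_derivable _ .accept 7
      (ForestSLP.arityLE_allRules ForestSLP.arityLE_fslpRule) _ _
      ForestSLP.FSLPInput.answer_iff_derivable,
    Datalog.polyTime_derivable _ .accept 7
      (ForestSLP.arityLE_allRules ForestSLP.arityLE_topDagRule) _ _
      ForestSLP.TopDagInput.answer_iff_derivable⟩
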